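/- **Theorem 2 (Regret bound of RDA-UCB).** *Setting.* There are $n$ agents with weights $B_i>0$, $\sum_i B_i=1$, and $m$ item types with probabilities $s_j\ge 0$, $\sum_j s_j=1$. Agent $i$ has the unknown value $v_{i,j}$ for type $j$, and $l\le v_{i,j}\le h$ for all $i,j$, where $0<l$. In round $t=1,\dots,T$ an item of type $j(t)$, drawn from $(s_j)_j$ independently of the past, is given to an agent $i(t)$, who realizes the utility $u(t)=v_{i(t),j(t)}+\varepsilon_t$. The noise is sub-Gaussian: given the past, $j(t)$ and $i(t)$, $\mathbb E[e^{\lambda\varepsilon_t}]\le e^{\lambda^2\sigma^2/2}$ for all $\lambda\in\mathbb R$. Let $U_i(T)=\sum_{t\le T:\,i(t)=i}u(t)$ and $$\mathrm{NSW}(T)=\prod_i U_i(T)^{B_i},\qquad \mathrm{ONSW}=\max_x\prod_i\Big(\sum_j s_jv_{i,j}x_{i,j}\Big)^{B_i},\qquad \mathrm{Regret}(T)=T\cdot\mathrm{ONSW}-\mathrm{NSW}(T),$$ where the maximum is over $x_{i,j}\ge 0$ with $\sum_i x_{i,j}\le 1$ for all $j$, and a negative $U_i(T)$ is counted as $0$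 in $\mathrm{NSW}(T)$. *Algorithm.* Fix $\delta_0>0$ and $c\ge 2\sigma^2$ (for instance $c=1/2$ if $\sigma\le 1/2$). Write $\mathrm{Proj}_{[a,b]}(x)=\max(a,\min(b,x))$. RDA-UCB runs successive instances of dual averaging. At the start of an instance it freezes the matrix $$w_{i,j}=\mathrm{Proj}_{[l,h]}\Big(\hat v_{i,j}+\sqrt{c\log(T^2)/N_{i,j}}\Big),$$ where $N_{i,j}$ is the number of items of type $j$ that agent $i$ has received so far and $\hat v_{i,j}$ is the mean of the corresponding utilities ($w_{i,j}=h$ if $N_{i,j}=0$), and it sets $\bar u_i=0$ for all $i$. In the $\tau$-th round of the instance, $\beta_i=\mathrm{Proj}_{[B_i/(h(1+\delta_0)),\,(1+\delta_0)/l]}(B_i/\bar u_i)$ (with $B_i/0=+\infty$), the item, of type $j$, goes to an agent that maximizes $\beta_iw_{i,j}$ (ties are broken arbitrarily), and $\bar u_i$ is replaced by $\frac{\tau-1}{\tau}\bar u_i+\frac1\tau\mathbb 1[i\text{ is the winner}]\,w_{i,j}$. The instance ends as soon as the count $N_{i,j}$ of the pair just served reaches one of $2,4,8,\dots,2^{\lfloor\log_2T\rfloor}$,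 and a new instance begins. *Claim.* There are an absolute exponent $p$ and, for all $l,h,\delta_0,c$ as above, a constant $C=C(l,h,\delta_0,c)$ such that, for all $n,m,T\ge 1$ and all $B,s,v,\sigma$ as above, $\mathrm{Regret}(T)$ is integrable and $$\mathbb E[\mathrm{Regret}(T)]\le C\,\frac{n^2m^2}{(\min_iB_i)^2}\,\sqrt T\,(1+\log T)^p .$$ In particular, for $B_i=1/n$, $\mathbb E[\mathrm{Regret}(T)]\le C\,n^4m^2\sqrt T\,(1+\log T)^p=\tilde O(n^4m^2\sqrt T)$. -/

import Mathlib

open MeasureTheory ProbabilityTheory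

namespace FairDivision

noncomputable section

/-- The data the algorithm is given: the horizon `T`, the weights `B`, the range `[l, h]` of the
values, the slack `δ₀` of the projection in dual averaging, and the factor `c` of the confidence
width `√(c log (T²) / N)`. -/
structure Alg (n : ℕ) where
  T : ℕ
  B : Fin n → ℝ
  l : ℝ
  h : ℝ
  δ₀ : ℝ
  c : ℝ

/-- The memory of the algorithm at the beginning of a round. -/
structure Memory (n m : ℕ) where
  /-- number of items of each type that each agent has received so far -/
  count : Fin n → Fin m → ℕ
  /-- sum of the utilities observed so far for each pair (agent, type) -/
  total : Fin n → Fin m → ℝ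
  /-- the value matrix that is frozen during the current instance of dual averaging -/
  value : Fin n → Fin m → ℝ
  /-- number of rounds already played in the current instance -/
  iter : ℕ
  /-- mean utility of each agent in the current instance, in terms of the frozen values -/
  mean : Fin n → ℝ

/-- `Proj_[a,b] x`. -/
def proj (a b x : ℝ) : ℝ := max a (min b x)

namespace Alg

variable {n m : ℕ} (A : Alg n)

/-- The clipped upper confidence bound from `N` samples with the given sum; an unsampled pair has
the upper confidence bound `+∞`, clipped to `h`. -/
def ucb (N : ℕ) (total : ℝ) : ℝ :=
  if N = 0 then A.h
  else proj A.l A.h (total / N + Real.sqrt (A.c * Real.log ((A.T : ℝ) ^ 2) / N))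

/-- The multiplier of agent `i` in dual averaging when the current mean utility is `u`; for `u = 0`
the quotient `B i / u` is `+∞`, projected to the upper end of the interval. -/
def multiplier (i : Fin n) (u : ℝ) : ℝ :=
  if u = 0 then (1 + A.δ₀) / A.l
  else proj (A.B i / (A.h * (1 + A.δ₀))) ((1 + A.δ₀) / A.l) (A.B i / u)

/-- The bid of agent `i` for an item of type `j`. -/
def bid (M : Memory n m) (i : Fin n) (j : Fin m) : ℝ :=
  A.multiplier i (M.mean i) * M.value i j

/-- The memory before the first round. -/
def start : Memory n m where
  count := fun _ _ => 0
  total := fun _ _ => 0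
  value := fun _ _ => A.h
  iter := 0
  mean := fun _ => 0

/-- The update after an item of type `j` has gone to agent `i`, who realized the utility `u`: if the
count of the pair `(i, j)` has now reached one of `2, 4, 8, …`, a new instance of dual averaging is
started on the current clipped upper confidence bounds; otherwise the current instance goes on. -/
def step (M : Memory n m) (j : Fin m) (i : Fin n) (u : ℝ) : Memory n m :=
  let count' : Fin n → Fin m → ℕ :=
    fun a k => M.count a k + if a = i ∧ k = j then 1 else 0
  let total' : Fin n → Fin m → ℝ :=
    fun a k => M.total a k + if a = i ∧ k = j then u else 0
  if count' i j ∈ (Finset.Icc 1 (Nat.log 2 A.T)).image (fun p => 2 ^ p) then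
    { count := count'
      total := total'
      value := fun a k => A.ucb (count' a k) (total' a k)
      iter := 0
      mean := fun _ => 0 }
  else
    { count := count'
      total := total'
      value := M.value
      iter := M.iter + 1
      mean := fun a =>
        (M.iter : ℝ) / (M.iter + 1) * M.mean a
          + 1 / (M.iter + 1) * (if a = i then M.value i j else 0) }

/-- The memory at the beginning of round `t` (rounds are numbered `0, 1, …, T - 1`), given the types
`j`, the winners `i` and the realized utilities `u` of the rounds. -/
def memory (j : ℕ → Fin m) (i : ℕ → Fin n) (u : ℕ → ℝ) : ℕ → Memory n m
  | 0 => A.start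
  | t + 1 => A.step (memory j i u t) (j t) (i t) (u t)

end Alg

/-- The optimal value of the Eisenberg–Gale program: the supremum of
`∏ i, (∑ j, s j * v i j * x i j) ^ B i` over all fractional allocations `x`. -/
def onsw {n m : ℕ} (B : Fin n → ℝ) (s : Fin m → ℝ) (v : Fin n → Fin m → ℝ) : ℝ :=
  sSup {y : ℝ | ∃ x : Fin n → Fin m → ℝ,
    (∀ i j, 0 ≤ x i j) ∧ (∀ j, ∑ i, x i j ≤ 1) ∧
      y = ∏ i, (∑ j, s j * v i j * x i j) ^ B i}

section Run

variable {n m : ℕ} {Ω : Type*}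

/-- The realized utility of the winner of round `t`. -/
def utility (v : Fin n → Fin m → ℝ) (j : ℕ → Ω → Fin m) (i : ℕ → Ω → Fin n) (ε : ℕ → Ω → ℝ)
    (t : ℕ) (ω : Ω) : ℝ :=
  v (i t ω) (j t ω) + ε t ω

/-- The cumulative utility of agent `a` in the first `T` rounds. -/
def cumUtility (v : Fin n → Fin m → ℝ) (j : ℕ → Ω → Fin m) (i : ℕ → Ω → Fin n) (ε : ℕ → Ω → ℝ)
    (T : ℕ) (a : Fin n) (ω : Ω) : ℝ :=
  ∑ t ∈ Finset.range T, if i t ω = a then utility v j i ε t ω else 0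

/-- The ex post Nash social welfare. The noise may make a cumulative utility negative, where the
weighted geometric mean is not defined; such a utility counts as `0`. -/
def nsw (B : Fin n → ℝ) (U : Fin n → ℝ) : ℝ :=
  ∏ a, (max (U a) 0) ^ B a

/-- `Regret(T) = T * ONSW - NSW(T)`. -/
def regret (B : Fin n → ℝ) (s : Fin m → ℝ) (v : Fin n → Fin m → ℝ)
    (j : ℕ → Ω → Fin m) (i : ℕ → Ω → Fin n) (ε : ℕ → Ω → ℝ) (T : ℕ) (ω : Ω) : ℝ :=
  T * onsw B s v - nsw B (fun a => cumUtility v j i ε T a ω)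

/-- Everything that has happened before round `t`: types, winners, noises. -/
def past (j : ℕ → Ω → Fin m) (i : ℕ → Ω → Fin n) (ε : ℕ → Ω → ℝ) (t : ℕ) (ω : Ω) :
    Fin t → Fin m × Fin n × ℝ :=
  fun τ => (j τ ω, i τ ω, ε τ ω)

/-- The model and a run of the algorithm on it, for `A.T` rounds. The type of each round has law `s`
and is independent of the past (so the types are i.i.d.); the winner is a highest bidder, with
arbitrary tie-breaking; the noise of each round is `σ`-sub-Gaussian given the past and the type and
winner of this round (its law may depend on them). -/
structure IsRun [MeasurableSpace Ω] (μ : Measure Ω) (A : Alg n) (s : Fin m → ℝ)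
    (v : Fin n → Fin m → ℝ) (σ : ℝ)
    (j : ℕ → Ω → Fin m) (i : ℕ → Ω → Fin n) (ε : ℕ → Ω → ℝ) : Prop where
  measurable_type : ∀ t < A.T, Measurable (j t)
  measurable_winner : ∀ t < A.T, Measurable (i t)
  measurable_noise : ∀ t < A.T, Measurable (ε t)
  type_law : ∀ t < A.T, ∀ k, μ.real {ω | j t ω = k} = s k
  type_indep : ∀ t < A.T, IndepFun (j t) (past j i ε t) μ
  winner : ∀ᵐ ω ∂μ, ∀ t < A.T, ∀ a,
    let M : Memory n m :=
      A.memory (fun τ => j τ ω) (fun τ => i τ ω) (fun τ => utility v j i ε τ ω) t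
    A.bid M a (j t ω) ≤ A.bid M (i t ω) (j t ω)
  noise_integrable : ∀ t < A.T, ∀ r : ℝ, Integrable (fun ω => Real.exp (r * ε t ω)) μ
  noise_subgaussian : ∀ t < A.T, ∀ r : ℝ,
    μ[fun ω => Real.exp (r * ε t ω) |
        MeasurableSpace.comap (fun ω => (past j i ε t ω, j t ω, i t ω)) inferInstance]
      ≤ᵐ[μ] fun _ => Real.exp (r ^ 2 * σ ^ 2 / 2)

end Run

end

end FairDivision

/-! ### The extended logarithm: tangents, smoothness, gap -/

namespace FairDivision

/-! The regret is controlled by weak duality for the logarithm: log u ≤ log L + u/L − 1 for every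
level L > 0, with equality at L = u. Let x be an optimal allocation of the Eisenberg–Gale program
and u_a its utilities. Dual averaging uses the levels L_a = max(mean utility of a, floor_a), where
floor_a = B_a l/(1+δ₀), and its projected multiplier B_a/L_a is the derivative of B_a · `logExt` at
the mean. Since `logExt` has a Lipschitz derivative, the τ-th round of an instance raises τ ·
`logExt`(mean) by at least g/L + log L − 1, up to O(1/τ), where g is the gain of the round
(`logExt_mean_update`); concavity then combines the instances into one bound at the overall mean
(`sum_le_mul_logExt`).

If the frozen values dominate the true ones, the winning bid is at least the price that x would earn
on the same item (`shadowPrice_le`). The mean of that price over the types is Σ B_a u_a/L_a, and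
weak duality bounds it, with the logarithms of the levels, below by Σ B_a log u_a. So the frozen
utilities are nearly optimal, up to a martingale in the types and a harmonic sum per instance
(`sum_log_le`).

Restarting at powers of two keeps the binary logarithm of every count constant within an instance.
Hence there are O(nm log T) restarts, and a stale confidence bound is as good, up to a constant, as
a fresh one (`value_mem`): the overestimation of the served pairs adds up to nm√T times a
logarithmic factor (`sum_value_sub_le`). Realized and frozen utilities differ by this and by the
noise.

Near optimality for `logExt` is not yet near optimality for the welfare, because `logExt` is milder
than the logarithm below the floor. The equilibrium prices close this gap: they bound Σ B_a U_a/u_a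
by T plus errors, so the tangents at u_a nearly bound the objective by the optimum. As u_a ≥ B_a l =
(1+δ₀) floor_a, an agent below its floor would lose a fixed amount `logGap δ₀` against its tangent.
Then the error is at least of order min B and the trivial bound h on the optimum suffices
(`prod_rpow_sub_le`). This costs one factor 1/min B; the second comes from the smoothness constant
1/floor_a².

In expectation, the type martingales are O(√T) by orthogonality of increments, the noise sums are
O(√T) by an exponential supermartingale, and the confidence intervals fail with probability at most
2nm/T, where the regret is at most Th. -/

/-- The logarithm, continued below `a` by its tangent at `a`. -/
noncomputable def logExt (a x : ℝ) : ℝ := Real.log (max x a) + x / max x a - 1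

theorem logExt_of_le {a x : ℝ} (ha : 0 < a) (hx : a ≤ x) : logExt a x = Real.log x := by
  have : x ≠ 0 := (ha.trans_le hx).ne'
  rw [logExt, max_eq_left hx, div_self this]; ring

theorem logExt_of_ge {a x : ℝ} (hx : x ≤ a) : logExt a x = Real.log a + x / a - 1 := by
  rw [logExt, max_eq_right hx]

theorem one_sub_div_le_log_sub {x y : ℝ} (hx : 0 < x) (hy : 0 < y) :
    1 - x / y ≤ Real.log y - Real.log x := by
  have h := Real.log_le_sub_one_of_pos (div_pos hx hy)
  rw [Real.log_div hx.ne' hy.ne'] at h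
  linarith

/-- By concavity every tangent touching at M ≥ a is a majorant; the one at `M = max x a` is exact.
This is the form in which both Jensen's inequality and weak duality are used. For x ≤ a, the slope
1/a is at least 1/M, so the gap only widens to the left of a. -/
theorem logExt_le {a x M : ℝ} (ha : 0 < a) (hM : a ≤ M) :
    logExt a x ≤ Real.log M + x / M - 1 := by
  have hM0 : 0 < M := ha.trans_le hM
  rcases le_total a x with hx | hx
  · rw [logExt_of_le ha hx]
    have := one_sub_div_le_log_sub (ha.trans_le hx) hM0
    linarith
  · rw [logExt_of_ge hx]
    have h1 := one_sub_div_le_log_sub ha hM0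
    have h2 : x / a - x / M ≤ 1 - a / M := by
      have : 1 - a / M - (x / a - x / M) = (a - x) * (M - a) / (a * M) := by field_simp
      have h3 : 0 ≤ (a - x) * (M - a) / (a * M) :=
        div_nonneg (mul_nonneg (by linarith) (by linarith)) (by positivity)
      linarith
    linarith

/-- Smoothness: the derivative `1 / max x a` is Lipschitz with constant 1/a², because clipping at a
is 1-Lipschitz. The plain logarithm has no such bound near 0, which is why it is continued linearly.
-/
theorem logExt_ge {a x y : ℝ} (ha : 0 < a) :
    logExt a x + (y - x) / max x a - (y - x) ^ 2 / a ^ 2 ≤ logExt a y := by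
  have hX : a ≤ max x a := le_max_right _ _
  have hY : a ≤ max y a := le_max_right _ _
  unfold logExt
  set X := max x a with hXd
  set Y := max y a with hYd
  have hX0 : 0 < X := ha.trans_le hX
  have hY0 : 0 < Y := ha.trans_le hY
  have h1 := one_sub_div_le_log_sub hX0 hY0
  have h2 : 1 - X / Y + y / Y - y / X = -((Y - X) * (y - X) / (X * Y)) := by field_simp; ring
  have h3 : (Y - X) * (y - X) ≤ (y - x) ^ 2 := by
    rcases le_total a y with hy | hy
    · rw [show Y = y from max_eq_left hy]
      rcases le_total a x with hx | hx
      · rw [show X = x from max_eq_left hx]; nlinarith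
      · rw [show X = a from max_eq_right hx]; nlinarith
    · rw [show Y = a from max_eq_right hy]
      rcases le_total a x with hx | hx
      · rw [show X = x from max_eq_left hx]; nlinarith
      · rw [show X = a from max_eq_right hx]; nlinarith
  have h4 : (Y - X) * (y - X) / (X * Y) ≤ (y - x) ^ 2 / a ^ 2 := by
    refine (div_le_div_of_nonneg_right h3 (by positivity)).trans ?_
    exact div_le_div_of_nonneg_left (sq_nonneg _) (by positivity) (by nlinarith)
  have h5 : (y - x) / X = y / X - x / X := sub_div _ _ _
  linarith

/-- The slope never exceeds 1/a. It transfers the bound from frozen to realized utilities, which the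
noise may even make negative. -/
theorem logExt_le_add {a x y : ℝ} (ha : 0 < a) : logExt a y ≤ logExt a x + |y - x| / a := by
  have h := logExt_le (x := y) ha (le_max_right x a)
  have hX : a ≤ max x a := le_max_right _ _
  have h1 : (y - x) / max x a ≤ |y - x| / a :=
    (div_le_div_of_nonneg_right (le_abs_self _) (ha.le.trans hX)).trans
      (div_le_div_of_nonneg_left (abs_nonneg _) ha hX)
  have h5 : (y - x) / max x a = y / max x a - x / max x a := sub_div _ _ _
  unfold logExt at *
  linarith

/-- The gap between the logarithm and its tangent at a point beyond the factor `1 + δ`. -/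
noncomputable def logGap (δ : ℝ) : ℝ := Real.log (1 + δ) - 1 + 1 / (1 + δ)

theorem logGap_pos {δ : ℝ} (hδ : 0 < δ) : 0 < logGap δ := by
  have h := Real.log_lt_sub_one_of_pos (x := 1 / (1 + δ)) (by positivity)
    (by rw [Ne, div_eq_one_iff_eq (by positivity)]; linarith)
  rw [one_div, Real.log_inv] at h
  unfold logGap
  rw [one_div]; linarith

/-- The distance to the tangent at M grows as x moves left and as M moves right, so it is smallest
at x = a, M = a(1+δ), where it equals `logGap δ`. -/
theorem logExt_le_sub_gap {a x M δ : ℝ} (ha : 0 < a) (hδ : 0 < δ) (hM : a * (1 + δ) ≤ M)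
    (hx : x ≤ a) : logExt a x ≤ Real.log M + x / M - 1 - logGap δ := by
  have hd : 0 < 1 + δ := by linarith
  have hM' : 0 < M := lt_of_lt_of_le (by positivity) hM
  rw [logExt_of_ge hx, logGap]
  have h1 := one_sub_div_le_log_sub (x := a * (1 + δ)) (by positivity) hM'
  rw [Real.log_mul ha.ne' hd.ne'] at h1
  have h2 : (1 - a * (1 + δ) / M) + 1 - 1 / (1 + δ) - (x / a - x / M)
      = (a - x) * (M - a) / (a * M) + δ * (M - a * (1 + δ)) / (M * (1 + δ)) := by
    field_simp; ring
  have h3 : 0 ≤ (a - x) * (M - a) / (a * M) :=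
    div_nonneg (mul_nonneg (by linarith) (by nlinarith)) (by positivity)
  have h4 : 0 ≤ δ * (M - a * (1 + δ)) / (M * (1 + δ)) :=
    div_nonneg (mul_nonneg hδ.le (by linarith)) (by positivity)
  linarith

end FairDivision

/-! ### The Eisenberg–Gale program: optimum, first order condition, prices -/

namespace FairDivision

/-- The fractional allocations. -/
def IsAllocation {n m : ℕ} (x : Fin n → Fin m → ℝ) : Prop :=
  (∀ i j, 0 ≤ x i j) ∧ ∀ j, ∑ i, x i j ≤ 1

/-- The expected utility of agent `i` in the allocation `x`. -/
def allocUtility {n m : ℕ} (s : Fin m → ℝ) (v x : Fin n → Fin m → ℝ) (i : Fin n) : ℝ :=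
  ∑ j, s j * v i j * x i j

variable {n m : ℕ} {B : Fin n → ℝ} {s : Fin m → ℝ} {v : Fin n → Fin m → ℝ} {l h : ℝ}

theorem IsAllocation.le_one {x : Fin n → Fin m → ℝ} (hx : IsAllocation x) (i : Fin n)
    (j : Fin m) : x i j ≤ 1 :=
  (Finset.single_le_sum (f := fun i => x i j) (fun i _ => hx.1 i j) (Finset.mem_univ i)).trans
    (hx.2 j)

theorem isCompact_isAllocation : IsCompact {x : Fin n → Fin m → ℝ | IsAllocation x} := by
  refine IsCompact.of_isClosed_subset (isCompact_Icc (a := 0) (b := 1)) ?_ ?_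
  · have : {x : Fin n → Fin m → ℝ | IsAllocation x}
        = (⋂ i, ⋂ j, {x | 0 ≤ x i j}) ∩ ⋂ j, {x | ∑ i, x i j ≤ 1} := by
      ext x; simp [IsAllocation]
    rw [this]
    refine IsClosed.inter (isClosed_iInter fun i => isClosed_iInter fun j => ?_)
      (isClosed_iInter fun j => ?_)
    · exact isClosed_le (by fun_prop) (by fun_prop)
    · exact isClosed_le (by fun_prop) (by fun_prop)
  · intro x hx
    exact ⟨fun i j => hx.1 i j, fun i j => hx.le_one i j⟩

theorem allocUtility_nonneg (hs : ∀ j, 0 ≤ s j) (hv : ∀ i j, 0 ≤ v i j)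
    {x : Fin n → Fin m → ℝ} (hx : IsAllocation x) (i : Fin n) : 0 ≤ allocUtility s v x i :=
  Finset.sum_nonneg fun j _ => mul_nonneg (mul_nonneg (hs j) (hv i j)) (hx.1 i j)

theorem allocUtility_le (hs : ∀ j, 0 ≤ s j) (hs1 : ∑ j, s j = 1) (hv0 : ∀ i j, 0 ≤ v i j)
    (hv : ∀ i j, v i j ≤ h)
    {x : Fin n → Fin m → ℝ} (hx : IsAllocation x) (i : Fin n) : allocUtility s v x i ≤ h := by
  calc allocUtility s v x i ≤ ∑ j, s j * h := by
        refine Finset.sum_le_sum fun j _ => ?_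
        have := mul_le_of_le_one_right (mul_nonneg (hs j) (hv0 i j)) (hx.le_one i j)
        exact this.trans (mul_le_mul_of_nonneg_left (hv i j) (hs j))
    _ = h := by rw [← Finset.sum_mul, hs1, one_mul]

/-- A maximizer of weighted logarithms along segments satisfies the first order condition. -/
theorem sum_weight_div_le_of_log_le (hB1 : ∑ i, B i = 1) {u y : Fin n → ℝ} (hu : ∀ i, 0 < u i)
    (hy : ∀ i, 0 ≤ y i) (hB : ∀ i, 0 < B i)
    (hmax : ∀ r : ℝ, 0 < r → r < 1 →
      ∑ i, B i * Real.log ((1 - r) * u i + r * y i) ≤ ∑ i, B i * Real.log (u i)) :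
    ∑ i, B i * (y i / u i) ≤ 1 := by
  -- The bound 1 − u/z ≤ log z − log u at the moved point z lets r cancel. The inequality then
  -- passes to the limit r → 0 by continuity, without differentiating the objective.
  have key : ∀ r : ℝ, 0 < r → r < 1 →
      ∑ i, B i * ((y i - u i) / ((1 - r) * u i + r * y i)) ≤ 0 := by
    intro r hr hr1
    have h1 : ∑ i, B i * (r * ((y i - u i) / ((1 - r) * u i + r * y i))) ≤ 0 := by
      have h2 : ∑ i, B i * (r * ((y i - u i) / ((1 - r) * u i + r * y i)))
          ≤ ∑ i, (B i * Real.log ((1 - r) * u i + r * y i) - B i * Real.log (u i)) := by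
        refine Finset.sum_le_sum fun i _ => ?_
        rw [← mul_sub]
        refine mul_le_mul_of_nonneg_left ?_ (hB i).le
        have hz : 0 < (1 - r) * u i + r * y i :=
          add_pos_of_pos_of_nonneg (mul_pos (by linarith) (hu i)) (mul_nonneg hr.le (hy i))
        refine le_trans (le_of_eq ?_) (one_sub_div_le_log_sub (hu i) hz)
        have hz' := hz.ne'
        rw [← mul_div_assoc, eq_sub_iff_add_eq, ← add_div, div_eq_one_iff_eq hz']
        ring
      rw [Finset.sum_sub_distrib] at h2
      linarith [hmax r hr hr1]
    have h3 : ∑ i, B i * (r * ((y i - u i) / ((1 - r) * u i + r * y i)))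
        = r * ∑ i, B i * ((y i - u i) / ((1 - r) * u i + r * y i)) := by
      rw [Finset.mul_sum]; exact Finset.sum_congr rfl fun i _ => by ring
    rw [h3] at h1
    exact nonpos_of_mul_nonpos_right h1 hr
  have hlim : Filter.Tendsto
      (fun r : ℝ => ∑ i, B i * ((y i - u i) / ((1 - r) * u i + r * y i)))
      (nhdsWithin 0 (Set.Ioi 0)) (nhds (∑ i, B i * ((y i - u i) / ((1 - 0) * u i + 0 * y i)))) := by
    refine Filter.Tendsto.mono_left ?_ nhdsWithin_le_nhds
    refine tendsto_finsetSum _ fun i _ => Filter.Tendsto.const_mul _ ?_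
    refine Filter.Tendsto.div tendsto_const_nhds ?_ (by simpa using (hu i).ne')
    have : Continuous fun r : ℝ => (1 - r) * u i + r * y i := by fun_prop
    exact this.tendsto 0
  have h0 := le_of_tendsto hlim (b := 0) (by
    filter_upwards [Ioo_mem_nhdsGT (show (0 : ℝ) < 1 by norm_num)] with r hr
    exact key r hr.1 hr.2)
  have h4 : ∑ i, B i * ((y i - u i) / ((1 - 0) * u i + 0 * y i))
      = ∑ i, B i * (y i / u i) - 1 := by
    rw [show (1 : ℝ) = ∑ i, B i from hB1.symm, ← Finset.sum_sub_distrib]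
    refine Finset.sum_congr rfl fun i _ => ?_
    rw [hB1, sub_zero, one_mul, zero_mul, add_zero, sub_div, div_self (hu i).ne']
    ring
  linarith

theorem log_prod_rpow {u : Fin n → ℝ} (hu : ∀ i, 0 < u i) :
    Real.log (∏ i, u i ^ B i) = ∑ i, B i * Real.log (u i) := by
  rw [Real.log_prod fun i _ => (Real.rpow_pos_of_pos (hu i) _).ne']
  exact Finset.sum_congr rfl fun i _ => Real.log_rpow (hu i) _

/-- The optimal allocation of the Eisenberg–Gale program exists, and satisfies the first order
condition. -/
theorem exists_optimal_allocation (hB : ∀ i, 0 < B i) (hB1 : ∑ i, B i = 1)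
    (hs : ∀ j, 0 ≤ s j) (hs1 : ∑ j, s j = 1) (hl : 0 < l) (hv : ∀ i j, l ≤ v i j) :
    ∃ x : Fin n → Fin m → ℝ, IsAllocation x ∧ (∀ i, 0 < allocUtility s v x i) ∧
      onsw B s v = ∏ i, allocUtility s v x i ^ B i ∧
      ∀ y, IsAllocation y → ∑ i, B i * (allocUtility s v y i / allocUtility s v x i) ≤ 1 := by
  have hv0 : ∀ i j, 0 ≤ v i j := fun i j => hl.le.trans (hv i j)
  have hn : n ≠ 0 := by rintro rfl; simp at hB1
  have hn0 : (0 : ℝ) < n := by positivity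
  have hunif : IsAllocation (fun (_ : Fin n) (_ : Fin m) => (1 : ℝ) / n) :=
    ⟨fun _ _ => by positivity, fun j => by simp [hn]⟩
  have hcont : Continuous fun x : Fin n → Fin m → ℝ => ∏ i, allocUtility s v x i ^ B i := by
    refine continuous_finsetProd _ fun i _ => ?_
    refine Continuous.rpow_const ?_ fun x => Or.inr (hB i).le
    unfold allocUtility; fun_prop
  obtain ⟨x, hx, hmax⟩ := isCompact_isAllocation.exists_isMaxOn ⟨_, hunif⟩ hcont.continuousOn
  have hx' : IsAllocation x := hx
  have hmax' : ∀ y, IsAllocation y →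
      ∏ i, allocUtility s v y i ^ B i ≤ ∏ i, allocUtility s v x i ^ B i := fun y hy => hmax hy
  -- The uniform allocation gives everyone at least l/n, so the maximum is positive and no utility
  -- vanishes at the optimum.
  have hpos : 0 < ∏ i, allocUtility s v x i ^ B i := by
    refine lt_of_lt_of_le ?_ (hmax' _ hunif)
    refine Finset.prod_pos fun i _ => Real.rpow_pos_of_pos ?_ _
    have : l * (1 / n) ≤ allocUtility s v (fun _ _ => (1 : ℝ) / n) i := by
      calc l * (1 / n) = ∑ j, s j * l * (1 / n) := by
            rw [← Finset.sum_mul, ← Finset.sum_mul, hs1, one_mul]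
        _ ≤ _ := Finset.sum_le_sum fun j _ => by
            have := mul_le_mul_of_nonneg_left (hv i j) (hs j)
            exact mul_le_mul_of_nonneg_right this (by positivity)
    exact lt_of_lt_of_le (by positivity) this
  have hupos : ∀ i, 0 < allocUtility s v x i := by
    intro i
    refine lt_of_le_of_ne (allocUtility_nonneg hs hv0 hx' i) fun h0 => hpos.ne' ?_
    exact Finset.prod_eq_zero (Finset.mem_univ i) (by rw [← h0, Real.zero_rpow (hB i).ne'])
  refine ⟨x, hx', hupos, ?_, fun y hy => ?_⟩
  · refine (IsGreatest.csSup_eq ⟨⟨x, hx'.1, hx'.2, rfl⟩, ?_⟩)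
    rintro _ ⟨y, hy0, hy1, rfl⟩
    exact hmax' y ⟨hy0, hy1⟩
  · refine sum_weight_div_le_of_log_le hB1 hupos (allocUtility_nonneg hs hv0 hy) hB ?_
    intro r hr hr1
    have hz : IsAllocation fun i j => (1 - r) * x i j + r * y i j := by
      refine ⟨fun i j => add_nonneg (mul_nonneg (by linarith) (hx'.1 i j))
        (mul_nonneg hr.le (hy.1 i j)), fun j => ?_⟩
      rw [Finset.sum_add_distrib, ← Finset.mul_sum, ← Finset.mul_sum]
      nlinarith [hx'.2 j, hy.2 j]
    have hzu : ∀ i, allocUtility s v (fun i j => (1 - r) * x i j + r * y i j) i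
        = (1 - r) * allocUtility s v x i + r * allocUtility s v y i := by
      intro i
      simp only [allocUtility, Finset.mul_sum, ← Finset.sum_add_distrib]
      exact Finset.sum_congr rfl fun j _ => by ring
    have hzpos : ∀ i, 0 < (1 - r) * allocUtility s v x i + r * allocUtility s v y i := fun i =>
      add_pos_of_pos_of_nonneg (mul_pos (by linarith) (hupos i))
        (mul_nonneg hr.le (allocUtility_nonneg hs hv0 hy i))
    have := hmax' _ hz
    simp only [hzu] at this
    rw [← log_prod_rpow hzpos, ← log_prod_rpow hupos]
    exact Real.log_le_log (Finset.prod_pos fun i _ => Real.rpow_pos_of_pos (hzpos i) _) this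

/-- Every agent gets at least its proportional share at the optimum. -/
theorem weight_mul_le_of_optimal (hB : ∀ i, 0 < B i)
    (hs : ∀ j, 0 ≤ s j) (hs1 : ∑ j, s j = 1) (hl : 0 < l) (hv : ∀ i j, l ≤ v i j)
    {u : Fin n → ℝ} (hu : ∀ i, 0 < u i)
    (hopt : ∀ y, IsAllocation y → ∑ i, B i * (allocUtility s v y i / u i) ≤ 1) (i : Fin n) :
    B i * l ≤ u i := by
  -- Test the first order condition with the allocation that gives everything to i, whose utility is
  -- then at least l.
  have hy : IsAllocation fun (a : Fin n) (_ : Fin m) => if a = i then (1 : ℝ) else 0 :=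
    ⟨fun a j => by dsimp only; split_ifs <;> norm_num, fun j => by simp⟩
  have h1 := hopt _ hy
  have h2 : B i * (l / u i) ≤ 1 := by
    refine le_trans ?_ ((Finset.single_le_sum (f := fun a => B a * (allocUtility s v
      (fun (a : Fin n) (_ : Fin m) => if a = i then (1 : ℝ) else 0) a / u a))
      (fun a _ => mul_nonneg (hB a).le (div_nonneg (allocUtility_nonneg hs
        (fun i j => hl.le.trans (hv i j)) hy a) (hu a).le)) (Finset.mem_univ i)).trans h1)
    refine mul_le_mul_of_nonneg_left (div_le_div_of_nonneg_right ?_ (hu i).le) (hB i).le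
    simp only [allocUtility, if_true, mul_one]
    calc l = ∑ j, s j * l := by rw [← Finset.sum_mul, hs1, one_mul]
      _ ≤ _ := Finset.sum_le_sum fun j _ => mul_le_mul_of_nonneg_left (hv i j) (hs j)
  rw [← mul_div_assoc, div_le_one (hu i)] at h2
  exact h2

/-- Equilibrium prices at the optimum. -/
theorem exists_prices (hB1 : ∑ i, B i = 1)
    {u : Fin n → ℝ}
    (hopt : ∀ y, IsAllocation y → ∑ i, B i * (allocUtility s v y i / u i) ≤ 1) :
    ∃ a : Fin m → Fin n, (∀ i j, B i * v i j / u i ≤ B (a j) * v (a j) j / u (a j)) ∧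
      ∑ j, s j * (B (a j) * v (a j) j / u (a j)) ≤ 1 := by
  have hn : n ≠ 0 := by rintro rfl; simp at hB1
  have : Nonempty (Fin n) := ⟨⟨0, Nat.pos_of_ne_zero hn⟩⟩
  choose a ha using fun j => Finite.exists_max fun i => B i * v i j / u i
  refine ⟨a, fun i j => ha j i, ?_⟩
  -- The price of a type is its largest weighted value; giving each type to an agent attaining it
  -- turns the first order condition into the bound on the mean price.
  have hy : IsAllocation fun (i : Fin n) (j : Fin m) => if i = a j then (1 : ℝ) else 0 :=
    ⟨fun a j => by dsimp only; split_ifs <;> norm_num, fun j => by simp⟩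
  refine le_trans (le_of_eq ?_) (hopt _ hy)
  have : ∀ i, B i * (allocUtility s v (fun (i : Fin n) (j : Fin m) =>
      if i = a j then (1 : ℝ) else 0) i / u i)
      = ∑ j, if i = a j then s j * (B i * v i j / u i) else 0 := by
    intro i
    rw [allocUtility, Finset.sum_div, Finset.mul_sum]
    refine Finset.sum_congr rfl fun j _ => ?_
    split_ifs <;> ring
  simp only [this]
  rw [Finset.sum_comm]
  exact Finset.sum_congr rfl fun j _ => by simp

theorem prod_rpow_le (hB : ∀ i, 0 < B i) (hB1 : ∑ i, B i = 1) {u : Fin n → ℝ}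
    (hu : ∀ i, 0 ≤ u i) (huh : ∀ i, u i ≤ h) (hh : 0 < h) : ∏ i, u i ^ B i ≤ h := by
  calc ∏ i, u i ^ B i ≤ ∏ i, h ^ B i := Finset.prod_le_prod
        (fun i _ => Real.rpow_nonneg (hu i) _)
        fun i _ => Real.rpow_le_rpow (hu i) (huh i) (hB i).le
    _ = h := by rw [← Real.rpow_sum_of_pos hh, hB1, Real.rpow_one]

end FairDivision

/-! ### Dual averaging with restarts along a fixed path -/

namespace FairDivision

theorem proj_mem {a b : ℝ} (hab : a ≤ b) (x : ℝ) : a ≤ proj a b x ∧ proj a b x ≤ b :=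
  ⟨le_max_left _ _, max_le hab (min_le_left _ _)⟩

theorem proj_mono {a b x y : ℝ} (hxy : x ≤ y) : proj a b x ≤ proj a b y :=
  max_le_max le_rfl (min_le_min le_rfl hxy)

theorem proj_of_mem {a b x : ℝ} (ha : a ≤ x) (hb : x ≤ b) : proj a b x = x := by
  rw [proj, min_eq_right hb, max_eq_right ha]

theorem proj_add_le {a b x r : ℝ} (ha : a ≤ x) (hr : 0 ≤ r) : proj a b (x + r) ≤ x + r :=
  max_le (by linarith) (min_le_right _ _)

namespace Alg

variable {n m : ℕ} (A : Alg n)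

/-- Whether serving the pair `(i, j)` ends the current instance. -/
def Restarts (M : Memory n m) (j : Fin m) (i : Fin n) : Prop :=
  M.count i j + 1 ∈ (Finset.Icc 1 (Nat.log 2 A.T)).image (fun p => 2 ^ p)

theorem step_count (M : Memory n m) (j : Fin m) (i : Fin n) (u : ℝ) (a : Fin n) (k : Fin m) :
    (A.step M j i u).count a k = M.count a k + if a = i ∧ k = j then 1 else 0 := by
  unfold step; dsimp only; rw [apply_ite Memory.count, ite_self]

theorem step_total (M : Memory n m) (j : Fin m) (i : Fin n) (u : ℝ) (a : Fin n) (k : Fin m) :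
    (A.step M j i u).total a k = M.total a k + if a = i ∧ k = j then u else 0 := by
  unfold step; dsimp only; rw [apply_ite Memory.total, ite_self]

theorem step_of_restarts {M : Memory n m} {j : Fin m} {i : Fin n} (u : ℝ)
    (hr : A.Restarts M j i) :
    (A.step M j i u).iter = 0 ∧ (∀ a, (A.step M j i u).mean a = 0) ∧
    ∀ a k, (A.step M j i u).value a k
      = A.ucb ((A.step M j i u).count a k) ((A.step M j i u).total a k) := by
  unfold Restarts at hr
  unfold step; dsimp only
  rw [if_pos (by simpa using hr)]
  exact ⟨rfl, fun _ => rfl, fun _ _ => rfl⟩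

theorem step_of_not_restarts {M : Memory n m} {j : Fin m} {i : Fin n} (u : ℝ)
    (hr : ¬ A.Restarts M j i) :
    (A.step M j i u).iter = M.iter + 1 ∧
    (∀ a, (A.step M j i u).mean a = (M.iter : ℝ) / (M.iter + 1) * M.mean a
          + 1 / (M.iter + 1) * (if a = i then M.value i j else 0)) ∧
    (A.step M j i u).value = M.value := by
  unfold Restarts at hr
  unfold step; dsimp only
  rw [if_neg (by simpa using hr)]
  exact ⟨rfl, fun _ => rfl, rfl⟩

/-- The smallest mean utility at which the multiplier of agent `i` is not truncated. -/
noncomputable def floor (i : Fin n) : ℝ := A.B i * A.l / (1 + A.δ₀)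

/-- The mean utility that the multiplier of agent `i` is based on. -/
noncomputable def level (M : Memory n m) (i : Fin n) : ℝ := max (M.mean i) (A.floor i)

/-- The frozen value that agent `a` obtains from the item of type `j` if it goes to `i`. -/
def gain (M : Memory n m) (j : Fin m) (i a : Fin n) : ℝ := if a = i then M.value i j else 0

/-- The parameters are admissible. -/
structure Valid : Prop where
  l_pos : 0 < A.l
  l_le_h : A.l ≤ A.h
  δ₀_pos : 0 < A.δ₀
  B_pos : ∀ i, 0 < A.B i
  B_le_one : ∀ i, A.B i ≤ 1

variable {A}

theorem Valid.h_pos (hA : A.Valid) : 0 < A.h := hA.l_pos.trans_le hA.l_le_h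

theorem Valid.floor_pos (hA : A.Valid) (i : Fin n) : 0 < A.floor i :=
  div_pos (mul_pos (hA.B_pos i) hA.l_pos) (by linarith [hA.δ₀_pos])

theorem Valid.floor_le (hA : A.Valid) (i : Fin n) : A.floor i ≤ A.h := by
  have := hA.δ₀_pos
  have := hA.l_pos
  unfold floor
  rw [div_le_iff₀ (by linarith)]
  nlinarith [hA.l_le_h, hA.B_le_one i, hA.B_pos i]

theorem Valid.level_pos (hA : A.Valid) (M : Memory n m) (i : Fin n) : 0 < A.level M i :=
  (hA.floor_pos i).trans_le (le_max_right _ _)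

theorem Valid.ucb_mem (hA : A.Valid) (N : ℕ) (x : ℝ) : A.l ≤ A.ucb N x ∧ A.ucb N x ≤ A.h := by
  unfold ucb
  split_ifs
  · exact ⟨hA.l_le_h, le_rfl⟩
  · exact proj_mem hA.l_le_h _

/-- The projected multiplier is the derivative of B_i times `logExt` with threshold `A.floor i`. The
upper end of the interval is B_i/floor_i, which also covers u = 0; the lower end is never active,
since neither u nor the floor exceeds h. -/
theorem Valid.multiplier_eq (hA : A.Valid) (i : Fin n) {u : ℝ} (hu : 0 ≤ u) (huh : u ≤ A.h) :
    A.multiplier i u = A.B i / max u (A.floor i) := by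
  have hδ := hA.δ₀_pos
  have hl := hA.l_pos
  have hB := hA.B_pos i
  have hf := hA.floor_pos i
  have hh := hA.h_pos
  have hhi : (1 + A.δ₀) / A.l = A.B i / A.floor i := by
    unfold floor; field_simp
  unfold multiplier
  split_ifs with h0
  · rw [h0, max_eq_right hf.le, hhi]
  · have hu0 : 0 < u := lt_of_le_of_ne hu (Ne.symm h0)
    rw [proj, hhi]
    have h1 : min (A.B i / A.floor i) (A.B i / u) = A.B i / max u (A.floor i) := by
      rcases le_total u (A.floor i) with h | h
      · rw [max_eq_right h, min_eq_left (div_le_div_of_nonneg_left hB.le hu0 h)]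
      · rw [max_eq_left h, min_eq_right (div_le_div_of_nonneg_left hB.le hf h)]
    rw [h1, max_eq_right]
    refine div_le_div_of_nonneg_left hB.le (lt_of_lt_of_le hf (le_max_right _ _)) ?_
    have := max_le huh (hA.floor_le i)
    nlinarith

/-- The ranges of the frozen values and the mean utilities. -/
structure Bounded (A : Alg n) (M : Memory n m) : Prop where
  le_value : ∀ a k, A.l ≤ M.value a k
  value_le : ∀ a k, M.value a k ≤ A.h
  mean_nonneg : ∀ a, 0 ≤ M.mean a
  mean_le : ∀ a, M.mean a ≤ A.h

theorem Bounded.gain_nonneg (hA : A.Valid) {M : Memory n m} (hM : A.Bounded M) (j : Fin m)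
    (i a : Fin n) : 0 ≤ gain M j i a := by
  unfold gain; split_ifs
  · exact hA.l_pos.le.trans (hM.le_value _ _)
  · exact le_rfl

theorem Bounded.gain_le (hA : A.Valid) {M : Memory n m} (hM : A.Bounded M) (j : Fin m)
    (i a : Fin n) : gain M j i a ≤ A.h := by
  unfold gain; split_ifs
  · exact hM.value_le _ _
  · exact hA.h_pos.le

theorem Bounded.bid_eq (hA : A.Valid) {M : Memory n m} (hM : A.Bounded M) (j : Fin m)
    (a : Fin n) : A.bid M a j = A.B a / A.level M a * M.value a j := by
  rw [bid, hA.multiplier_eq a (hM.mean_nonneg a) (hM.mean_le a), level]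

theorem start_bounded (hA : A.Valid) : A.Bounded (A.start : Memory n m) where
  le_value _ _ := hA.l_le_h
  value_le _ _ := le_rfl
  mean_nonneg _ := le_rfl
  mean_le _ := hA.h_pos.le

theorem Bounded.step (hA : A.Valid) {M : Memory n m} (hM : A.Bounded M) (j : Fin m) (i : Fin n)
    (u : ℝ) : A.Bounded (A.step M j i u) := by
  by_cases hr : A.Restarts M j i
  · obtain ⟨-, h2, h3⟩ := A.step_of_restarts u hr
    exact ⟨fun a k => h3 a k ▸ (hA.ucb_mem _ _).1, fun a k => h3 a k ▸ (hA.ucb_mem _ _).2,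
      fun a => (h2 a).ge, fun a => (h2 a).le.trans hA.h_pos.le⟩
  · obtain ⟨-, h2, h3⟩ := A.step_of_not_restarts u hr
    have hi : (0 : ℝ) < (M.iter : ℝ) + 1 := by positivity
    refine ⟨fun a k => h3 ▸ hM.le_value a k, fun a k => h3 ▸ hM.value_le a k, fun a => ?_,
      fun a => ?_⟩
    · rw [h2 a]
      exact add_nonneg (mul_nonneg (by positivity) (hM.mean_nonneg a))
        (mul_nonneg (by positivity) (hM.gain_nonneg hA j i a))
    · rw [h2 a]
      calc (M.iter : ℝ) / (M.iter + 1) * M.mean a + 1 / (M.iter + 1) * gain M j i a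
          ≤ (M.iter : ℝ) / (M.iter + 1) * A.h + 1 / (M.iter + 1) * A.h :=
            add_le_add (mul_le_mul_of_nonneg_left (hM.mean_le a) (by positivity))
              (mul_le_mul_of_nonneg_left (hM.gain_le hA j i a) (by positivity))
        _ = A.h := by field_simp

theorem memory_bounded (hA : A.Valid) (j : ℕ → Fin m) (i : ℕ → Fin n) (u : ℕ → ℝ) (t : ℕ) :
    A.Bounded (A.memory j i u t) := by
  induction t with
  | zero => exact start_bounded hA
  | succ t ih => exact ih.step hA _ _ _

theorem memory_count_le (j : ℕ → Fin m) (i : ℕ → Fin n) (u : ℕ → ℝ) (t : ℕ) (a : Fin n)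
    (k : Fin m) : (A.memory j i u t).count a k ≤ t := by
  induction t with
  | zero => exact le_rfl
  | succ t ih =>
    rw [memory, step_count]
    split_ifs <;> omega

theorem memory_iter_le (j : ℕ → Fin m) (i : ℕ → Fin n) (u : ℕ → ℝ) (t : ℕ) :
    (A.memory j i u t).iter ≤ t := by
  induction t with
  | zero => exact le_rfl
  | succ t ih =>
    rw [memory]
    by_cases hr : A.Restarts (A.memory j i u t) (j t) (i t)
    · rw [(A.step_of_restarts _ hr).1]; omega
    · rw [(A.step_of_not_restarts _ hr).1]; omega

/-- Dual averaging on one coordinate: a round increases the potential `τ * logExt` by at least the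
linear terms, up to an error of order `1 / τ`. -/
theorem logExt_mean_update {a x g H : ℝ} (ha : 0 < a) (hx : 0 ≤ x) (hxH : x ≤ H) (hg : 0 ≤ g)
    (hgH : g ≤ H) (N : ℕ) :
    N * logExt a x + (g / max x a + Real.log (max x a) - 1 - H ^ 2 / (a ^ 2 * (N + 1)))
      ≤ (N + 1) * logExt a ((N : ℝ) / (N + 1) * x + 1 / (N + 1) * g) := by
  have hN : (0 : ℝ) < (N : ℝ) + 1 := by positivity
  set y := (N : ℝ) / (N + 1) * x + 1 / (N + 1) * g with hy
  -- Averaging makes a step of size 1/(N+1). Multiplying the smoothness bound by N+1 therefore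
  -- leaves the full linear term (g − x)/max(x, a) but only 1/(N+1) of the quadratic error.
  have hyx : y - x = (g - x) / (N + 1) := by rw [hy]; field_simp; ring
  have h := mul_le_mul_of_nonneg_left (logExt_ge (x := x) (y := y) ha) hN.le
  rw [hyx] at h
  have hX : 0 < max x a := ha.trans_le (le_max_right _ _)
  have h1 : ((N : ℝ) + 1) * (logExt a x + (g - x) / (N + 1) / max x a
      - ((g - x) / (N + 1)) ^ 2 / a ^ 2)
      = N * logExt a x + (logExt a x + (g - x) / max x a) - (g - x) ^ 2 / (a ^ 2 * (N + 1)) := by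
    field_simp
    ring
  have h2 : logExt a x + (g - x) / max x a = g / max x a + Real.log (max x a) - 1 := by
    rw [logExt, sub_div]; ring
  have h3 : (g - x) ^ 2 / (a ^ 2 * (N + 1)) ≤ H ^ 2 / (a ^ 2 * (N + 1)) := by
    refine div_le_div_of_nonneg_right ?_ (by positivity)
    exact sq_le_sq' (by linarith) (by linarith)
  linarith

/-- The potential inequality of restarted dual averaging, for one agent. -/
theorem sum_le_mul_logExt (hA : A.Valid) (j : ℕ → Fin m) (i : ℕ → Fin n) (u : ℕ → ℝ) (a : Fin n)
    {T : ℕ} (hT : 0 < T) :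
    ∑ t ∈ Finset.range T, (gain (A.memory j i u t) (j t) (i t) a / A.level (A.memory j i u t) a
        + Real.log (A.level (A.memory j i u t) a) - 1
        - A.h ^ 2 / (A.floor a ^ 2 * ((A.memory j i u t).iter + 1)))
      ≤ T * logExt (A.floor a)
        ((∑ t ∈ Finset.range T, gain (A.memory j i u t) (j t) (i t) a) / T) := by
  have hf := hA.floor_pos a
  -- Invariant with a free level L: the completed instances are accounted for by the tangent at L,
  -- which is linear in their lengths and gains and so can be added up; the running instance keeps
  -- its exact potential.
  have key : ∀ L : ℝ, A.floor a ≤ L → ∀ t : ℕ,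
      ∑ t ∈ Finset.range t, (gain (A.memory j i u t) (j t) (i t) a / A.level (A.memory j i u t) a
        + Real.log (A.level (A.memory j i u t) a) - 1
        - A.h ^ 2 / (A.floor a ^ 2 * ((A.memory j i u t).iter + 1)))
      ≤ (t - (A.memory j i u t).iter) * (Real.log L - 1)
        + (∑ t ∈ Finset.range t, gain (A.memory j i u t) (j t) (i t) a
          - (A.memory j i u t).iter * (A.memory j i u t).mean a) / L
        + (A.memory j i u t).iter * logExt (A.floor a) ((A.memory j i u t).mean a) := by
    intro L hL t
    have hL0 := hf.trans_le hL
    induction t with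
    | zero => simp [memory, start]
    | succ t ih =>
      rw [Finset.sum_range_succ, Finset.sum_range_succ _ t]
      have hb := memory_bounded hA j i u t
      rw [memory]
      set M := A.memory j i u t with hM
      have hup := logExt_mean_update (a := A.floor a) hf (hb.mean_nonneg a) (hb.mean_le a)
        (hb.gain_nonneg hA (j t) (i t) a) (hb.gain_le hA (j t) (i t) a) M.iter
      have hN : (0 : ℝ) < (M.iter : ℝ) + 1 := by positivity
      have hy : ((M.iter : ℝ) + 1) * ((M.iter : ℝ) / (M.iter + 1) * M.mean a
          + 1 / (M.iter + 1) * gain M (j t) (i t) a)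
          = M.iter * M.mean a + gain M (j t) (i t) a := by field_simp
      change _ + (gain M (j t) (i t) a / A.level M a + Real.log (A.level M a) - 1 - _) ≤ _
      change _ + (gain M (j t) (i t) a / A.level M a + Real.log (A.level M a) - 1 - _) ≤ _ at hup
      -- At a restart the potential of the closing instance is exchanged for its tangent majorant at
      -- L; otherwise the potential simply grows by the one-round bound.
      by_cases hr : A.Restarts M (j t) (i t)
      · obtain ⟨h1, h2, -⟩ := A.step_of_restarts (u t) hr
        rw [h1, h2]
        have hle := mul_le_mul_of_nonneg_left (logExt_le
          (x := (M.iter : ℝ) / (M.iter + 1) * M.mean a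
            + 1 / (M.iter + 1) * gain M (j t) (i t) a) hf hL) hN.le
        rw [mul_sub, mul_add, ← mul_div_assoc, hy] at hle
        rw [sub_div] at ih
        rw [add_div] at hle
        push_cast
        simp only [zero_mul, sub_zero, add_zero, add_div]
        linarith
      · obtain ⟨h1, h2, -⟩ := A.step_of_not_restarts (u t) hr
        rw [h1, h2]
        push_cast
        change _ ≤ _ + (_ - ((M.iter : ℝ) + 1) * ((M.iter : ℝ) / (M.iter + 1) * M.mean a
            + 1 / (M.iter + 1) * gain M (j t) (i t) a)) / L + ((M.iter : ℝ) + 1) *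
            logExt (A.floor a) ((M.iter : ℝ) / (M.iter + 1) * M.mean a
            + 1 / (M.iter + 1) * gain M (j t) (i t) a)
        rw [hy, add_sub_add_right_eq_sub, add_sub_add_right_eq_sub]
        linarith
  set V := ∑ t ∈ Finset.range T, gain (A.memory j i u t) (j t) (i t) a with hV
  have hT0 : (0 : ℝ) < T := by exact_mod_cast hT
  -- The tangent at this level touches `logExt` at the overall mean V/T, so the collected linear
  -- majorants equal T · `logExt`(V/T) exactly.
  have hL : A.floor a ≤ max (V / T) (A.floor a) := le_max_right _ _
  have hL0 := hf.trans_le hL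
  refine (key _ hL T).trans ?_
  set M := A.memory j i u T with hM
  have hle := mul_le_mul_of_nonneg_left (logExt_le (x := M.mean a) hf hL)
    (Nat.cast_nonneg (α := ℝ) M.iter)
  rw [mul_sub, mul_add, ← mul_div_assoc] at hle
  rw [sub_div]
  have : (T : ℝ) * logExt (A.floor a) (V / T)
      = T * (Real.log (max (V / T) (A.floor a)) - 1) + V / max (V / T) (A.floor a) := by
    rw [logExt]
    field_simp
    ring
  rw [this]
  linarith

end Alg
end FairDivision

/-! ### Number and age of the instances -/

namespace FairDivision
namespace Alg

variable {n m : ℕ} {A : Alg n}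

/-- The new count is a power of two with positive exponent. Thus the sum of the binary logarithms of
all counts bounds the number of restarts. -/
theorem Restarts.log_lt {M : Memory n m} {j : Fin m} {i : Fin n} (hr : A.Restarts M j i) :
    Nat.log 2 (M.count i j) + 1 ≤ Nat.log 2 (M.count i j + 1) := by
  obtain ⟨p, hp, hpe⟩ := Finset.mem_image.1 hr
  have hp1 := (Finset.mem_Icc.1 hp).1
  rw [← hpe, Nat.log_pow (by norm_num)]
  exact Nat.log_lt_of_lt_pow' (by omega) (by omega)

/-- The binary logarithm changes only at a power 2, 4, 8, …, and the list of restarts contains all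
those up to T. A first sample does not restart, in agreement with `Nat.log 2 0 = Nat.log 2 1 = 0`.
-/
theorem log_eq_of_not_restarts {M : Memory n m} {j : Fin m} {i : Fin n}
    (hr : ¬ A.Restarts M j i) (hT : M.count i j + 1 ≤ A.T) :
    Nat.log 2 (M.count i j + 1) = Nat.log 2 (M.count i j) := by
  refine le_antisymm ?_ (Nat.log_mono_right (Nat.le_succ _))
  by_contra hlt
  push Not at hlt
  apply hr
  refine Finset.mem_image.2 ⟨Nat.log 2 (M.count i j + 1), Finset.mem_Icc.2
    ⟨by omega, Nat.log_mono_right hT⟩, ?_⟩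
  refine le_antisymm (Nat.pow_log_le_self 2 (by omega)) ?_
  by_contra h2
  push Not at h2
  exact absurd (Nat.le_log_of_pow_le (by norm_num) (Nat.lt_succ_iff.1 h2)) (by omega)

theorem step_count_self (M : Memory n m) (j : Fin m) (i : Fin n) (u : ℝ) :
    (A.step M j i u).count i j = M.count i j + 1 := by rw [step_count]; simp

theorem count_le_step_count (M : Memory n m) (j : Fin m) (i : Fin n) (u : ℝ) (a : Fin n)
    (k : Fin m) : M.count a k ≤ (A.step M j i u).count a k := by rw [step_count]; omega

theorem count_memory_mono (j : ℕ → Fin m) (i : ℕ → Fin n) (u : ℕ → ℝ) (a : Fin n) (k : Fin m) :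
    Monotone fun t => (A.memory j i u t).count a k :=
  monotone_nat_of_le_succ fun _ => count_le_step_count _ _ _ _ _ _

/-- Each completed instance is charged a whole harmonic sum of length T, and each completion raises
the sum of the binary logarithms by at least one. The running instance is charged only its own
harmonic sum. -/
theorem sum_inv_iter_le_aux (j : ℕ → Fin m) (i : ℕ → Fin n) (u : ℕ → ℝ) (t : ℕ) (ht : t ≤ A.T) :
    ∑ τ ∈ Finset.range t, 1 / (((A.memory j i u τ).iter : ℝ) + 1)
      ≤ (∑ p : Fin n × Fin m, Nat.log 2 ((A.memory j i u t).count p.1 p.2) : ℕ)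
          * (∑ q ∈ Finset.range A.T, 1 / ((q : ℝ) + 1))
        + ∑ q ∈ Finset.range (A.memory j i u t).iter, 1 / ((q : ℝ) + 1) := by
  induction t with
  | zero => simp [memory, start]
  | succ t ih =>
    have ih := ih (by omega)
    have hit := memory_iter_le (A := A) j i u t
    rw [Finset.sum_range_succ, memory]
    set M := A.memory j i u t
    have hH : 0 ≤ ∑ q ∈ Finset.range A.T, 1 / ((q : ℝ) + 1) :=
      Finset.sum_nonneg fun q _ => by positivity
    by_cases hr : A.Restarts M (j t) (i t)
    · rw [(A.step_of_restarts (u t) hr).1, Finset.sum_range_zero, add_zero]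
      have h1 : ∑ p : Fin n × Fin m, Nat.log 2 (M.count p.1 p.2) + 1
          ≤ ∑ p : Fin n × Fin m, Nat.log 2 ((A.step M (j t) (i t) (u t)).count p.1 p.2) := by
        refine Finset.sum_lt_sum (fun p _ => Nat.log_mono_right (count_le_step_count _ _ _ _ _ _))
          ⟨(i t, j t), Finset.mem_univ _, ?_⟩
        rw [step_count_self]
        exact hr.log_lt
      have h2 : ((∑ p : Fin n × Fin m, Nat.log 2 (M.count p.1 p.2) : ℕ) : ℝ) + 1
          ≤ (∑ p : Fin n × Fin m, Nat.log 2 ((A.step M (j t) (i t) (u t)).count p.1 p.2) : ℕ) := by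
        exact_mod_cast h1
      have h3 : ∑ q ∈ Finset.range M.iter, 1 / ((q : ℝ) + 1) + 1 / ((M.iter : ℝ) + 1)
          ≤ ∑ q ∈ Finset.range A.T, 1 / ((q : ℝ) + 1) := by
        rw [← Finset.sum_range_succ (fun q : ℕ => 1 / ((q : ℝ) + 1))]
        exact Finset.sum_le_sum_of_subset_of_nonneg
          (Finset.range_subset_range.2 (by omega)) fun q _ _ => by positivity
      have h4 := mul_le_mul_of_nonneg_right h2 hH
      linarith
    · rw [(A.step_of_not_restarts (u t) hr).1, Finset.sum_range_succ]
      have h1 : ((∑ p : Fin n × Fin m, Nat.log 2 (M.count p.1 p.2) : ℕ) : ℝ)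
          ≤ (∑ p : Fin n × Fin m, Nat.log 2 ((A.step M (j t) (i t) (u t)).count p.1 p.2) : ℕ) := by
        refine Nat.cast_le.2 (Finset.sum_le_sum fun p _ => ?_)
        exact Nat.log_mono_right (count_le_step_count _ _ _ _ _ _)
      have h4 := mul_le_mul_of_nonneg_right h1 hH
      linarith

theorem sum_one_div_le (T : ℕ) :
    ∑ q ∈ Finset.range T, 1 / ((q : ℝ) + 1) ≤ 1 + Real.log T := by
  have h := harmonic_le_one_add_log T
  rw [harmonic] at h
  push_cast at h
  simpa using h

theorem natLog_two_le (T : ℕ) (hT : 1 ≤ T) : (Nat.log 2 T : ℝ) ≤ 2 * Real.log T := by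
  have h1 : ((2 : ℝ) ^ Nat.log 2 T) ≤ T := by exact_mod_cast Nat.pow_log_le_self 2 (by omega)
  have h2 := Real.log_le_log (by positivity) h1
  rw [Real.log_pow] at h2
  have := Real.log_two_gt_d9
  nlinarith [(Nat.cast_nonneg (Nat.log 2 T) : (0 : ℝ) ≤ _)]

/-- The sum of the inverse ages of the instances. -/
theorem sum_inv_iter_le (j : ℕ → Fin m) (i : ℕ → Fin n) (u : ℕ → ℝ) (hT : 1 ≤ A.T) :
    ∑ τ ∈ Finset.range A.T, 1 / (((A.memory j i u τ).iter : ℝ) + 1)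
      ≤ 2 * (n * m) * (1 + Real.log A.T) ^ 2 := by
  refine (sum_inv_iter_le_aux j i u A.T le_rfl).trans ?_
  set L := Real.log A.T
  have hL : 0 ≤ L := Real.log_nonneg (by exact_mod_cast hT)
  have hH : 0 ≤ ∑ q ∈ Finset.range A.T, 1 / ((q : ℝ) + 1) :=
    Finset.sum_nonneg fun q _ => by positivity
  have h1 : ∑ q ∈ Finset.range A.T, 1 / ((q : ℝ) + 1) ≤ 1 + L := sum_one_div_le _
  have h2 : ∑ q ∈ Finset.range (A.memory j i u A.T).iter, 1 / ((q : ℝ) + 1) ≤ 1 + L :=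
    (Finset.sum_le_sum_of_subset_of_nonneg (Finset.range_subset_range.2
      (memory_iter_le j i u A.T)) fun q _ _ => by positivity).trans h1
  have h3 : ((∑ p : Fin n × Fin m, Nat.log 2 ((A.memory j i u A.T).count p.1 p.2) : ℕ) : ℝ)
      ≤ n * m * (2 * L) := by
    have : ∑ p : Fin n × Fin m, Nat.log 2 ((A.memory j i u A.T).count p.1 p.2)
        ≤ n * m * Nat.log 2 A.T := by
      refine (Finset.sum_le_card_nsmul _ _ (Nat.log 2 A.T) fun p _ =>
        Nat.log_mono_right (memory_count_le _ _ _ _ _ _)).trans ?_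
      simp
    have h4 : ((∑ p : Fin n × Fin m, Nat.log 2 ((A.memory j i u A.T).count p.1 p.2) : ℕ) : ℝ)
        ≤ n * m * Nat.log 2 A.T := by exact_mod_cast this
    exact h4.trans (mul_le_mul_of_nonneg_left (natLog_two_le _ hT) (by positivity))
  -- The path itself provides an agent and a type; nm ≥ 1 lets the running instance be absorbed into
  -- the product bound.
  have hnm : (1 : ℝ) ≤ n * m := by
    have h1 : 1 ≤ n := (i 0).pos
    have h2 : 1 ≤ m := (j 0).pos
    exact_mod_cast Nat.mul_pos h1 h2
  have h5 := mul_le_mul h3 h1 hH (by positivity)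
  nlinarith [mul_nonneg (sub_nonneg.2 hnm) hL, mul_nonneg (sub_nonneg.2 hnm) (sq_nonneg L)]

/-! ### Optimism of the frozen values and the total overestimation -/

section Confidence

variable {v : Fin n → Fin m → ℝ} {j : ℕ → Fin m} {i : ℕ → Fin n} {e : ℕ → ℝ}

/-- The realized utilities along a path. -/
def pathUtility (v : Fin n → Fin m → ℝ) (j : ℕ → Fin m) (i : ℕ → Fin n) (e : ℕ → ℝ) (t : ℕ) : ℝ :=
  v (i t) (j t) + e t

/-- The memory along a path with values `v` and noises `e`. -/
noncomputable def pathMemory (A : Alg n) (v : Fin n → Fin m → ℝ) (j : ℕ → Fin m) (i : ℕ → Fin n)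
    (e : ℕ → ℝ) : ℕ → Memory n m :=
  A.memory j i (pathUtility v j i e)

/-- The sum of the first `N` noises of the pair `(a, k)`. -/
noncomputable def sampleNoise (A : Alg n) (v : Fin n → Fin m → ℝ) (j : ℕ → Fin m) (i : ℕ → Fin n)
    (e : ℕ → ℝ) (a : Fin n) (k : Fin m) (N : ℕ) : ℝ :=
  ∑ t ∈ Finset.range A.T,
    if i t = a ∧ j t = k ∧ (A.pathMemory v j i e t).count a k < N then e t else 0

theorem total_memory (a : Fin n) (k : Fin m) (t : ℕ) :
    (A.pathMemory v j i e t).total a k = (A.pathMemory v j i e t).count a k * v a k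
      + ∑ τ ∈ Finset.range t, if i τ = a ∧ j τ = k then e τ else 0 := by
  induction t with
  | zero => simp [pathMemory, memory, start]
  | succ t ih =>
    unfold pathMemory at *
    rw [memory, step_total, step_count, ih, Finset.sum_range_succ]
    by_cases hc : a = i t ∧ k = j t
    · rw [if_pos hc, if_pos hc, if_pos ⟨hc.1.symm, hc.2.symm⟩, pathUtility, ← hc.1, ← hc.2]
      push_cast; ring
    · rw [if_neg hc, if_neg hc, if_neg fun h => hc ⟨h.1.symm, h.2.symm⟩]
      push_cast; ring

/-- The noise collected up to a time depends on a random number of samples. Reindexing by the sample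
count reduces it to the sums for fixed N, over which a union bound is possible. -/
theorem sum_noise_eq_sampleNoise (a : Fin n) (k : Fin m) {t : ℕ} (ht : t ≤ A.T) :
    (∑ τ ∈ Finset.range t, if i τ = a ∧ j τ = k then e τ else 0)
      = A.sampleNoise v j i e a k ((A.pathMemory v j i e t).count a k) := by
  have hmono := count_memory_mono (A := A) j i (pathUtility v j i e) a k
  unfold sampleNoise
  rw [← Finset.sum_subset (Finset.range_subset_range.2 ht)]
  · refine Finset.sum_congr rfl fun τ hτ => ?_
    have hτ := Finset.mem_range.1 hτ
    by_cases hc : i τ = a ∧ j τ = k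
    · have h1 : (A.pathMemory v j i e τ).count a k < (A.pathMemory v j i e t).count a k := by
        refine lt_of_lt_of_le ?_ (hmono (Nat.succ_le_of_lt hτ))
        dsimp only [pathMemory]
        rw [Nat.succ_eq_add_one, memory, ← hc.1, ← hc.2, step_count_self]
        exact Nat.lt_succ_self _
      rw [if_pos hc, if_pos ⟨hc.1, hc.2, h1⟩]
    · rw [if_neg hc, if_neg fun h => hc ⟨h.1, h.2.1⟩]
  · intro τ _ hτ
    have hτ : t ≤ τ := by simpa using hτ
    exact if_neg fun h => absurd (hmono hτ) (not_le.2 h.2.2)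

/-- All confidence intervals are valid. -/
def Confident (A : Alg n) (v : Fin n → Fin m → ℝ) (j : ℕ → Fin m) (i : ℕ → Fin n)
    (e : ℕ → ℝ) : Prop :=
  ∀ a k N, 1 ≤ N → N ≤ A.T → |A.sampleNoise v j i e a k N|
    ≤ Real.sqrt (A.c * Real.log ((A.T : ℝ) ^ 2)) * Real.sqrt N

/-- The scale of the confidence width. -/
noncomputable def width (A : Alg n) : ℝ := A.h + 2 * Real.sqrt (A.c * Real.log ((A.T : ℝ) ^ 2))

theorem Valid.width_pos (hA : A.Valid) : 0 < A.width :=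
  add_pos_of_pos_of_nonneg hA.h_pos (by positivity)

/-- The range of a clipped upper confidence bound when the confidence interval is valid. -/
theorem ucb_mem_of_abs_le (hA : A.Valid) {x : ℝ} (hx : A.l ≤ x) (hxh : x ≤ A.h) {N : ℕ} {S : ℝ}
    (hS : 1 ≤ N → |S| ≤ Real.sqrt (A.c * Real.log ((A.T : ℝ) ^ 2)) * Real.sqrt N) :
    x ≤ A.ucb N (N * x + S) ∧
      A.ucb N (N * x + S) ≤ x + A.width / Real.sqrt (2 ^ Nat.log 2 N) := by
  have hx0 := hA.l_pos.trans_le hx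
  unfold ucb
  split_ifs with hN
  -- An unsampled pair has bound h, and `Nat.log 2 0 = 0` makes the allowed excess the whole
  -- `A.width`; this is the reason for the summand h in the width.
  · refine ⟨hxh, ?_⟩
    simp only [hN, Nat.log_zero_right, pow_zero, Real.sqrt_one, div_one]
    have : 0 ≤ 2 * Real.sqrt (A.c * Real.log ((A.T : ℝ) ^ 2)) := by positivity
    unfold width
    linarith
  · have hN1 : 1 ≤ N := Nat.one_le_iff_ne_zero.2 hN
    have hN0 : (0 : ℝ) < N := by exact_mod_cast hN1
    have hS := hS hN1
    set q := Real.sqrt (A.c * Real.log ((A.T : ℝ) ^ 2)) with hq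
    have hq0 : 0 ≤ q := Real.sqrt_nonneg _
    have hsN : 0 < Real.sqrt N := Real.sqrt_pos.2 hN0
    have h1 : Real.sqrt (A.c * Real.log ((A.T : ℝ) ^ 2) / N) = q / Real.sqrt N :=
      Real.sqrt_div' _ hN0.le
    have h2 : |S / N| ≤ q / Real.sqrt N := by
      rw [abs_div, abs_of_pos hN0, div_le_div_iff₀ hN0 hsN]
      nlinarith [Real.mul_self_sqrt hN0.le]
    have h3 : (N * x + S) / N = x + S / N := by field_simp
    rw [h1, h3]
    have h4 := abs_le.1 h2
    have h5 : q / Real.sqrt N ≤ q / Real.sqrt (2 ^ Nat.log 2 N) := by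
      refine div_le_div_of_nonneg_left hq0 (Real.sqrt_pos.2 (by positivity))
        (Real.sqrt_le_sqrt ?_)
      exact_mod_cast Nat.pow_log_le_self 2 hN
    constructor
    · calc x = proj A.l A.h x := (proj_of_mem hx hxh).symm
        _ ≤ _ := proj_mono (by linarith)
    · rw [add_assoc]
      refine (proj_add_le hx (by linarith)).trans ?_
      unfold width
      rw [add_div, mul_div_assoc]
      have : 0 ≤ A.h / Real.sqrt (2 ^ Nat.log 2 N) := div_nonneg hA.h_pos.le (Real.sqrt_nonneg _)
      linarith

/-- The value was frozen at the last restart, but the binary logarithm of every count has not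
changed since. Expressing the width by 2 to that logarithm makes the bound valid at the present
count. -/
theorem value_mem (hA : A.Valid) (hv : ∀ a k, A.l ≤ v a k ∧ v a k ≤ A.h)
    (hconf : A.Confident v j i e) (t : ℕ) (ht : t ≤ A.T) (a : Fin n) (k : Fin m) :
    v a k ≤ (A.pathMemory v j i e t).value a k ∧ (A.pathMemory v j i e t).value a k
      ≤ v a k + A.width / Real.sqrt (2 ^ Nat.log 2 ((A.pathMemory v j i e t).count a k)) := by
  induction t with
  | zero =>
    have := ucb_mem_of_abs_le hA (hv a k).1 (hv a k).2 (N := 0) (S := 0) (by simp)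
    simpa [pathMemory, memory, start, ucb] using this
  | succ t ih =>
    have ih := ih (by omega)
    by_cases hr : A.Restarts (A.pathMemory v j i e t) (j t) (i t)
    · have h3 := (A.step_of_restarts (pathUtility v j i e t) hr).2.2 a k
      change (A.pathMemory v j i e (t + 1)).value a k
        = A.ucb ((A.pathMemory v j i e (t + 1)).count a k)
            ((A.pathMemory v j i e (t + 1)).total a k) at h3
      rw [h3, total_memory, sum_noise_eq_sampleNoise (A := A) (v := v) a k ht]
      exact ucb_mem_of_abs_le hA (hv a k).1 (hv a k).2 fun h1 => hconf a k _ h1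
        ((memory_count_le _ _ _ _ _ _).trans ht)
    · have h3 := (A.step_of_not_restarts (pathUtility v j i e t) hr).2.2
      change (A.pathMemory v j i e (t + 1)).value = _ at h3
      have h4 : Nat.log 2 ((A.pathMemory v j i e (t + 1)).count a k)
          = Nat.log 2 ((A.pathMemory v j i e t).count a k) := by
        have h5 := A.step_count (A.pathMemory v j i e t) (j t) (i t) (pathUtility v j i e t) a k
        change (A.pathMemory v j i e (t + 1)).count a k = _ at h5
        rw [h5]
        by_cases hc : a = i t ∧ k = j t
        · rw [if_pos hc, hc.1, hc.2]
          refine log_eq_of_not_restarts hr ?_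
          have := memory_count_le (A := A) j i (pathUtility v j i e) t (i t) (j t)
          change (A.pathMemory v j i e t).count (i t) (j t) ≤ t at this
          omega
        · rw [if_neg hc, add_zero]
      rw [h3, h4]
      exact ih

/-- The sum of the square roots of the counts serves as a potential: serving a pair with count N
raises it by √(N+1) − √N, which pays for the width at N. -/
theorem sum_value_sub_le_aux (hA : A.Valid) (hv : ∀ a k, A.l ≤ v a k ∧ v a k ≤ A.h)
    (hconf : A.Confident v j i e) (t : ℕ) (ht : t ≤ A.T) :
    ∑ τ ∈ Finset.range t, ((A.pathMemory v j i e τ).value (i τ) (j τ) - v (i τ) (j τ))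
      ≤ 4 * A.width * ∑ p : Fin n × Fin m, Real.sqrt ((A.pathMemory v j i e t).count p.1 p.2) := by
  have hw := hA.width_pos
  induction t with
  | zero => simp [pathMemory, memory, start]
  | succ t ih =>
    have ih := ih (by omega)
    have h1 := (value_mem hA hv hconf t (by omega) (i t) (j t)).2
    rw [Finset.sum_range_succ]
    have hcount : ∀ p : Fin n × Fin m, (A.pathMemory v j i e (t + 1)).count p.1 p.2
        = (A.pathMemory v j i e t).count p.1 p.2 + if p.1 = i t ∧ p.2 = j t then 1 else 0 :=
      fun p => A.step_count _ _ _ _ _ _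
    set M := A.pathMemory v j i e t
    set N := M.count (i t) (j t) with hN
    have h2 : ∑ p : Fin n × Fin m, Real.sqrt (M.count p.1 p.2)
        + (Real.sqrt (N + 1) - Real.sqrt N)
        ≤ ∑ p : Fin n × Fin m, Real.sqrt ((A.pathMemory v j i e (t + 1)).count p.1 p.2) := by
      rw [← Finset.add_sum_erase _ _ (Finset.mem_univ (i t, j t)),
        ← Finset.add_sum_erase (Finset.univ) (fun p : Fin n × Fin m =>
          Real.sqrt ((A.pathMemory v j i e (t + 1)).count p.1 p.2)) (Finset.mem_univ (i t, j t))]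
      have h3 : ∑ p ∈ Finset.univ.erase (i t, j t), Real.sqrt (M.count p.1 p.2)
          ≤ ∑ p ∈ Finset.univ.erase (i t, j t),
            Real.sqrt ((A.pathMemory v j i e (t + 1)).count p.1 p.2) := by
        refine Finset.sum_le_sum fun p _ => Real.sqrt_le_sqrt ?_
        rw [hcount p]
        exact_mod_cast Nat.le_add_right _ _
      rw [hcount (i t, j t)]
      simp only [and_self, if_true]
      push_cast
      linarith
    -- With z = √(2^log N) one has N + 1 ≤ 2z², so √(N+1) ≤ 2z and √(N+1) − √N ≥ 1/(2√(N+1)) ≥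
    -- 1/(4z). This is the factor 4, and it also covers N = 0.
    have h4 : A.width / Real.sqrt (2 ^ Nat.log 2 N)
        ≤ 4 * A.width * (Real.sqrt (N + 1) - Real.sqrt N) := by
      have hx : 0 ≤ Real.sqrt N := Real.sqrt_nonneg _
      have hy : 0 < Real.sqrt (N + 1) := Real.sqrt_pos.2 (by positivity)
      have hz : 0 < Real.sqrt (2 ^ Nat.log 2 N) := Real.sqrt_pos.2 (by positivity)
      have hx2 : Real.sqrt N ^ 2 = N := Real.sq_sqrt (by positivity)
      have hy2 : Real.sqrt (N + 1) ^ 2 = N + 1 := Real.sq_sqrt (by positivity)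
      have hz2 : Real.sqrt (2 ^ Nat.log 2 N) ^ 2 = 2 ^ Nat.log 2 N := Real.sq_sqrt (by positivity)
      have hpow : (N : ℝ) + 1 ≤ 2 * 2 ^ Nat.log 2 N := by
        have := Nat.lt_pow_succ_log_self (b := 2) (by norm_num) N
        rw [pow_succ] at this
        have h : N + 1 ≤ 2 * 2 ^ Nat.log 2 N := by omega
        exact_mod_cast h
      have hxy : Real.sqrt N ≤ Real.sqrt (N + 1) := Real.sqrt_le_sqrt (by linarith)
      have hyz : Real.sqrt (N + 1) ≤ 2 * Real.sqrt (2 ^ Nat.log 2 N) := by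
        refine abs_le_of_sq_le_sq' ?_ (by positivity) |>.2
        nlinarith
      rw [div_le_iff₀ hz]
      have : 1 ≤ 4 * (Real.sqrt (N + 1) - Real.sqrt N) * Real.sqrt (2 ^ Nat.log 2 N) := by
        nlinarith [mul_nonneg (sub_nonneg.2 hxy) (sub_nonneg.2 hyz),
          mul_nonneg (sub_nonneg.2 hxy) (sub_nonneg.2 hxy)]
      nlinarith
    have h5 := mul_le_mul_of_nonneg_left h2 (by positivity : 0 ≤ 4 * A.width)
    rw [mul_add] at h5
    linarith

/-- The total overestimation of the values of the served pairs. -/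
theorem sum_value_sub_le (hA : A.Valid) (hv : ∀ a k, A.l ≤ v a k ∧ v a k ≤ A.h)
    (hconf : A.Confident v j i e) :
    ∑ τ ∈ Finset.range A.T, ((A.pathMemory v j i e τ).value (i τ) (j τ) - v (i τ) (j τ))
      ≤ 4 * A.width * (n * m * Real.sqrt A.T) := by
  refine (sum_value_sub_le_aux hA hv hconf A.T le_rfl).trans ?_
  refine mul_le_mul_of_nonneg_left ?_ (by have := hA.width_pos; positivity)
  refine (Finset.sum_le_card_nsmul _ _ (Real.sqrt A.T) fun p _ => Real.sqrt_le_sqrt ?_).trans ?_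
  · exact Nat.cast_le.2 (memory_count_le j i (pathUtility v j i e) A.T p.1 p.2)
  · simp

end Confidence

end Alg
end FairDivision

/-! ### From logarithms to welfare, and the regret along a path -/

namespace FairDivision

/-- Near optimality in terms of the extended logarithms gives near optimality of the weighted
geometric mean. -/
theorem prod_rpow_sub_le {n : ℕ} {B u X f : Fin n → ℝ} {h δ b η η' : ℝ} (hB : ∀ i, 0 < B i)
    (hB1 : ∑ i, B i = 1) (hb : 0 < b) (hbB : ∀ i, b ≤ B i) (hδ : 0 < δ) (hh : 0 < h)
    (huh : ∀ i, u i ≤ h) (hf : ∀ i, 0 < f i) (hfu : ∀ i, f i * (1 + δ) ≤ u i)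
    (hη : 0 ≤ η) (hη' : 0 ≤ η')
    (hlog : ∑ i, B i * Real.log (u i) - η ≤ ∑ i, B i * logExt (f i) (X i))
    (hlin : ∑ i, B i * (X i / u i) ≤ 1 + η') :
    ∏ i, u i ^ B i - ∏ i, max (X i) 0 ^ B i ≤ h * (1 + 1 / (b * logGap δ)) * (η + η') := by
  have hγ := logGap_pos hδ
  have hu : ∀ i, 0 < u i := fun i => lt_of_lt_of_le (mul_pos (hf i) (by linarith)) (hfu i)
  have hF0 : 0 ≤ ∏ i, max (X i) 0 ^ B i :=
    Finset.prod_nonneg fun i _ => Real.rpow_nonneg (le_max_right _ _) _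
  have hO : ∏ i, u i ^ B i ≤ h := prod_rpow_le hB hB1 (fun i => (hu i).le) huh hh
  have hO0 : 0 < ∏ i, u i ^ B i := Finset.prod_pos fun i _ => Real.rpow_pos_of_pos (hu i) _
  have hle : ∀ i, logExt (f i) (X i) ≤ Real.log (u i) + X i / u i - 1 := fun i =>
    logExt_le (hf i) (by nlinarith [hfu i, hf i])
  have hγ1 : 0 ≤ 1 / (b * logGap δ) * (η + η') := by positivity
  -- When nobody is below the floor, `logExt` is the logarithm and exponentiating gives a relative
  -- loss of at most η.
  by_cases hX : ∀ i, f i ≤ X i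
  · have hX0 : ∀ i, 0 < X i := fun i => (hf i).trans_le (hX i)
    have h1 : ∏ i, max (X i) 0 ^ B i = ∏ i, X i ^ B i :=
      Finset.prod_congr rfl fun i _ => by rw [max_eq_left (hX0 i).le]
    have hP0 : 0 < ∏ i, X i ^ B i := Finset.prod_pos fun i _ => Real.rpow_pos_of_pos (hX0 i) _
    have h2 : Real.log (∏ i, u i ^ B i) - η ≤ Real.log (∏ i, X i ^ B i) := by
      rw [log_prod_rpow hu, log_prod_rpow hX0]
      refine hlog.trans (le_of_eq (Finset.sum_congr rfl fun i _ => ?_))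
      rw [logExt_of_le (hf i) (hX i)]
    have h3 : (∏ i, u i ^ B i) * Real.exp (-η) ≤ ∏ i, X i ^ B i := by
      have := Real.exp_le_exp.2 h2
      rwa [Real.exp_log hP0, sub_eq_add_neg, Real.exp_add, Real.exp_log hO0] at this
    have h4 : (∏ i, u i ^ B i) * (1 - η) ≤ ∏ i, X i ^ B i :=
      (mul_le_mul_of_nonneg_left (by linarith [Real.add_one_le_exp (-η)]) hO0.le).trans h3
    rw [h1]
    have h5 : (∏ i, u i ^ B i) * η ≤ h * η := mul_le_mul_of_nonneg_right hO hη
    have h6 : 0 ≤ h * η' := by positivity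
    have h7 : 0 ≤ h * (1 / (b * logGap δ) * (η + η')) := mul_nonneg hh.le hγ1
    nlinarith
  -- An agent below the floor loses B_a · `logGap δ` against its tangent at u_a, while the sum of
  -- all tangents exceeds the optimum by at most η'. So b · `logGap δ` ≤ η + η', and the claimed
  -- bound is at least h, hence trivial.
  · push Not at hX
    obtain ⟨a, ha⟩ := hX
    have h1 : ∑ i, B i * logExt (f i) (X i)
        ≤ ∑ i, (B i * Real.log (u i) + B i * (X i / u i) - B i) - B a * logGap δ := by
      rw [← Finset.add_sum_erase _ _ (Finset.mem_univ a),
        ← Finset.add_sum_erase (Finset.univ) (fun i => B i * Real.log (u i) + B i * (X i / u i)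
          - B i) (Finset.mem_univ a)]
      have h2 := mul_le_mul_of_nonneg_left (logExt_le_sub_gap (hf a) hδ (hfu a) ha.le) (hB a).le
      have h3 : ∑ i ∈ Finset.univ.erase a, B i * logExt (f i) (X i)
          ≤ ∑ i ∈ Finset.univ.erase a, (B i * Real.log (u i) + B i * (X i / u i) - B i) :=
        Finset.sum_le_sum fun i _ => by
          have := mul_le_mul_of_nonneg_left (hle i) (hB i).le
          linarith
      linarith
    rw [Finset.sum_sub_distrib, Finset.sum_add_distrib, hB1] at h1
    have h2 : b * logGap δ ≤ η + η' := by
      have := mul_le_mul_of_nonneg_right (hbB a) hγ.le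
      linarith
    have h3 : 1 ≤ 1 / (b * logGap δ) * (η + η') := by
      rw [one_div_mul_eq_div, le_div_iff₀ (by positivity)]
      linarith
    have h4 : h * 1 ≤ h * (1 / (b * logGap δ) * (η + η')) := mul_le_mul_of_nonneg_left h3 hh.le
    have h5 : 0 ≤ h * (η + η') := by positivity
    nlinarith

namespace Alg

variable {n m : ℕ} {A : Alg n} {s : Fin m → ℝ} {v x : Fin n → Fin m → ℝ} {j : ℕ → Fin m}
  {i : ℕ → Fin n} {e : ℕ → ℝ}

/-- The price that the allocation `x` of an item of type `k` earns at the current multipliers. -/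
noncomputable def shadowPrice (A : Alg n) (v x : Fin n → Fin m → ℝ) (M : Memory n m)
    (k : Fin m) : ℝ :=
  ∑ a, x a k * (A.B a / A.level M a * v a k)

/-- The shadow price is a subconvex combination of bids at true values. Optimism replaces these by
the actual bids, and the winner has the largest of them. -/
theorem shadowPrice_le (hA : A.Valid) {M : Memory n m} (hM : A.Bounded M) (hx : IsAllocation x)
    (hv : ∀ a k, v a k ≤ M.value a k) (hv0 : ∀ a k, 0 ≤ v a k) {i : Fin n} {k : Fin m}
    (hwin : ∀ a, A.bid M a k ≤ A.bid M i k) :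
    A.shadowPrice v x M k ≤ A.B i / A.level M i * M.value i k := by
  rw [← hM.bid_eq hA k i]
  have h0 : 0 ≤ A.bid M i k := by
    rw [hM.bid_eq hA k i]
    exact mul_nonneg (div_nonneg (hA.B_pos i).le (hA.level_pos M i).le)
      ((hv0 i k).trans (hv i k))
  calc A.shadowPrice v x M k ≤ ∑ a, x a k * A.bid M i k := by
        refine Finset.sum_le_sum fun a _ => mul_le_mul_of_nonneg_left ?_ (hx.1 a k)
        refine le_trans ?_ (hwin a)
        rw [hM.bid_eq hA k a]
        exact mul_le_mul_of_nonneg_left (hv a k)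
          (div_nonneg (hA.B_pos a).le (hA.level_pos M a).le)
    _ = (∑ a, x a k) * A.bid M i k := by rw [Finset.sum_mul]
    _ ≤ A.bid M i k := mul_le_of_le_one_left h0 (hx.2 k)

/-- Averaged over the types, the shadow price becomes the linear part of the dual objective at the
current levels, to which weak duality applies. -/
theorem sum_mul_shadowPrice (M : Memory n m) :
    ∑ k, s k * A.shadowPrice v x M k
      = ∑ a, A.B a * (allocUtility s v x a / A.level M a) := by
  simp only [shadowPrice, allocUtility, Finset.mul_sum, Finset.sum_div]
  rw [Finset.sum_comm]
  exact Finset.sum_congr rfl fun a _ => Finset.sum_congr rfl fun k _ => by ring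

theorem shadowPrice_nonneg (hA : A.Valid) (M : Memory n m) (hx : IsAllocation x)
    (hv0 : ∀ a k, 0 ≤ v a k) (k : Fin m) : 0 ≤ A.shadowPrice v x M k :=
  Finset.sum_nonneg fun a _ => mul_nonneg (hx.1 a k)
    (mul_nonneg (div_nonneg (hA.B_pos a).le (hA.level_pos M a).le) (hv0 a k))

theorem shadowPrice_le_const (hA : A.Valid) (M : Memory n m) (hx : IsAllocation x)
    (hv0 : ∀ a k, 0 ≤ v a k) (hv : ∀ a k, v a k ≤ A.h) (k : Fin m) :
    A.shadowPrice v x M k ≤ (1 + A.δ₀) / A.l * A.h := by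
  have hδ := hA.δ₀_pos
  have hl := hA.l_pos
  have hh := hA.h_pos
  calc A.shadowPrice v x M k ≤ ∑ a, x a k * ((1 + A.δ₀) / A.l * A.h) := by
        refine Finset.sum_le_sum fun a _ => mul_le_mul_of_nonneg_left ?_ (hx.1 a k)
        refine mul_le_mul ?_ (hv a k) (hv0 a k) (by positivity)
        have hB := hA.B_pos a
        calc A.B a / A.level M a ≤ A.B a / A.floor a :=
              div_le_div_of_nonneg_left hB.le (hA.floor_pos a) (le_max_right _ _)
          _ = (1 + A.δ₀) / A.l := by unfold floor; field_simp
    _ = (∑ a, x a k) * ((1 + A.δ₀) / A.l * A.h) := by rw [Finset.sum_mul]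
    _ ≤ _ := mul_le_of_le_one_left (by positivity) (hx.2 k)

/-- Dual averaging is near optimal in terms of the frozen values. -/
theorem sum_log_le (hA : A.Valid) (hB1 : ∑ a, A.B a = 1) (hT : 1 ≤ A.T)
    (hv : ∀ a k, A.l ≤ v a k ∧ v a k ≤ A.h) (hconf : A.Confident v j i e)
    (hwin : ∀ t < A.T, ∀ a, A.bid (A.pathMemory v j i e t) a (j t)
      ≤ A.bid (A.pathMemory v j i e t) (i t) (j t))
    (hx : IsAllocation x) (hu : ∀ a, 0 < allocUtility s v x a) :
    A.T * ∑ a, A.B a * Real.log (allocUtility s v x a)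
      + ∑ t ∈ Finset.range A.T, (A.shadowPrice v x (A.pathMemory v j i e t) (j t)
          - ∑ k, s k * A.shadowPrice v x (A.pathMemory v j i e t) k)
      - (∑ a, A.B a * (A.h ^ 2 / A.floor a ^ 2))
        * ∑ t ∈ Finset.range A.T, 1 / (((A.pathMemory v j i e t).iter : ℝ) + 1)
      ≤ A.T * ∑ a, A.B a * logExt (A.floor a) ((∑ t ∈ Finset.range A.T,
          gain (A.pathMemory v j i e t) (j t) (i t) a) / A.T) := by
  have h1 : ∑ a, A.B a * ∑ t ∈ Finset.range A.T,
      (gain (A.pathMemory v j i e t) (j t) (i t) a / A.level (A.pathMemory v j i e t) a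
        + Real.log (A.level (A.pathMemory v j i e t) a) - 1
        - A.h ^ 2 / (A.floor a ^ 2 * ((A.pathMemory v j i e t).iter + 1)))
      ≤ A.T * ∑ a, A.B a * logExt (A.floor a) ((∑ t ∈ Finset.range A.T,
          gain (A.pathMemory v j i e t) (j t) (i t) a) / A.T) := by
    rw [Finset.mul_sum]
    refine Finset.sum_le_sum fun a _ => ?_
    have := mul_le_mul_of_nonneg_left
      (sum_le_mul_logExt hA j i (pathUtility v j i e) a hT) (hA.B_pos a).le
    refine this.trans (le_of_eq ?_)
    rw [pathMemory]; ring
  refine le_trans ?_ h1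
  have h2 : ∑ a, A.B a * ∑ t ∈ Finset.range A.T,
      (gain (A.pathMemory v j i e t) (j t) (i t) a / A.level (A.pathMemory v j i e t) a
        + Real.log (A.level (A.pathMemory v j i e t) a) - 1
        - A.h ^ 2 / (A.floor a ^ 2 * ((A.pathMemory v j i e t).iter + 1)))
      = ∑ t ∈ Finset.range A.T, ∑ a, A.B a *
      (gain (A.pathMemory v j i e t) (j t) (i t) a / A.level (A.pathMemory v j i e t) a
        + Real.log (A.level (A.pathMemory v j i e t) a) - 1
        - A.h ^ 2 / (A.floor a ^ 2 * ((A.pathMemory v j i e t).iter + 1))) := by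
    simp only [Finset.mul_sum]
    rw [Finset.sum_comm]
  rw [h2]
  have h3 : (A.T : ℝ) * ∑ a, A.B a * Real.log (allocUtility s v x a)
      = ∑ t ∈ Finset.range A.T, ∑ a, A.B a * Real.log (allocUtility s v x a) := by simp
  rw [h3, Finset.mul_sum, ← Finset.sum_add_distrib, ← Finset.sum_sub_distrib]
  refine Finset.sum_le_sum fun t ht => ?_
  have ht := Finset.mem_range.1 ht
  have hM : A.Bounded (A.pathMemory v j i e t) := memory_bounded hA _ _ _ t
  have hval := fun a k => (value_mem hA hv hconf t ht.le a k).1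
  have hwt := hwin t ht
  set M := A.pathMemory v j i e t
  have hsp := shadowPrice_le hA hM hx hval (fun a k => hA.l_pos.le.trans (hv a k).1) hwt
  have hg : ∑ a, A.B a * (gain M (j t) (i t) a / A.level M a)
      = A.B (i t) / A.level M (i t) * M.value (i t) (j t) := by
    rw [Finset.sum_eq_single (i t)]
    · rw [gain, if_pos rfl]; ring
    · intro a _ ha; rw [gain, if_neg ha]; simp
    · simp
  -- Weak duality for one round: each logarithm lies below its tangent at the current level,
  -- whatever that level is.
  have hdual : ∑ a, A.B a * Real.log (allocUtility s v x a)
      ≤ ∑ a, (A.B a * (allocUtility s v x a / A.level M a) + A.B a * Real.log (A.level M a)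
        - A.B a) := by
    refine Finset.sum_le_sum fun a _ => ?_
    have := mul_le_mul_of_nonneg_left (one_sub_div_le_log_sub (hu a) (hA.level_pos M a))
      (hA.B_pos a).le
    linarith
  have hexp : ∑ a, A.B a * (gain M (j t) (i t) a / A.level M a + Real.log (A.level M a) - 1
        - A.h ^ 2 / (A.floor a ^ 2 * (M.iter + 1)))
      = ∑ a, A.B a * (gain M (j t) (i t) a / A.level M a) + ∑ a, A.B a * Real.log (A.level M a)
        - 1 - (∑ a, A.B a * (A.h ^ 2 / A.floor a ^ 2)) * (1 / ((M.iter : ℝ) + 1)) := by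
    nth_rw 3 [← hB1]
    rw [Finset.sum_mul, ← Finset.sum_add_distrib, ← Finset.sum_sub_distrib,
      ← Finset.sum_sub_distrib]
    refine Finset.sum_congr rfl fun a _ => ?_
    have hN : (M.iter : ℝ) + 1 ≠ 0 := by positivity
    have hf := (hA.floor_pos a).ne'
    field_simp
  rw [hexp, hg, sum_mul_shadowPrice]
  rw [Finset.sum_sub_distrib, Finset.sum_add_distrib, hB1] at hdual
  linarith

/-- The regret along a path on which all confidence intervals are valid. -/
theorem path_regret_le (hA : A.Valid) (hB1 : ∑ a, A.B a = 1) (hT : 1 ≤ A.T)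
    (hs : ∀ k, 0 ≤ s k) (hs1 : ∑ k, s k = 1)
    (hv : ∀ a k, A.l ≤ v a k ∧ v a k ≤ A.h) (hconf : A.Confident v j i e)
    (hwin : ∀ t < A.T, ∀ a, A.bid (A.pathMemory v j i e t) a (j t)
      ≤ A.bid (A.pathMemory v j i e t) (i t) (j t))
    (hx : IsAllocation x) (hu : ∀ a, 0 < allocUtility s v x a)
    (hul : ∀ a, A.B a * A.l ≤ allocUtility s v x a)
    {price : Fin m → ℝ} (hprice : ∀ a k, A.B a * v a k / allocUtility s v x a ≤ price k)
    (hprice1 : ∑ k, s k * price k ≤ 1) {b : ℝ} (hb : 0 < b) (hbB : ∀ a, b ≤ A.B a) :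
    A.T * ∏ a, allocUtility s v x a ^ A.B a
      - nsw A.B (fun a => ∑ t ∈ Finset.range A.T,
          if i t = a then pathUtility v j i e t else 0)
      ≤ A.h * (1 + 1 / (b * logGap A.δ₀)) *
        (|∑ t ∈ Finset.range A.T, (A.shadowPrice v x (A.pathMemory v j i e t) (j t)
            - ∑ k, s k * A.shadowPrice v x (A.pathMemory v j i e t) k)|
          + n * ((1 + A.δ₀) ^ 2 * A.h ^ 2 / (A.l ^ 2 * b))
            * (2 * (n * m) * (1 + Real.log A.T) ^ 2)
          + (1 + A.δ₀) / A.l * (4 * A.width * (n * m * Real.sqrt A.T))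
          + |∑ t ∈ Finset.range A.T, (price (j t) - ∑ k, s k * price k)|
          + ((1 + A.δ₀) / A.l + 1 / A.l)
            * ∑ a, |∑ t ∈ Finset.range A.T, if i t = a then e t else 0|) := by
  have hδ := hA.δ₀_pos
  have hl := hA.l_pos
  have hh := hA.h_pos
  have hT0 : (0 : ℝ) < A.T := by exact_mod_cast hT
  have hv0 : ∀ a k, 0 ≤ v a k := fun a k => hl.le.trans (hv a k).1
  have hmain := sum_log_le hA hB1 hT hv hconf hwin hx hu
  have hR := sum_inv_iter_le (A := A) j i (pathUtility v j i e) hT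
  change ∑ τ ∈ Finset.range A.T, 1 / (((A.pathMemory v j i e τ).iter : ℝ) + 1) ≤ _ at hR
  have hW := sum_value_sub_le hA hv hconf
  have hval := fun t (ht : t ∈ Finset.range A.T) =>
    (value_mem hA hv hconf t (Finset.mem_range.1 ht).le (i t) (j t)).1
  set M := A.pathMemory v j i e
  set Q := ∑ t ∈ Finset.range A.T, (A.shadowPrice v x (M t) (j t)
    - ∑ k, s k * A.shadowPrice v x (M t) k)
  set R := ∑ t ∈ Finset.range A.T, 1 / (((M t).iter : ℝ) + 1)
  set W := ∑ t ∈ Finset.range A.T, ((M t).value (i t) (j t) - v (i t) (j t))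
  set P := ∑ t ∈ Finset.range A.T, (price (j t) - ∑ k, s k * price k) with hP
  set V : Fin n → ℝ := fun a => ∑ t ∈ Finset.range A.T, gain (M t) (j t) (i t) a with hV
  set S : Fin n → ℝ := fun a => ∑ t ∈ Finset.range A.T, if i t = a then e t else 0 with hS
  set U : Fin n → ℝ := fun a => ∑ t ∈ Finset.range A.T,
    if i t = a then pathUtility v j i e t else 0 with hU
  change _ ≤ A.h * (1 + 1 / (b * logGap A.δ₀)) * (|Q|
          + n * ((1 + A.δ₀) ^ 2 * A.h ^ 2 / (A.l ^ 2 * b))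
            * (2 * (n * m) * (1 + Real.log A.T) ^ 2)
          + (1 + A.δ₀) / A.l * (4 * A.width * (n * m * Real.sqrt A.T)) + |P|
          + ((1 + A.δ₀) / A.l + 1 / A.l) * ∑ a, |S a|)
  have hR0 : 0 ≤ R := Finset.sum_nonneg fun t _ => by positivity
  have hW0 : 0 ≤ W := Finset.sum_nonneg fun t ht => sub_nonneg.2 (hval t ht)
  have hS0 : 0 ≤ ∑ a, |S a| := Finset.sum_nonneg fun a _ => abs_nonneg _
  -- the frozen utilities and the realized utilities differ by the widths and the noises
  have hVU : ∑ a, |V a - U a| ≤ W + ∑ a, |S a| := by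
    have h1 : ∀ a, |V a - U a| ≤ (∑ t ∈ Finset.range A.T,
        if i t = a then (M t).value (i t) (j t) - v (i t) (j t) else 0) + |S a| := by
      intro a
      have h2 : V a - U a = (∑ t ∈ Finset.range A.T,
          if i t = a then (M t).value (i t) (j t) - v (i t) (j t) else 0) - S a := by
        simp only [hV, hU, hS]
        rw [← Finset.sum_sub_distrib, ← Finset.sum_sub_distrib]
        refine Finset.sum_congr rfl fun t _ => ?_
        by_cases hc : i t = a
        · rw [if_pos hc, if_pos hc, if_pos hc, gain, if_pos hc.symm, pathUtility]; ring
        · rw [if_neg hc, if_neg hc, if_neg hc, gain, if_neg (Ne.symm hc)]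
      rw [h2]
      refine (abs_sub _ _).trans (le_of_eq ?_)
      rw [abs_of_nonneg]
      refine Finset.sum_nonneg fun t ht => ?_
      split_ifs
      · exact sub_nonneg.2 (hval t ht)
      · exact le_rfl
    refine (Finset.sum_le_sum fun a _ => h1 a).trans (le_of_eq ?_)
    rw [Finset.sum_add_distrib, Finset.sum_comm]
    simp [W]
  have hfl : ∀ a, A.B a / A.floor a = (1 + A.δ₀) / A.l := fun a => by
    have := hA.B_pos a
    unfold floor; field_simp
  -- The Lipschitz constant 1/floor_a, weighted by B_a, is the same number (1+δ₀)/l for all agents,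
  -- so only the total deviation matters.
  have hlogVU : A.T * ∑ a, A.B a * logExt (A.floor a) (V a / A.T)
      ≤ A.T * ∑ a, A.B a * logExt (A.floor a) (U a / A.T)
        + (1 + A.δ₀) / A.l * (W + ∑ a, |S a|) := by
    have h1 : ∀ a, A.T * (A.B a * logExt (A.floor a) (V a / A.T))
        ≤ A.T * (A.B a * logExt (A.floor a) (U a / A.T)) + (1 + A.δ₀) / A.l * |V a - U a| := by
      intro a
      have h2 := mul_le_mul_of_nonneg_left (mul_le_mul_of_nonneg_left
        (logExt_le_add (x := U a / A.T) (y := V a / A.T) (hA.floor_pos a)) (hA.B_pos a).le) hT0.le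
      refine h2.trans (le_of_eq ?_)
      rw [← sub_div, abs_div, abs_of_pos hT0, ← hfl a]
      have := hA.floor_pos a
      field_simp
    rw [Finset.mul_sum, Finset.mul_sum]
    refine (Finset.sum_le_sum fun a _ => h1 a).trans ?_
    have := mul_le_mul_of_nonneg_left hVU (by positivity : 0 ≤ (1 + A.δ₀) / A.l)
    rw [Finset.mul_sum] at this
    rw [Finset.sum_add_distrib]
    linarith
  have hcoef : ∑ a, A.B a * (A.h ^ 2 / A.floor a ^ 2)
      ≤ n * ((1 + A.δ₀) ^ 2 * A.h ^ 2 / (A.l ^ 2 * b)) := by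
    refine (Finset.sum_le_card_nsmul _ _ ((1 + A.δ₀) ^ 2 * A.h ^ 2 / (A.l ^ 2 * b))
      fun a _ => ?_).trans (by simp)
    have hB := hA.B_pos a
    have : A.B a * (A.h ^ 2 / A.floor a ^ 2) = (1 + A.δ₀) ^ 2 * A.h ^ 2 / (A.l ^ 2 * A.B a) := by
      unfold floor; field_simp
    rw [this]
    exact div_le_div_of_nonneg_left (by positivity) (by positivity)
      (mul_le_mul_of_nonneg_left (hbB a) (by positivity))
  have hcR : (∑ a, A.B a * (A.h ^ 2 / A.floor a ^ 2)) * R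
      ≤ n * ((1 + A.δ₀) ^ 2 * A.h ^ 2 / (A.l ^ 2 * b))
        * (2 * (n * m) * (1 + Real.log A.T) ^ 2) :=
    mul_le_mul hcoef hR hR0 (by positivity)
  set E₁ := n * ((1 + A.δ₀) ^ 2 * A.h ^ 2 / (A.l ^ 2 * b))
        * (2 * (n * m) * (1 + Real.log A.T) ^ 2) with hE₁
  have hE₁0 : 0 ≤ E₁ := by rw [hE₁]; positivity
  -- A served item contributes at most its equilibrium price, whoever wins it, and the prices have
  -- mean at most 1. The noise is weighted by B_a/u_a ≤ 1/l.
  have hlin : ∑ a, A.B a * (U a / allocUtility s v x a)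
      ≤ A.T + |P| + 1 / A.l * ∑ a, |S a| := by
    have h1 : ∀ a, A.B a * (U a / allocUtility s v x a) ≤ (∑ t ∈ Finset.range A.T,
        if i t = a then price (j t) else 0) + 1 / A.l * |S a| := by
      intro a
      have hBu : A.B a / allocUtility s v x a ≤ 1 / A.l := by
        rw [div_le_div_iff₀ (hu a) hl]; linarith [hul a]
      have hBu0 : 0 ≤ A.B a / allocUtility s v x a := div_nonneg (hA.B_pos a).le (hu a).le
      have h2 : A.B a * (U a / allocUtility s v x a) = (∑ t ∈ Finset.range A.T,
          if i t = a then A.B a * v a (j t) / allocUtility s v x a else 0)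
          + A.B a / allocUtility s v x a * S a := by
        simp only [hU, hS]
        rw [← mul_comm_div, Finset.mul_sum, Finset.mul_sum, ← Finset.sum_add_distrib]
        refine Finset.sum_congr rfl fun t _ => ?_
        by_cases hc : i t = a
        · rw [if_pos hc, if_pos hc, if_pos hc, pathUtility, hc]; ring
        · rw [if_neg hc, if_neg hc, if_neg hc]; ring
      rw [h2]
      refine add_le_add (Finset.sum_le_sum fun t _ => ?_) ?_
      · split_ifs
        · exact hprice a (j t)
        · exact le_rfl
      · exact (mul_le_mul_of_nonneg_left (le_abs_self _) hBu0).trans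
          (mul_le_mul_of_nonneg_right hBu (abs_nonneg _))
    refine (Finset.sum_le_sum fun a _ => h1 a).trans ?_
    rw [Finset.sum_add_distrib, Finset.sum_comm, ← Finset.mul_sum]
    simp only [Finset.sum_ite_eq, Finset.mem_univ, if_true]
    have h3 : ∑ t ∈ Finset.range A.T, price (j t) = P + A.T * ∑ k, s k * price k := by
      rw [hP, Finset.sum_sub_distrib]; simp
    rw [h3]
    have h4 : (A.T : ℝ) * ∑ k, s k * price k ≤ A.T * 1 :=
      mul_le_mul_of_nonneg_left hprice1 hT0.le
    linarith [le_abs_self P]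
  set E₂ := (1 + A.δ₀) / A.l * (4 * A.width * (n * m * Real.sqrt A.T)) with hE₂
  have hWE : (1 + A.δ₀) / A.l * W ≤ E₂ := mul_le_mul_of_nonneg_left hW (by positivity)
  have hWE0 : 0 ≤ (1 + A.δ₀) / A.l * W := by positivity
  have hη : 0 ≤ |Q| + E₁ + E₂ + (1 + A.δ₀) / A.l * ∑ a, |S a| := by
    have : 0 ≤ (1 + A.δ₀) / A.l * ∑ a, |S a| := by positivity
    have := abs_nonneg Q
    linarith
  have key := prod_rpow_sub_le (B := A.B) (u := allocUtility s v x) (X := fun a => U a / A.T)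
    (f := A.floor) (h := A.h) (δ := A.δ₀) (b := b)
    (η := (|Q| + E₁ + E₂ + (1 + A.δ₀) / A.l * ∑ a, |S a|) / A.T)
    (η' := (|P| + 1 / A.l * ∑ a, |S a|) / A.T) hA.B_pos hB1 hb hbB hδ hh
    (fun a => allocUtility_le hs hs1 hv0 (fun a k => (hv a k).2) hx a) hA.floor_pos
    (fun a => by
      have : A.floor a * (1 + A.δ₀) = A.B a * A.l := by unfold floor; field_simp
      rw [this]; exact hul a)
    (div_nonneg hη hT0.le) (by positivity)
    (by
      rw [sub_le_iff_le_add, ← sub_le_iff_le_add', le_div_iff₀ hT0]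
      have := neg_abs_le Q
      linarith)
    (by
      have h1 : ∑ a, A.B a * (U a / A.T / allocUtility s v x a)
          = (∑ a, A.B a * (U a / allocUtility s v x a)) / A.T := by
        rw [Finset.sum_div]
        exact Finset.sum_congr rfl fun a _ => by ring
      rw [h1, div_le_iff₀ hT0, add_mul, div_mul_cancel₀ _ hT0.ne']
      linarith)
  -- The weights sum to 1, so the welfare is homogeneous of degree one and the bound for averages
  -- can be multiplied by T.
  have hscale : nsw A.B U = A.T * ∏ a, max (U a / A.T) 0 ^ A.B a := by
    have h1 : ∀ a, max (U a) 0 ^ A.B a = (A.T : ℝ) ^ A.B a * max (U a / A.T) 0 ^ A.B a := by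
      intro a
      rw [← Real.mul_rpow hT0.le (le_max_right _ _), mul_max_of_nonneg _ _ hT0.le,
        mul_div_cancel₀ _ hT0.ne', mul_zero]
    unfold nsw
    rw [Finset.prod_congr rfl fun a _ => h1 a, Finset.prod_mul_distrib,
      ← Real.rpow_sum_of_pos hT0, hB1, Real.rpow_one]
  rw [hscale, ← mul_sub]
  refine (mul_le_mul_of_nonneg_left key hT0.le).trans (le_of_eq ?_)
  rw [← add_div, mul_comm, mul_assoc, div_mul_cancel₀ _ hT0.ne']
  ring

end Alg
end FairDivision

/-! ### Measurability of the memory and the filtrations -/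

namespace FairDivision

theorem measurable_apply_countable {Ω ι β : Type*} [MeasurableSpace Ω] [MeasurableSpace β]
    [Countable ι] [MeasurableSpace ι] [MeasurableSingletonClass ι] {f : ι → Ω → β} {k : Ω → ι}
    (hf : ∀ x, Measurable (f x)) (hk : Measurable k) : Measurable fun ω => f (k ω) ω :=
  (measurable_from_prod_countable_right (f := fun p : ι × Ω => f p.1 p.2) hf).comp
    (hk.prodMk measurable_id)

namespace Alg

variable {n m : ℕ} {A : Alg n} {Ω : Type*}

/-- All entries of a random memory are measurable. -/
structure MeasurableMemory [MeasurableSpace Ω] (M : Ω → Memory n m) : Prop where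
  count : ∀ a k, Measurable fun ω => (M ω).count a k
  total : ∀ a k, Measurable fun ω => (M ω).total a k
  value : ∀ a k, Measurable fun ω => (M ω).value a k
  iter : Measurable fun ω => (M ω).iter
  mean : ∀ a, Measurable fun ω => (M ω).mean a

theorem measurable_ucb [MeasurableSpace Ω] {N : Ω → ℕ} {x : Ω → ℝ} (hN : Measurable N)
    (hx : Measurable x) : Measurable fun ω => A.ucb (N ω) (x ω) := by
  refine measurable_apply_countable (f := fun N ω => A.ucb N (x ω)) (fun N => ?_) hN
  unfold ucb
  split_ifs
  · exact measurable_const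
  · unfold proj
    fun_prop

theorem MeasurableMemory.step [MeasurableSpace Ω] {M : Ω → Memory n m} (hM : MeasurableMemory M)
    {j : Ω → Fin m} {i : Ω → Fin n} {u : Ω → ℝ} (hj : Measurable j) (hi : Measurable i)
    (hu : Measurable u) : MeasurableMemory fun ω => A.step (M ω) (j ω) (i ω) (u ω) := by
  classical
  have hpair : ∀ a k, MeasurableSet {ω | a = i ω ∧ k = j ω} := fun a k =>
    (measurableSet_eq_fun measurable_const hi).inter (measurableSet_eq_fun measurable_const hj)
  have hcount : ∀ a k, Measurable fun ω => (A.step (M ω) (j ω) (i ω) (u ω)).count a k := by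
    intro a k
    simp only [step_count]
    exact (hM.count a k).add (Measurable.ite (hpair a k) measurable_const measurable_const)
  have htotal : ∀ a k, Measurable fun ω => (A.step (M ω) (j ω) (i ω) (u ω)).total a k := by
    intro a k
    simp only [step_total]
    exact (hM.total a k).add (Measurable.ite (hpair a k) hu measurable_const)
  have hr : MeasurableSet {ω | A.Restarts (M ω) (j ω) (i ω)} := by
    have h1 : Measurable fun ω => (M ω).count (i ω) (j ω) :=
      measurable_apply_countable (f := fun (p : Fin n × Fin m) ω => (M ω).count p.1 p.2)
        (fun p => hM.count p.1 p.2) (hi.prodMk hj)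
    have h2 : Measurable fun ω => (M ω).count (i ω) (j ω) + 1 := h1.add measurable_const
    exact h2 (MeasurableSet.of_discrete
      (s := (((Finset.Icc 1 (Nat.log 2 A.T)).image (fun p => 2 ^ p) : Finset ℕ) : Set ℕ)))
  have hgain : ∀ a, Measurable fun ω => if a = i ω then (M ω).value (i ω) (j ω) else 0 := by
    intro a
    refine Measurable.ite (measurableSet_eq_fun measurable_const hi) ?_ measurable_const
    exact measurable_apply_countable (f := fun (p : Fin n × Fin m) ω => (M ω).value p.1 p.2)
        (fun p => hM.value p.1 p.2) (hi.prodMk hj)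
  have hiter : Measurable fun ω => ((M ω).iter : ℝ) := measurable_from_top.comp hM.iter
  refine ⟨hcount, htotal, fun a k => ?_, ?_, fun a => ?_⟩
  · have : (fun ω => (A.step (M ω) (j ω) (i ω) (u ω)).value a k)
        = fun ω => if A.Restarts (M ω) (j ω) (i ω) then
            A.ucb ((A.step (M ω) (j ω) (i ω) (u ω)).count a k)
              ((A.step (M ω) (j ω) (i ω) (u ω)).total a k) else (M ω).value a k := by
      funext ω
      split_ifs with h
      · exact (A.step_of_restarts (u ω) h).2.2 a k
      · rw [(A.step_of_not_restarts (u ω) h).2.2]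
    rw [this]
    exact Measurable.ite hr (measurable_ucb (hcount a k) (htotal a k)) (hM.value a k)
  · have : (fun ω => (A.step (M ω) (j ω) (i ω) (u ω)).iter)
        = fun ω => if A.Restarts (M ω) (j ω) (i ω) then 0 else (M ω).iter + 1 := by
      funext ω
      split_ifs with h
      · exact (A.step_of_restarts (u ω) h).1
      · exact (A.step_of_not_restarts (u ω) h).1
    rw [this]
    exact Measurable.ite hr measurable_const (hM.iter.add measurable_const)
  · have : (fun ω => (A.step (M ω) (j ω) (i ω) (u ω)).mean a)
        = fun ω => if A.Restarts (M ω) (j ω) (i ω) then 0 else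
            ((M ω).iter : ℝ) / ((M ω).iter + 1) * (M ω).mean a
          + 1 / ((M ω).iter + 1) * (if a = i ω then (M ω).value (i ω) (j ω) else 0) := by
      funext ω
      split_ifs with h h2
      · exact (A.step_of_restarts (u ω) h).2.1 a
      · rw [(A.step_of_not_restarts (u ω) h).2.1, if_pos h2]
      · rw [(A.step_of_not_restarts (u ω) h).2.1, if_neg h2]
    rw [this]
    refine Measurable.ite hr measurable_const ?_
    exact ((hiter.div (hiter.add measurable_const)).mul (hM.mean a)).add
      ((measurable_const.div (hiter.add measurable_const)).mul (hgain a))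

theorem measurable_memory [MeasurableSpace Ω] {j : ℕ → Ω → Fin m} {i : ℕ → Ω → Fin n}
    {u : ℕ → Ω → ℝ} {t : ℕ} (hj : ∀ τ < t, Measurable (j τ)) (hi : ∀ τ < t, Measurable (i τ))
    (hu : ∀ τ < t, Measurable (u τ)) :
    MeasurableMemory fun ω => A.memory (fun τ => j τ ω) (fun τ => i τ ω) (fun τ => u τ ω) t := by
  induction t with
  | zero =>
    exact ⟨fun _ _ => measurable_const, fun _ _ => measurable_const, fun _ _ => measurable_const,
      measurable_const, fun _ => measurable_const⟩
  | succ t ih =>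
    exact (ih (fun τ h => hj τ (by omega)) (fun τ h => hi τ (by omega))
      (fun τ h => hu τ (by omega))).step (hj t (by omega)) (hi t (by omega)) (hu t (by omega))

end Alg

section Filtration

variable {n m : ℕ} {Ω : Type*} {v : Fin n → Fin m → ℝ} {j : ℕ → Ω → Fin m} {i : ℕ → Ω → Fin n}
  {ε : ℕ → Ω → ℝ}

/-- The events before round `t`. -/
abbrev pastAlgebra (j : ℕ → Ω → Fin m) (i : ℕ → Ω → Fin n) (ε : ℕ → Ω → ℝ) (t : ℕ) :
    MeasurableSpace Ω :=
  MeasurableSpace.comap (past j i ε t) inferInstance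

/-- The events before the noise of round `t`. -/
abbrev preNoiseAlgebra (j : ℕ → Ω → Fin m) (i : ℕ → Ω → Fin n) (ε : ℕ → Ω → ℝ) (t : ℕ) :
    MeasurableSpace Ω :=
  MeasurableSpace.comap (fun ω => (past j i ε t ω, j t ω, i t ω)) inferInstance

theorem measurable_past_entry {t τ : ℕ} (h : τ < t) :
    Measurable[pastAlgebra j i ε t] fun ω => (j τ ω, i τ ω, ε τ ω) :=
  (measurable_pi_apply (⟨τ, h⟩ : Fin t)).comp (comap_measurable (past j i ε t))

theorem measurable_type_past {t τ : ℕ} (h : τ < t) : Measurable[pastAlgebra j i ε t] (j τ) :=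
  measurable_fst.comp (measurable_past_entry h)

theorem measurable_winner_past {t τ : ℕ} (h : τ < t) : Measurable[pastAlgebra j i ε t] (i τ) :=
  (measurable_fst.comp measurable_snd).comp (measurable_past_entry h)

theorem measurable_noise_past {t τ : ℕ} (h : τ < t) : Measurable[pastAlgebra j i ε t] (ε τ) :=
  (measurable_snd.comp measurable_snd).comp (measurable_past_entry h)

theorem measurable_utility [MeasurableSpace Ω] {t : ℕ} (hj : Measurable (j t))
    (hi : Measurable (i t)) (hε : Measurable (ε t)) : Measurable (utility v j i ε t) :=
  (((measurable_of_countable fun p : Fin n × Fin m => v p.1 p.2).comp (hi.prodMk hj))).add hε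

/-- The memory is a function of the past alone. This makes the shadow prices predictable, and lets
the membership of a round in a sample be known before its noise. -/
theorem measurable_memory_past (A : Alg n) {t t' : ℕ} (h : t ≤ t') :
    @Alg.MeasurableMemory n m Ω (pastAlgebra j i ε t') fun ω =>
      A.pathMemory v (fun τ => j τ ω) (fun τ => i τ ω) (fun τ => ε τ ω) t := by
  let _ := pastAlgebra j i ε t'
  exact Alg.measurable_memory (u := utility v j i ε)
    (fun τ hτ => measurable_type_past (hτ.trans_le h))
    (fun τ hτ => measurable_winner_past (hτ.trans_le h))
    (fun τ hτ => measurable_utility (measurable_type_past (hτ.trans_le h))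
      (measurable_winner_past (hτ.trans_le h)) (measurable_noise_past (hτ.trans_le h)))

theorem pastAlgebra_mono {t t' : ℕ} (h : t ≤ t') : pastAlgebra j i ε t ≤ pastAlgebra j i ε t' := by
  refine Measurable.comap_le (m₁ := pastAlgebra j i ε t') ?_
  let _ := pastAlgebra j i ε t'
  exact measurable_pi_lambda _ fun τ => measurable_past_entry (τ.2.trans_le h)

theorem pastAlgebra_le_preNoise (t : ℕ) : pastAlgebra j i ε t ≤ preNoiseAlgebra j i ε t := by
  refine Measurable.comap_le (m₁ := preNoiseAlgebra j i ε t) ?_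
  exact measurable_fst.comp (comap_measurable _)

theorem measurable_type_preNoise (t : ℕ) : Measurable[preNoiseAlgebra j i ε t] (j t) :=
  (measurable_fst.comp measurable_snd).comp
    (comap_measurable fun ω => (past j i ε t ω, j t ω, i t ω))

theorem measurable_winner_preNoise (t : ℕ) : Measurable[preNoiseAlgebra j i ε t] (i t) :=
  (measurable_snd.comp measurable_snd).comp
    (comap_measurable fun ω => (past j i ε t ω, j t ω, i t ω))

theorem IsRun.pastAlgebra_le [m0 : MeasurableSpace Ω] {μ : Measure Ω} {A : Alg n} {s : Fin m → ℝ}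
    {σ : ℝ} (hrun : IsRun μ A s v σ j i ε) {t : ℕ} (ht : t ≤ A.T) :
    pastAlgebra j i ε t ≤ m0 := by
  refine Measurable.comap_le (m₁ := m0) (measurable_pi_lambda _ fun τ => ?_)
  have hτ := τ.2.trans_le ht
  exact (hrun.measurable_type τ hτ).prodMk
    ((hrun.measurable_winner τ hτ).prodMk (hrun.measurable_noise τ hτ))

theorem IsRun.preNoiseAlgebra_le [m0 : MeasurableSpace Ω] {μ : Measure Ω} {A : Alg n}
    {s : Fin m → ℝ} {σ : ℝ} (hrun : IsRun μ A s v σ j i ε) {t : ℕ} (ht : t < A.T) :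
    preNoiseAlgebra j i ε t ≤ m0 := by
  refine Measurable.comap_le (m₁ := m0) (Measurable.prodMk ?_
    ((hrun.measurable_type t ht).prodMk (hrun.measurable_winner t ht)))
  exact measurable_iff_comap_le.2 (hrun.pastAlgebra_le ht.le)

end Filtration

end FairDivision

/-! ### Martingales of the types -/

namespace FairDivision

/-- The arithmetic-geometric mean inequality; with a suitable constant r it passes from a second
moment to a first moment. -/
theorem abs_le_add_sq_div {x r : ℝ} (hr : 0 < r) : |x| ≤ (x ^ 2 / r + r) / 2 := by
  rw [le_div_iff₀ two_pos, div_add' _ _ _ hr.ne', le_div_iff₀ hr]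
  nlinarith [sq_nonneg (|x| - r), sq_abs x]

section Martingale

variable {n m : ℕ} {Ω : Type*} {v : Fin n → Fin m → ℝ} {j : ℕ → Ω → Fin m} {i : ℕ → Ω → Fin n}
  {ε : ℕ → Ω → ℝ} {s : Fin m → ℝ} {σ : ℝ}

/-- The sum of the deviations of a predictable function of the type from its conditional mean. -/
def typeDeviation (s : Fin m → ℝ) (j : ℕ → Ω → Fin m) (f : ℕ → Ω → Fin m → ℝ) (t : ℕ)
    (ω : Ω) : ℝ :=
  ∑ τ ∈ Finset.range t, (f τ ω (j τ ω) - ∑ k, s k * f τ ω k)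

theorem abs_type_sub_mean_le (hs : ∀ k, 0 ≤ s k) (hs1 : ∑ k, s k = 1) {g : Fin m → ℝ} {b : ℝ}
    (hg0 : ∀ k, 0 ≤ g k) (hgb : ∀ k, g k ≤ b) (q : Fin m) :
    |g q - ∑ k, s k * g k| ≤ b := by
  have h1 : 0 ≤ ∑ k, s k * g k := Finset.sum_nonneg fun k _ => mul_nonneg (hs k) (hg0 k)
  have h2 : ∑ k, s k * g k ≤ b := by
    calc ∑ k, s k * g k ≤ ∑ k, s k * b :=
          Finset.sum_le_sum fun k _ => mul_le_mul_of_nonneg_left (hgb k) (hs k)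
      _ = b := by rw [← Finset.sum_mul, hs1, one_mul]
  rw [abs_le]
  exact ⟨by linarith [hg0 q], by linarith [hgb q]⟩

theorem measurable_typeDeviation {f : ℕ → Ω → Fin m → ℝ} {t t' : ℕ} (htt : t ≤ t')
    (hf : ∀ τ < t, ∀ k, Measurable[pastAlgebra j i ε τ] fun ω => f τ ω k) :
    Measurable[pastAlgebra j i ε t'] (typeDeviation s j f t) := by
  let _ := pastAlgebra j i ε t'
  refine Finset.measurable_sum _ fun τ hτ => ?_
  have hτ := Finset.mem_range.1 hτ
  have hfτ : ∀ k, Measurable fun ω => f τ ω k := fun k =>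
    (hf τ hτ k).mono (pastAlgebra_mono (hτ.le.trans htt)) le_rfl
  exact (measurable_apply_countable (f := fun k ω => f τ ω k) hfτ
    (measurable_type_past (hτ.trans_le htt))).sub
    (Finset.measurable_sum _ fun k _ => (hfτ k).const_mul _)

theorem abs_typeDeviation_le (hs : ∀ k, 0 ≤ s k) (hs1 : ∑ k, s k = 1) {f : ℕ → Ω → Fin m → ℝ}
    {b : ℝ} (hf0 : ∀ t ω k, 0 ≤ f t ω k) (hfb : ∀ t ω k, f t ω k ≤ b) (t : ℕ) (ω : Ω) :
    |typeDeviation s j f t ω| ≤ t * b := by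
  refine (Finset.abs_sum_le_sum_abs _ _).trans ?_
  refine (Finset.sum_le_card_nsmul _ _ b fun τ _ => ?_).trans (by simp)
  exact abs_type_sub_mean_le hs hs1 (hf0 τ ω) (hfb τ ω) _

variable [m0 : MeasurableSpace Ω] {μ : Measure Ω} [IsProbabilityMeasure μ] {A : Alg n}

theorem integrable_of_bounded {f : Ω → ℝ} (hf : Measurable f) {b : ℝ} (hb : ∀ ω, |f ω| ≤ b) :
    Integrable f μ :=
  Integrable.of_bound hf.aestronglyMeasurable b (Filter.Eventually.of_forall hb)

/-- The type of a round is centered given the past. -/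
theorem IsRun.integral_centered_type (hrun : IsRun μ A s v σ j i ε) {t : ℕ} (ht : t < A.T)
    {X : Ω → ℝ} (hX : Measurable[pastAlgebra j i ε t] X) {b : ℝ} (hb : ∀ ω, |X ω| ≤ b)
    (k : Fin m) : ∫ ω, ((if j t ω = k then 1 else 0) - s k) * X ω ∂μ = 0 := by
  have hX0 : Measurable X := hX.mono (hrun.pastAlgebra_le ht.le) le_rfl
  have hset : MeasurableSet {ω | j t ω = k} :=
    measurableSet_eq_fun (hrun.measurable_type t ht) measurable_const
  have hI : Measurable fun ω => if j t ω = k then (1 : ℝ) else 0 :=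
    Measurable.ite hset measurable_const measurable_const
  have hind : IndepFun (fun ω => if j t ω = k then (1 : ℝ) else 0) X μ := by
    have h1 := (IndepFun_iff_Indep _ _ _).1 (hrun.type_indep t ht)
    have h2 : IndepFun (j t) X μ :=
      (IndepFun_iff_Indep _ _ _).2 (indep_of_indep_of_le_right h1 (measurable_iff_comap_le.1 hX))
    exact h2.comp (φ := fun q => if q = k then (1 : ℝ) else 0) (measurable_of_countable _)
      measurable_id
  have hXi : Integrable X μ := integrable_of_bounded hX0 hb
  have hIX : Integrable (fun ω => (if j t ω = k then (1 : ℝ) else 0) * X ω) μ := by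
    refine integrable_of_bounded (hI.mul hX0) (b := b) fun ω => ?_
    have := abs_nonneg (X ω)
    split_ifs
    · simpa using hb ω
    · simpa using this.trans (hb ω)
  have hIint : ∫ ω, (if j t ω = k then (1 : ℝ) else 0) ∂μ = s k := by
    rw [← hrun.type_law t ht k, ← integral_indicator_one hset]
    refine integral_congr_ae (Filter.Eventually.of_forall fun ω => ?_)
    simp [Set.indicator_apply]
  simp only [sub_mul]
  rw [integral_sub hIX (hXi.const_mul _), hind.integral_fun_mul_eq_mul_integral
    hI.aestronglyMeasurable hX0.aestronglyMeasurable, hIint, integral_const_mul, sub_self]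

/-- The increments are bounded by b and orthogonal to the past, so their second moments add up. -/
theorem IsRun.integral_typeDeviation_sq_le (hrun : IsRun μ A s v σ j i ε) (hs : ∀ k, 0 ≤ s k)
    (hs1 : ∑ k, s k = 1) {f : ℕ → Ω → Fin m → ℝ} {b : ℝ}
    (hf : ∀ t < A.T, ∀ k, Measurable[pastAlgebra j i ε t] fun ω => f t ω k)
    (hf0 : ∀ t ω k, 0 ≤ f t ω k) (hfb : ∀ t ω k, f t ω k ≤ b) (t : ℕ) (ht : t ≤ A.T) :
    ∫ ω, typeDeviation s j f t ω ^ 2 ∂μ ≤ t * b ^ 2 := by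
  induction t with
  | zero => simp [typeDeviation]
  | succ t ih =>
    have ih := ih (by omega)
    have ht' : t < A.T := by omega
    have hSm := measurable_typeDeviation (s := s) (le_refl t)
      (fun τ hτ => hf τ (hτ.trans ht') : ∀ τ < t, ∀ k, Measurable[pastAlgebra j i ε τ] _)
    have hSm0 : Measurable (typeDeviation s j f t) := hSm.mono (hrun.pastAlgebra_le ht'.le) le_rfl
    have hSb := abs_typeDeviation_le (j := j) hs hs1 hf0 hfb t
    have hfm0 : ∀ k, Measurable fun ω => f t ω k := fun k =>
      (hf t ht' k).mono (hrun.pastAlgebra_le ht'.le) le_rfl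
    set D : Ω → ℝ := fun ω => f t ω (j t ω) - ∑ k, s k * f t ω k with hD
    have hDm : Measurable D := (measurable_apply_countable (f := fun k ω => f t ω k) hfm0
      (hrun.measurable_type t ht')).sub (Finset.measurable_sum _ fun k _ => (hfm0 k).const_mul _)
    have hDb : ∀ ω, |D ω| ≤ b := fun ω => abs_type_sub_mean_le hs hs1 (hf0 t ω) (hfb t ω) _
    -- Splitting the increment by types leaves, for each k, the centered indicator of type k times a
    -- bounded function of the past; independence makes each expectation vanish.
    have hcross : ∫ ω, typeDeviation s j f t ω * D ω ∂μ = 0 := by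
      have h1 : ∀ ω, typeDeviation s j f t ω * D ω = ∑ k, ((if j t ω = k then 1 else 0) - s k)
          * (typeDeviation s j f t ω * f t ω k) := by
        intro ω
        have : D ω = ∑ k, ((if j t ω = k then 1 else 0) - s k) * f t ω k := by
          simp [hD, sub_mul, Finset.sum_sub_distrib]
        rw [this, Finset.mul_sum]
        exact Finset.sum_congr rfl fun k _ => by ring
      simp only [h1]
      have hXm : ∀ k, Measurable[pastAlgebra j i ε t] fun ω =>
          typeDeviation s j f t ω * f t ω k := fun k => hSm.mul (hf t ht' k)
      have hXb : ∀ k ω, |typeDeviation s j f t ω * f t ω k| ≤ t * b * b := by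
        intro k ω
        rw [abs_mul, abs_of_nonneg (hf0 t ω k)]
        exact mul_le_mul (hSb ω) (hfb t ω k) (hf0 t ω k) ((abs_nonneg _).trans (hSb ω))
      rw [integral_finsetSum]
      · exact Finset.sum_eq_zero fun k _ => hrun.integral_centered_type ht' (hXm k) (hXb k) k
      · intro k _
        have hset : MeasurableSet {ω | j t ω = k} :=
          measurableSet_eq_fun (hrun.measurable_type t ht') measurable_const
        refine Integrable.bdd_mul (c := 1 + |s k|) (integrable_of_bounded ((hXm k).mono
          (hrun.pastAlgebra_le ht'.le) le_rfl) (hXb k))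
          ((Measurable.ite hset measurable_const measurable_const).sub
            measurable_const).aestronglyMeasurable (Filter.Eventually.of_forall fun ω => ?_)
        rw [Real.norm_eq_abs]
        refine (abs_sub _ _).trans (add_le_add ?_ le_rfl)
        split_ifs <;> simp
    have hexp : ∀ ω, typeDeviation s j f (t + 1) ω ^ 2
        = typeDeviation s j f t ω ^ 2 + 2 * (typeDeviation s j f t ω * D ω) + D ω ^ 2 := by
      intro ω
      have : typeDeviation s j f (t + 1) ω = typeDeviation s j f t ω + D ω := by
        simp only [typeDeviation, Finset.sum_range_succ, hD]
      rw [this]; ring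
    simp only [hexp]
    have hb0 : 0 ≤ t * b := by
      obtain ⟨ω⟩ : Nonempty Ω := nonempty_of_isProbabilityMeasure μ
      exact (abs_nonneg _).trans (hSb ω)
    have i1 : Integrable (fun ω => typeDeviation s j f t ω ^ 2) μ :=
      integrable_of_bounded (hSm0.pow_const 2) (b := (t * b) ^ 2) fun ω => by
        rw [abs_pow]; exact pow_le_pow_left₀ (abs_nonneg _) (hSb ω) 2
    have i2 : Integrable (fun ω => 2 * (typeDeviation s j f t ω * D ω)) μ :=
      (integrable_of_bounded (hSm0.mul hDm) (b := t * b * b) fun ω => by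
        rw [Pi.mul_apply, abs_mul]
        exact mul_le_mul (hSb ω) (hDb ω) (abs_nonneg _) hb0).const_mul 2
    have i3 : Integrable (fun ω => D ω ^ 2) μ :=
      integrable_of_bounded (hDm.pow_const 2) (b := b ^ 2) fun ω => by
        rw [abs_pow]; exact pow_le_pow_left₀ (abs_nonneg _) (hDb ω) 2
    have i12 : Integrable (fun ω => typeDeviation s j f t ω ^ 2
      + 2 * (typeDeviation s j f t ω * D ω)) μ := i1.add i2
    rw [integral_add i12 i3, integral_add i1 i2, integral_const_mul, hcross]
    have h3 : ∫ ω, D ω ^ 2 ∂μ ≤ b ^ 2 := by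
      calc ∫ ω, D ω ^ 2 ∂μ ≤ ∫ _, b ^ 2 ∂μ := integral_mono i3 (integrable_const _) fun ω => by
            rw [← sq_abs]; exact pow_le_pow_left₀ (abs_nonneg _) (hDb ω) 2
        _ = b ^ 2 := by simp
    push_cast
    linarith

theorem IsRun.integral_abs_typeDeviation_le (hrun : IsRun μ A s v σ j i ε) (hT : 1 ≤ A.T)
    (hs : ∀ k, 0 ≤ s k) (hs1 : ∑ k, s k = 1) {f : ℕ → Ω → Fin m → ℝ} {b : ℝ} (hb : 0 < b)
    (hf : ∀ t < A.T, ∀ k, Measurable[pastAlgebra j i ε t] fun ω => f t ω k)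
    (hf0 : ∀ t ω k, 0 ≤ f t ω k) (hfb : ∀ t ω k, f t ω k ≤ b) :
    Integrable (fun ω => |typeDeviation s j f A.T ω|) μ ∧
      ∫ ω, |typeDeviation s j f A.T ω| ∂μ ≤ b * Real.sqrt A.T := by
  have hSm : Measurable (typeDeviation s j f A.T) :=
    (measurable_typeDeviation (ε := ε) (i := i) le_rfl hf).mono (hrun.pastAlgebra_le le_rfl) le_rfl
  have hSb := abs_typeDeviation_le (j := j) hs hs1 hf0 hfb A.T
  have hi : Integrable (typeDeviation s j f A.T) μ := integrable_of_bounded hSm hSb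
  have hi2 : Integrable (fun ω => typeDeviation s j f A.T ω ^ 2) μ :=
    integrable_of_bounded (hSm.pow_const 2) (b := (A.T * b) ^ 2) fun ω => by
      rw [abs_pow]; exact pow_le_pow_left₀ (abs_nonneg _) (hSb ω) 2
  refine ⟨hi.abs, ?_⟩
  have hT0 : (0 : ℝ) < A.T := by exact_mod_cast hT
  -- The choice r = b√T balances the two terms, since the second moment is at most Tb².
  have hr : 0 < b * Real.sqrt A.T := mul_pos hb (Real.sqrt_pos.2 hT0)
  have h2 := hrun.integral_typeDeviation_sq_le hs hs1 hf hf0 hfb A.T le_rfl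
  calc ∫ ω, |typeDeviation s j f A.T ω| ∂μ
      ≤ ∫ ω, (typeDeviation s j f A.T ω ^ 2 / (b * Real.sqrt A.T) + b * Real.sqrt A.T) / 2 ∂μ :=
        integral_mono hi.abs (((hi2.div_const _).add (integrable_const _)).div_const _)
          fun ω => abs_le_add_sq_div hr
    _ = ((∫ ω, typeDeviation s j f A.T ω ^ 2 ∂μ) / (b * Real.sqrt A.T) + b * Real.sqrt A.T) / 2 := by
        rw [integral_div, integral_add (hi2.div_const _) (integrable_const _), integral_div]
        simp
    _ ≤ (A.T * b ^ 2 / (b * Real.sqrt A.T) + b * Real.sqrt A.T) / 2 := by gcongr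
    _ = b * Real.sqrt A.T := by
        have : (A.T : ℝ) * b ^ 2 / (b * Real.sqrt A.T) = b * Real.sqrt A.T := by
          rw [div_eq_iff hr.ne']
          nlinarith [Real.mul_self_sqrt hT0.le]
        rw [this]; ring

end Martingale

end FairDivision

/-! ### Concentration of the noise -/

namespace FairDivision

/-- On G, the measure with density X is dominated by K times μ; integrating W against both measures
gives the claim. Working with nonnegative integrals, W needs no integrability, which is not yet
available for products of exponentials. -/
theorem lintegral_mul_ofReal_le_of_condExp_le {Ω : Type*} {G m0 : MeasurableSpace Ω}
    {μ : Measure Ω} [IsProbabilityMeasure μ] (hG : G ≤ m0) {X : Ω → ℝ} (hXm : Measurable X)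
    (hX : Integrable X μ) (hX0 : ∀ ω, 0 ≤ X ω) {K : ℝ} (hK : μ[X | G] ≤ᵐ[μ] fun _ => K)
    {W : Ω → ENNReal} (hW : Measurable[G] W) :
    ∫⁻ ω, ENNReal.ofReal (X ω) * W ω ∂μ ≤ ENNReal.ofReal K * ∫⁻ ω, W ω ∂μ := by
  have hle : (μ.withDensity fun ω => ENNReal.ofReal (X ω)).trim hG
      ≤ (ENNReal.ofReal K • μ).trim hG := by
    refine (@Measure.le_iff Ω G _ _).2 fun S hS => ?_
    have hS0 : MeasurableSet S := hG S hS
    rw [trim_measurableSet_eq hG hS, trim_measurableSet_eq hG hS, withDensity_apply _ hS0,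
      ← ofReal_integral_eq_lintegral_ofReal hX.integrableOn (Filter.Eventually.of_forall hX0),
      ← setIntegral_condExp hG hX hS, Measure.smul_apply, smul_eq_mul]
    have h1 : ∫ ω in S, (μ[X | G]) ω ∂μ ≤ ∫ _ in S, K ∂μ :=
      setIntegral_mono_ae integrable_condExp.integrableOn (integrable_const K).integrableOn hK
    rw [setIntegral_const, smul_eq_mul, mul_comm] at h1
    have hK0 : ∫ ω in S, (μ[X | G]) ω ∂μ ≤ K * μ.real S := h1
    refine (ENNReal.ofReal_le_ofReal hK0).trans ?_
    rw [mul_comm K, ENNReal.ofReal_mul measureReal_nonneg, mul_comm,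
      measureReal_def, ENNReal.ofReal_toReal (measure_ne_top _ _)]
  have h1 := @lintegral_mono' Ω G _ _ hle W W le_rfl
  rw [lintegral_trim hG hW, lintegral_trim hG hW, lintegral_smul_measure,
    lintegral_withDensity_eq_lintegral_mul _ hXm.ennreal_ofReal (hW.mono hG le_rfl)] at h1
  exact h1

section Noise

variable {n m : ℕ} {Ω : Type*} {v : Fin n → Fin m → ℝ} {j : ℕ → Ω → Fin m} {i : ℕ → Ω → Fin n}
  {ε : ℕ → Ω → ℝ} {s : Fin m → ℝ} {σ : ℝ}

theorem preNoiseAlgebra_le_past {τ t : ℕ} (h : τ < t) :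
    preNoiseAlgebra j i ε τ ≤ pastAlgebra j i ε t := by
  refine Measurable.comap_le (m₁ := pastAlgebra j i ε t) ?_
  exact Measurable.prodMk (measurable_iff_comap_le.2 (pastAlgebra_mono h.le))
    ((measurable_type_past h).prodMk (measurable_winner_past h))

/-- The sum of the noises of the first `T` rounds that satisfy `θ`. -/
def maskedNoise (ε : ℕ → Ω → ℝ) (T : ℕ) (θ : ℕ → Ω → Prop) [∀ t, DecidablePred (θ t)]
    (ω : Ω) : ℝ :=
  ∑ t ∈ Finset.range T, if θ t ω then ε t ω else 0

variable [m0 : MeasurableSpace Ω] {μ : Measure Ω} {A : Alg n} {θ : ℕ → Ω → Prop}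
  [∀ t, DecidablePred (θ t)]

theorem IsRun.measurable_maskedNoise (hrun : IsRun μ A s v σ j i ε)
    (hθ : ∀ t < A.T, MeasurableSet[preNoiseAlgebra j i ε t] {ω | θ t ω}) :
    Measurable (maskedNoise ε A.T θ) := by
  refine Finset.measurable_sum _ fun t ht => ?_
  have ht := Finset.mem_range.1 ht
  exact Measurable.ite (hrun.preNoiseAlgebra_le ht _ (hθ t ht)) (hrun.measurable_noise t ht)
    measurable_const

variable [IsProbabilityMeasure μ]

/-- The exponential supermartingale of the noises at predictable rounds. -/
theorem IsRun.lintegral_prod_le_one (hrun : IsRun μ A s v σ j i ε)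
    (hθ : ∀ t < A.T, MeasurableSet[preNoiseAlgebra j i ε t] {ω | θ t ω}) (r : ℝ) (t : ℕ)
    (ht : t ≤ A.T) :
    ∫⁻ ω, ∏ τ ∈ Finset.range t, (if θ τ ω then
      ENNReal.ofReal (Real.exp (-(r ^ 2 * σ ^ 2 / 2))) * ENNReal.ofReal (Real.exp (r * ε τ ω))
      else 1) ∂μ ≤ 1 := by
  induction t with
  | zero => simp
  | succ t ih =>
    have ih := ih (by omega)
    have ht' : t < A.T := by omega
    have hG := hrun.preNoiseAlgebra_le ht'
    set Z : Ω → ENNReal := fun ω => ∏ τ ∈ Finset.range t, (if θ τ ω then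
      ENNReal.ofReal (Real.exp (-(r ^ 2 * σ ^ 2 / 2))) * ENNReal.ofReal (Real.exp (r * ε τ ω))
      else 1) with hZ
    have hZm : Measurable[preNoiseAlgebra j i ε t] Z := by
      let _ := preNoiseAlgebra j i ε t
      refine Finset.measurable_prod _ fun τ hτ => ?_
      have hτ := Finset.mem_range.1 hτ
      have hle : preNoiseAlgebra j i ε τ ≤ preNoiseAlgebra j i ε t :=
        (preNoiseAlgebra_le_past hτ).trans (pastAlgebra_le_preNoise t)
      have hε : Measurable (ε τ) :=
        (measurable_noise_past hτ).mono (pastAlgebra_le_preNoise t) le_rfl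
      refine Measurable.ite (hle _ (hθ τ (hτ.trans ht'))) ?_ measurable_const
      exact (Real.measurable_exp.comp (hε.const_mul r)).ennreal_ofReal.const_mul _
    have hZm0 : Measurable Z := hZm.mono hG le_rfl
    have hθt := hθ t ht'
    have hθ0 : MeasurableSet {ω | θ t ω} := hG _ hθt
    -- The mask is known before the noise. Where it holds, the compensator cancels the conditional
    -- moment bound; elsewhere the product does not change.
    set W : Ω → ENNReal := fun ω => if θ t ω then
      ENNReal.ofReal (Real.exp (-(r ^ 2 * σ ^ 2 / 2))) * Z ω else 0 with hW
    have hWm : Measurable[preNoiseAlgebra j i ε t] W := by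
      let _ := preNoiseAlgebra j i ε t
      exact Measurable.ite hθt (hZm.const_mul _) measurable_const
    have hεm : Measurable fun ω => Real.exp (r * ε t ω) :=
      Real.measurable_exp.comp ((hrun.measurable_noise t ht').const_mul r)
    have key := lintegral_mul_ofReal_le_of_condExp_le hG hεm (hrun.noise_integrable t ht' r)
      (fun ω => (Real.exp_pos _).le) (hrun.noise_subgaussian t ht' r) hWm
    have hK : ENNReal.ofReal (Real.exp (r ^ 2 * σ ^ 2 / 2))
        * ENNReal.ofReal (Real.exp (-(r ^ 2 * σ ^ 2 / 2))) = 1 := by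
      rw [← ENNReal.ofReal_mul (Real.exp_pos _).le, ← Real.exp_add, add_neg_cancel, Real.exp_zero,
        ENNReal.ofReal_one]
    have hKW : ENNReal.ofReal (Real.exp (r ^ 2 * σ ^ 2 / 2)) * ∫⁻ ω, W ω ∂μ
        = ∫⁻ ω, (if θ t ω then Z ω else 0) ∂μ := by
      rw [← lintegral_const_mul _ (hWm.mono hG le_rfl)]
      refine lintegral_congr fun ω => ?_
      simp only [hW]
      split_ifs
      · rw [← mul_assoc, hK, one_mul]
      · simp
    rw [hKW] at key
    calc ∫⁻ ω, ∏ τ ∈ Finset.range (t + 1), (if θ τ ω then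
          ENNReal.ofReal (Real.exp (-(r ^ 2 * σ ^ 2 / 2)))
            * ENNReal.ofReal (Real.exp (r * ε τ ω)) else 1) ∂μ
        = ∫⁻ ω, (ENNReal.ofReal (Real.exp (r * ε t ω)) * W ω + if θ t ω then 0 else Z ω) ∂μ := by
          refine lintegral_congr fun ω => ?_
          rw [Finset.prod_range_succ]
          simp only [hW]
          split_ifs
          · rw [add_zero, mul_comm, mul_comm _ (ENNReal.ofReal (Real.exp (r * ε t ω))), mul_assoc]
          · rw [mul_zero, zero_add, mul_one]
      _ = ∫⁻ ω, ENNReal.ofReal (Real.exp (r * ε t ω)) * W ω ∂μ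
          + ∫⁻ ω, (if θ t ω then 0 else Z ω) ∂μ :=
          lintegral_add_right _ (Measurable.ite hθ0 measurable_const hZm0)
      _ ≤ ∫⁻ ω, (if θ t ω then Z ω else 0) ∂μ + ∫⁻ ω, (if θ t ω then 0 else Z ω) ∂μ :=
          add_le_add key le_rfl
      _ = ∫⁻ ω, Z ω ∂μ := by
          rw [← lintegral_add_right _ (Measurable.ite hθ0 measurable_const hZm0)]
          refine lintegral_congr fun ω => ?_
          split_ifs <;> simp
      _ ≤ 1 := ih

/-- A sum of at most `N` noises at predictable rounds is sub-Gaussian. -/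
theorem IsRun.lintegral_exp_maskedNoise_le (hrun : IsRun μ A s v σ j i ε)
    (hθ : ∀ t < A.T, MeasurableSet[preNoiseAlgebra j i ε t] {ω | θ t ω}) {N : ℕ}
    (hN : ∀ ω, ((Finset.range A.T).filter fun t => θ t ω).card ≤ N) (r : ℝ) :
    ∫⁻ ω, ENNReal.ofReal (Real.exp (r * maskedNoise ε A.T θ ω)) ∂μ
      ≤ ENNReal.ofReal (Real.exp (N * (r ^ 2 * σ ^ 2 / 2))) := by
  set q := r ^ 2 * σ ^ 2 / 2 with hq
  have hq0 : 0 ≤ q := by positivity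
  have h1 := hrun.lintegral_prod_le_one hθ r A.T le_rfl
  have h2 : ∀ ω, ENNReal.ofReal (Real.exp (r * maskedNoise ε A.T θ ω))
      ≤ ENNReal.ofReal (Real.exp (N * q)) * ∏ τ ∈ Finset.range A.T, (if θ τ ω then
      ENNReal.ofReal (Real.exp (-q)) * ENNReal.ofReal (Real.exp (r * ε τ ω)) else 1) := by
    intro ω
    have h3 : ∏ τ ∈ Finset.range A.T, (if θ τ ω then
        ENNReal.ofReal (Real.exp (-q)) * ENNReal.ofReal (Real.exp (r * ε τ ω)) else 1)
        = ENNReal.ofReal (Real.exp (∑ τ ∈ Finset.range A.T,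
          if θ τ ω then (-q + r * ε τ ω) else 0)) := by
      rw [Real.exp_sum, ENNReal.ofReal_prod_of_nonneg fun τ _ => (Real.exp_pos _).le]
      refine Finset.prod_congr rfl fun τ _ => ?_
      split_ifs
      · rw [Real.exp_add, ENNReal.ofReal_mul (Real.exp_pos _).le]
      · simp
    rw [h3, ← ENNReal.ofReal_mul (Real.exp_pos _).le, ← Real.exp_add]
    refine ENNReal.ofReal_le_ofReal (Real.exp_le_exp.2 ?_)
    have h4 : ∑ τ ∈ Finset.range A.T, (if θ τ ω then (-q + r * ε τ ω) else 0)
        = -(((Finset.range A.T).filter fun t => θ t ω).card * q) + r * maskedNoise ε A.T θ ω := by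
      rw [maskedNoise, Finset.mul_sum, ← Finset.sum_filter, Finset.sum_add_distrib,
        Finset.sum_const, nsmul_eq_mul, mul_neg, Finset.sum_filter]
      congr 1
      exact Finset.sum_congr rfl fun τ _ => by split_ifs <;> simp
    have h5 : (((Finset.range A.T).filter fun t => θ t ω).card : ℝ) * q ≤ N * q :=
      mul_le_mul_of_nonneg_right (by exact_mod_cast hN ω) hq0
    rw [h4]
    linarith
  calc _ ≤ ∫⁻ ω, ENNReal.ofReal (Real.exp (N * q)) * ∏ τ ∈ Finset.range A.T, (if θ τ ω then
      ENNReal.ofReal (Real.exp (-q)) * ENNReal.ofReal (Real.exp (r * ε τ ω)) else 1) ∂μ :=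
        lintegral_mono h2
    _ ≤ ENNReal.ofReal (Real.exp (N * q)) * 1 := by
        rw [lintegral_const_mul' _ _ ENNReal.ofReal_ne_top]
        exact mul_le_mul_right h1 _
    _ = _ := mul_one _

theorem IsRun.integrable_exp_maskedNoise (hrun : IsRun μ A s v σ j i ε)
    (hθ : ∀ t < A.T, MeasurableSet[preNoiseAlgebra j i ε t] {ω | θ t ω}) {N : ℕ}
    (hN : ∀ ω, ((Finset.range A.T).filter fun t => θ t ω).card ≤ N) (r : ℝ) :
    Integrable (fun ω => Real.exp (r * maskedNoise ε A.T θ ω)) μ ∧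
      ∫ ω, Real.exp (r * maskedNoise ε A.T θ ω) ∂μ ≤ Real.exp (N * (r ^ 2 * σ ^ 2 / 2)) := by
  have hm : Measurable fun ω => Real.exp (r * maskedNoise ε A.T θ ω) :=
    Real.measurable_exp.comp ((hrun.measurable_maskedNoise hθ).const_mul r)
  have h1 := hrun.lintegral_exp_maskedNoise_le hθ hN r
  constructor
  · exact (lintegral_ofReal_ne_top_iff_integrable hm.aestronglyMeasurable
      (Filter.Eventually.of_forall fun ω => (Real.exp_pos _).le)).1
      (ne_top_of_le_ne_top ENNReal.ofReal_ne_top h1)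
  · rw [integral_eq_lintegral_of_nonneg_ae (Filter.Eventually.of_forall fun ω =>
      (Real.exp_pos _).le) hm.aestronglyMeasurable]
    exact ENNReal.toReal_le_of_le_ofReal (Real.exp_pos _).le h1

theorem abs_le_exp_add_exp_neg (x : ℝ) : |x| ≤ Real.exp x + Real.exp (-x) := by
  have h1 := Real.add_one_le_exp x
  have h2 := Real.add_one_le_exp (-x)
  have h3 := Real.exp_pos x
  have h4 := Real.exp_pos (-x)
  rcases abs_cases x with h | h <;> linarith

/-- The scale r = 1/√T makes the exponential moment a constant: with at most T terms its exponent is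
at most σ²/2 ≤ c/4. Then |x| ≤ √T (e^{rx} + e^{−rx}) finishes. -/
theorem IsRun.integral_abs_maskedNoise_le (hrun : IsRun μ A s v σ j i ε) (hT : 1 ≤ A.T)
    (hθ : ∀ t < A.T, MeasurableSet[preNoiseAlgebra j i ε t] {ω | θ t ω}) {c : ℝ}
    (hc : 2 * σ ^ 2 ≤ c) :
    Integrable (fun ω => |maskedNoise ε A.T θ ω|) μ ∧
      ∫ ω, |maskedNoise ε A.T θ ω| ∂μ ≤ 2 * Real.exp (c / 4) * Real.sqrt A.T := by
  have hN : ∀ ω, ((Finset.range A.T).filter fun t => θ t ω).card ≤ A.T := fun ω =>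
    (Finset.card_filter_le _ _).trans (by simp)
  have hT0 : (0 : ℝ) < A.T := by exact_mod_cast hT
  have hsT : 0 < Real.sqrt A.T := Real.sqrt_pos.2 hT0
  set r := 1 / Real.sqrt A.T with hr
  have hr0 : 0 < r := by positivity
  have hr2 : (A.T : ℝ) * r ^ 2 = 1 := by
    rw [hr, div_pow, Real.sq_sqrt hT0.le]; field_simp
  obtain ⟨i1, b1⟩ := hrun.integrable_exp_maskedNoise hθ hN r
  obtain ⟨i2, b2⟩ := hrun.integrable_exp_maskedNoise hθ hN (-r)
  have hpt : ∀ ω, |maskedNoise ε A.T θ ω| ≤ Real.sqrt A.T *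
      (Real.exp (r * maskedNoise ε A.T θ ω) + Real.exp (-r * maskedNoise ε A.T θ ω)) := by
    intro ω
    have h := abs_le_exp_add_exp_neg (r * maskedNoise ε A.T θ ω)
    rw [abs_mul, abs_of_pos hr0] at h
    have h2 := mul_le_mul_of_nonneg_left h hsT.le
    rw [← mul_assoc, hr, mul_one_div_cancel hsT.ne', one_mul] at h2
    rw [neg_mul]
    exact h2
  have hint := (i1.add i2).const_mul (Real.sqrt A.T)
  have hm := hrun.measurable_maskedNoise hθ
  have hi : Integrable (fun ω => |maskedNoise ε A.T θ ω|) μ := by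
    refine Integrable.mono' hint hm.abs.aestronglyMeasurable
      (Filter.Eventually.of_forall fun ω => ?_)
    rw [Real.norm_eq_abs, abs_abs]
    exact hpt ω
  refine ⟨hi, ?_⟩
  have hexp : Real.exp (A.T * (r ^ 2 * σ ^ 2 / 2)) ≤ Real.exp (c / 4) := by
    refine Real.exp_le_exp.2 ?_
    have : (A.T : ℝ) * (r ^ 2 * σ ^ 2 / 2) = (A.T * r ^ 2) * (σ ^ 2 / 2) := by ring
    rw [this, hr2]; linarith
  rw [neg_sq] at b2
  calc ∫ ω, |maskedNoise ε A.T θ ω| ∂μ ≤ ∫ ω, Real.sqrt A.T *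
      (Real.exp (r * maskedNoise ε A.T θ ω) + Real.exp (-r * maskedNoise ε A.T θ ω)) ∂μ :=
        integral_mono hi hint hpt
    _ = Real.sqrt A.T * (∫ ω, Real.exp (r * maskedNoise ε A.T θ ω) ∂μ
        + ∫ ω, Real.exp (-r * maskedNoise ε A.T θ ω) ∂μ) := by
        rw [integral_const_mul, integral_add i1 i2]
    _ ≤ Real.sqrt A.T * (Real.exp (c / 4) + Real.exp (c / 4)) := by gcongr <;> linarith
    _ = _ := by ring

/-- A one-sided Chernoff bound from a moment generating function. -/
theorem measureReal_lt_le_exp {X : Ω → ℝ} {c L N : ℝ} (hc : 0 < c) (hL : 0 ≤ L) (hN : 0 < N)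
    (hX : ∀ r : ℝ, Integrable (fun ω => Real.exp (r * X ω)) μ ∧
      ∫ ω, Real.exp (r * X ω) ∂μ ≤ Real.exp (N * (r ^ 2 * (c / 4)))) :
    μ.real {ω | Real.sqrt (c * L) * Real.sqrt N < X ω} ≤ Real.exp (-L) := by
  set a := Real.sqrt (c * L) * Real.sqrt N with ha
  have ha0 : 0 ≤ a := by positivity
  have ha2 : a ^ 2 = c * L * N := by
    rw [ha, mul_pow, Real.sq_sqrt (by positivity), Real.sq_sqrt hN.le]
  -- The minimizer of N r² c/4 − r a, where the two terms are L and 2L.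
  set r := 2 * a / (N * c) with hr
  have hr0 : 0 ≤ r := by positivity
  obtain ⟨hi, hb⟩ := hX r
  have h1 := mul_meas_ge_le_integral_of_nonneg (Filter.Eventually.of_forall fun ω =>
    (Real.exp_pos (r * X ω)).le) hi (Real.exp (r * a))
  have h2 : μ.real {ω | a < X ω} ≤ μ.real {ω | Real.exp (r * a) ≤ Real.exp (r * X ω)} := by
    refine measureReal_mono fun ω hω => ?_
    exact Real.exp_le_exp.2 (mul_le_mul_of_nonneg_left (le_of_lt hω) hr0)
  have h3 : Real.exp (r * a) * μ.real {ω | a < X ω} ≤ Real.exp (N * (r ^ 2 * (c / 4))) :=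
    (mul_le_mul_of_nonneg_left h2 (Real.exp_pos _).le).trans (h1.trans hb)
  have h4 : Real.exp (N * (r ^ 2 * (c / 4))) = Real.exp (r * a) * Real.exp (-L) := by
    rw [← Real.exp_add]
    congr 1
    have h5 : r * a = 2 * L := by
      rw [hr, div_mul_eq_mul_div, div_eq_iff (by positivity)]
      nlinarith
    have h6 : N * (r ^ 2 * (c / 4)) = L := by
      have : N * (r ^ 2 * (c / 4)) = r * (2 * a / (N * c)) * (N * c) / 4 := by rw [← hr]; ring
      rw [this, mul_assoc, div_mul_cancel₀ _ (by positivity)]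
      linarith
    rw [h5, h6]; ring
  rw [h4] at h3
  exact le_of_mul_le_mul_left h3 (Real.exp_pos _)

/-- The nonnegative function e^X + e^{−X} − 2 has nonpositive integral, and it vanishes only where X
= 0. This covers c = 0, where the Chernoff parameter would divide by zero. -/
theorem ae_eq_zero_of_exp {X : Ω → ℝ} (hX : ∀ r : ℝ, Integrable (fun ω => Real.exp (r * X ω)) μ ∧
      ∫ ω, Real.exp (r * X ω) ∂μ ≤ 1) : ∀ᵐ ω ∂μ, X ω = 0 := by
  obtain ⟨i1, b1⟩ := hX 1
  obtain ⟨i2, b2⟩ := hX (-1)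
  have hpos : ∀ ω, 0 ≤ (Real.exp (1 * X ω) - 1 - X ω) + (Real.exp (-1 * X ω) - 1 + X ω) := by
    intro ω
    have h1 := Real.add_one_le_exp (1 * X ω)
    have h2 := Real.add_one_le_exp (-1 * X ω)
    linarith
  have hi : Integrable (fun ω => (Real.exp (1 * X ω) - 1 - X ω)
      + (Real.exp (-1 * X ω) - 1 + X ω)) μ := by
    refine ((i1.add i2).sub (integrable_const 2)).congr (Filter.Eventually.of_forall fun ω => ?_)
    simp only [Pi.sub_apply, Pi.add_apply]
    ring
  have hz : ∫ ω, ((Real.exp (1 * X ω) - 1 - X ω) + (Real.exp (-1 * X ω) - 1 + X ω)) ∂μ = 0 := by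
    refine le_antisymm ?_ (integral_nonneg hpos)
    have : ∀ ω, (Real.exp (1 * X ω) - 1 - X ω) + (Real.exp (-1 * X ω) - 1 + X ω)
        = (Real.exp (1 * X ω) + Real.exp (-1 * X ω)) - 2 := fun ω => by ring
    simp only [this]
    have i12 : Integrable (fun ω => Real.exp (1 * X ω) + Real.exp (-1 * X ω)) μ := i1.add i2
    rw [integral_sub i12 (integrable_const 2), integral_add i1 i2]
    have h2 : ∫ _, (2 : ℝ) ∂μ = 2 := by simp
    linarith
  have h0 := (integral_eq_zero_iff_of_nonneg hpos hi).1 hz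
  filter_upwards [h0] with ω hω
  by_contra hne
  have h1 := Real.add_one_lt_exp (x := 1 * X ω) (by simpa using hne)
  have h2 := Real.add_one_le_exp (-1 * X ω)
  simp only [Pi.zero_apply] at hω
  linarith

/-- The two-sided concentration of a sum of at most `N` noises at predictable rounds. -/
theorem IsRun.measureReal_maskedNoise_le (hrun : IsRun μ A s v σ j i ε)
    (hθ : ∀ t < A.T, MeasurableSet[preNoiseAlgebra j i ε t] {ω | θ t ω}) {N : ℕ} (hN1 : 1 ≤ N)
    (hN : ∀ ω, ((Finset.range A.T).filter fun t => θ t ω).card ≤ N) {c L : ℝ}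
    (hc : 2 * σ ^ 2 ≤ c) (hL : 0 ≤ L) :
    μ.real {ω | Real.sqrt (c * L) * Real.sqrt N < |maskedNoise ε A.T θ ω|}
      ≤ 2 * Real.exp (-L) := by
  have hN0 : (0 : ℝ) < N := by exact_mod_cast hN1
  -- The condition c ≥ 2σ² enters here: σ²/2 ≤ c/4.
  have hexp : ∀ r : ℝ, Integrable (fun ω => Real.exp (r * maskedNoise ε A.T θ ω)) μ ∧
      ∫ ω, Real.exp (r * maskedNoise ε A.T θ ω) ∂μ ≤ Real.exp (N * (r ^ 2 * (c / 4))) := by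
    intro r
    obtain ⟨h1, h2⟩ := hrun.integrable_exp_maskedNoise hθ hN r
    refine ⟨h1, h2.trans (Real.exp_le_exp.2 ?_)⟩
    refine mul_le_mul_of_nonneg_left ?_ hN0.le
    nlinarith [sq_nonneg r]
  have hc0 : 0 ≤ c := by nlinarith [sq_nonneg σ]
  rcases hc0.eq_or_lt with hc0 | hc0
  · have h0 : ∀ᵐ ω ∂μ, maskedNoise ε A.T θ ω = 0 := by
      refine ae_eq_zero_of_exp fun r => ?_
      have := hexp r
      rw [← hc0] at this
      simpa using this
    have : μ {ω | Real.sqrt (c * L) * Real.sqrt N < |maskedNoise ε A.T θ ω|} = 0 := by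
      refine measure_mono_null (fun ω hω => ?_) h0
      intro hzero
      simp only [Set.mem_ofPred_eq] at hω hzero
      rw [hzero, ← hc0] at hω
      simp at hω
    rw [measureReal_def, this]
    simp only [ENNReal.toReal_zero]
    positivity
  · have h1 := measureReal_lt_le_exp hc0 hL hN0 hexp
    have h2 := measureReal_lt_le_exp (X := fun ω => -maskedNoise ε A.T θ ω) hc0 hL hN0
      (fun r => by have := hexp (-r); simpa using this)
    have hsub : {ω | Real.sqrt (c * L) * Real.sqrt N < |maskedNoise ε A.T θ ω|}
        ⊆ {ω | Real.sqrt (c * L) * Real.sqrt N < maskedNoise ε A.T θ ω}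
          ∪ {ω | Real.sqrt (c * L) * Real.sqrt N < -maskedNoise ε A.T θ ω} := by
      intro ω hω
      simp only [Set.mem_union, Set.mem_ofPred_eq] at hω ⊢
      exact lt_abs.1 hω
    have h3 := (measureReal_mono (μ := μ) hsub).trans (measureReal_union_le _ _)
    linarith

end Noise

end FairDivision

/-! ### The confidence event and integrability of the welfare -/

namespace FairDivision

variable {n m : ℕ} {Ω : Type*} {v : Fin n → Fin m → ℝ} {j : ℕ → Ω → Fin m} {i : ℕ → Ω → Fin n}
  {ε : ℕ → Ω → ℝ} {s : Fin m → ℝ} {σ : ℝ} {A : Alg n}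

/-- Only the bound by N is needed later. The minimum with the count makes the induction work: a new
sample occurs only while the count is below N, and it raises the count. -/
theorem card_samples_le (A : Alg n) (v : Fin n → Fin m → ℝ) (j : ℕ → Fin m) (i : ℕ → Fin n)
    (e : ℕ → ℝ) (a : Fin n) (k : Fin m) (N t : ℕ) :
    ((Finset.range t).filter fun τ =>
      i τ = a ∧ j τ = k ∧ (A.pathMemory v j i e τ).count a k < N).card
      ≤ min N ((A.pathMemory v j i e t).count a k) := by
  induction t with
  | zero => simp
  | succ t ih =>
    rw [Finset.range_add_one, Finset.filter_insert]
    have hstep : (A.pathMemory v j i e (t + 1)).count a k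
        = (A.pathMemory v j i e t).count a k + if a = i t ∧ k = j t then 1 else 0 :=
      A.step_count _ _ _ _ _ _
    rw [hstep]
    split_ifs with h1 h2 h2
    · rw [Finset.card_insert_of_notMem (by simp)]
      omega
    · exact absurd ⟨h1.1.symm, h1.2.1.symm⟩ h2
    · omega
    · omega

/-- The served pair is `(a, k)`, with less than `N` earlier samples. -/
def IsSample (A : Alg n) (v : Fin n → Fin m → ℝ) (j : ℕ → Ω → Fin m) (i : ℕ → Ω → Fin n)
    (ε : ℕ → Ω → ℝ) (a : Fin n) (k : Fin m) (N t : ℕ) (ω : Ω) : Prop :=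
  i t ω = a ∧ j t ω = k ∧
    (A.pathMemory v (fun τ => j τ ω) (fun τ => i τ ω) (fun τ => ε τ ω) t).count a k < N

noncomputable instance (a : Fin n) (k : Fin m) (N t : ℕ) :
    DecidablePred (IsSample A v j i ε a k N t) := fun _ => by
  unfold IsSample; infer_instance

theorem measurableSet_isSample (a : Fin n) (k : Fin m) (N t : ℕ) :
    MeasurableSet[preNoiseAlgebra j i ε t] {ω | IsSample A v j i ε a k N t ω} := by
  let _ := preNoiseAlgebra j i ε t
  have h1 : MeasurableSet {ω | i t ω = a} :=
    measurableSet_eq_fun (measurable_winner_preNoise t) measurable_const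
  have h2 : MeasurableSet {ω | j t ω = k} :=
    measurableSet_eq_fun (measurable_type_preNoise t) measurable_const
  have h3 : Measurable fun ω =>
      (A.pathMemory v (fun τ => j τ ω) (fun τ => i τ ω) (fun τ => ε τ ω) t).count a k :=
    (@Alg.MeasurableMemory.count _ _ _ (pastAlgebra j i ε t) _
      (measurable_memory_past A le_rfl) a k).mono (pastAlgebra_le_preNoise t) le_rfl
  have h4 : MeasurableSet {ω | (A.pathMemory v (fun τ => j τ ω) (fun τ => i τ ω)
      (fun τ => ε τ ω) t).count a k < N} := measurableSet_lt h3 measurable_const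
  exact h1.inter (h2.inter h4)

/-- The event that all confidence intervals are valid. -/
def confidentEvent (A : Alg n) (v : Fin n → Fin m → ℝ) (j : ℕ → Ω → Fin m) (i : ℕ → Ω → Fin n)
    (ε : ℕ → Ω → ℝ) : Set Ω :=
  {ω | A.Confident v (fun τ => j τ ω) (fun τ => i τ ω) (fun τ => ε τ ω)}

theorem compl_confidentEvent_eq :
    (confidentEvent A v j i ε)ᶜ = ⋃ p : (Fin n × Fin m) × Fin A.T,
      {ω | Real.sqrt (A.c * Real.log ((A.T : ℝ) ^ 2)) * Real.sqrt ((p.2 : ℕ) + 1 : ℕ)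
        < |maskedNoise ε A.T (IsSample A v j i ε p.1.1 p.1.2 (p.2 + 1)) ω|} := by
  ext ω
  simp only [Set.mem_compl_iff, confidentEvent, Alg.Confident, Set.mem_ofPred_eq, Set.mem_iUnion]
  push Not
  constructor
  · rintro ⟨a, k, N, h1, h2, h3⟩
    obtain ⟨N, rfl⟩ : ∃ N', N = N' + 1 := ⟨N - 1, by omega⟩
    exact ⟨((a, k), ⟨N, by omega⟩), h3⟩
  · rintro ⟨⟨⟨a, k⟩, N⟩, h⟩
    exact ⟨a, k, N + 1, by omega, by omega, h⟩

variable [m0 : MeasurableSpace Ω] {μ : Measure Ω}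

theorem IsRun.measurableSet_confidentEvent (hrun : IsRun μ A s v σ j i ε) :
    MeasurableSet (confidentEvent A v j i ε) := by
  rw [← MeasurableSet.compl_iff, compl_confidentEvent_eq]
  refine MeasurableSet.iUnion fun p => measurableSet_lt measurable_const ?_
  exact (hrun.measurable_maskedNoise fun t _ => measurableSet_isSample _ _ _ _).abs

/-- A union bound over nm pairs and T sample sizes; L = log T² makes each failure probability at
most 2/T². -/
theorem IsRun.measureReal_compl_confidentEvent_le [IsProbabilityMeasure μ]
    (hrun : IsRun μ A s v σ j i ε) (hT : 1 ≤ A.T) (hc : 2 * σ ^ 2 ≤ A.c) :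
    μ.real (confidentEvent A v j i ε)ᶜ ≤ 2 * (n * m) / A.T := by
  have hT0 : (0 : ℝ) < A.T := by exact_mod_cast hT
  rw [compl_confidentEvent_eq]
  refine (measureReal_iUnion_fintype_le _).trans ?_
  have h1 : ∀ p : (Fin n × Fin m) × Fin A.T, μ.real {ω |
      Real.sqrt (A.c * Real.log ((A.T : ℝ) ^ 2)) * Real.sqrt ((p.2 : ℕ) + 1 : ℕ)
        < |maskedNoise ε A.T (IsSample A v j i ε p.1.1 p.1.2 (p.2 + 1)) ω|}
      ≤ 2 / (A.T : ℝ) ^ 2 := by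
    intro p
    refine (hrun.measureReal_maskedNoise_le (fun t _ => measurableSet_isSample _ _ _ _)
      (by omega) (fun ω => ?_) hc
      (Real.log_nonneg (one_le_pow₀ (by exact_mod_cast hT)))).trans (le_of_eq ?_)
    · exact (card_samples_le A v _ _ _ _ _ _ _).trans (min_le_left _ _)
    · rw [Real.exp_neg, Real.exp_log (by positivity)]; rfl
  refine (Finset.sum_le_card_nsmul _ _ _ fun p _ => h1 p).trans (le_of_eq ?_)
  simp only [Finset.card_univ, Fintype.card_prod, Fintype.card_fin, nsmul_eq_mul]
  push_cast
  field_simp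

theorem IsRun.integrable_cumUtility [IsProbabilityMeasure μ] (hrun : IsRun μ A s v σ j i ε)
    (a : Fin n) : Integrable (cumUtility v j i ε A.T a) μ := by
  refine integrable_finsetSum _ fun t ht => ?_
  have ht := Finset.mem_range.1 ht
  have hset : MeasurableSet {ω | i t ω = a} :=
    measurableSet_eq_fun (hrun.measurable_winner t ht) measurable_const
  have hε : Integrable (ε t) μ := by
    refine Integrable.mono' ((hrun.noise_integrable t ht 1).add (hrun.noise_integrable t ht (-1)))
      (hrun.measurable_noise t ht).aestronglyMeasurable (Filter.Eventually.of_forall fun ω => ?_)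
    have := abs_le_exp_add_exp_neg (ε t ω)
    simpa using this
  have hv : Integrable (fun ω => v (i t ω) (j t ω)) μ := by
    refine integrable_of_bounded (b := ∑ p : Fin n × Fin m, |v p.1 p.2|)
      ((measurable_of_countable fun p : Fin n × Fin m => v p.1 p.2).comp
        ((hrun.measurable_winner t ht).prodMk (hrun.measurable_type t ht))) fun ω => ?_
    exact Finset.single_le_sum (f := fun p : Fin n × Fin m => |v p.1 p.2|)
      (fun p _ => abs_nonneg _) (Finset.mem_univ (i t ω, j t ω))
  have hu : Integrable (utility v j i ε t) μ := hv.add hε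
  have := hu.indicator hset
  refine this.congr (Filter.Eventually.of_forall fun ω => ?_)
  simp [Set.indicator_apply]

theorem IsRun.integrable_nsw [IsProbabilityMeasure μ] (hrun : IsRun μ A s v σ j i ε)
    {B : Fin n → ℝ} (hB : ∀ a, 0 < B a) (hB1 : ∑ a, B a = 1) :
    Integrable (fun ω => nsw B fun a => cumUtility v j i ε A.T a ω) μ := by
  have hU := hrun.integrable_cumUtility
  have hUm : ∀ a, AEMeasurable (cumUtility v j i ε A.T a) μ := fun a => (hU a).aemeasurable
  -- A weighted geometric mean is at most any common bound of its entries; the summand 1 keeps this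
  -- bound positive.
  have hbound : Integrable (fun ω => ∑ a, |cumUtility v j i ε A.T a ω| + 1) μ :=
    (integrable_finsetSum _ fun a _ => (hU a).abs).add (integrable_const 1)
  refine Integrable.mono' hbound ?_ (Filter.Eventually.of_forall fun ω => ?_)
  · refine AEMeasurable.aestronglyMeasurable ?_
    unfold nsw
    exact Finset.aemeasurable_fun_prod _ fun a _ =>
      ((hUm a).max aemeasurable_const).pow_const _
  · have h0 : 0 ≤ nsw B fun a => cumUtility v j i ε A.T a ω :=
      Finset.prod_nonneg fun a _ => Real.rpow_nonneg (le_max_right _ _) _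
    have hs0 : 0 ≤ ∑ a, |cumUtility v j i ε A.T a ω| :=
      Finset.sum_nonneg fun a _ => abs_nonneg _
    rw [Real.norm_eq_abs, abs_of_nonneg h0]
    refine prod_rpow_le hB hB1 (fun a => le_max_right _ _) (fun a => max_le ?_ ?_) (by linarith)
    · have := Finset.single_le_sum (f := fun a => |cumUtility v j i ε A.T a ω|)
        (fun a _ => abs_nonneg _) (Finset.mem_univ a)
      have h2 := le_abs_self (cumUtility v j i ε A.T a ω)
      linarith
    · linarith

end FairDivision

/-! ### The expected regret and its constants -/

namespace FairDivision

theorem Alg.MeasurableMemory.shadowPrice {n m : ℕ} {Ω : Type*} [MeasurableSpace Ω]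
    {M : Ω → Memory n m} (hM : Alg.MeasurableMemory M) (A : Alg n) (v x : Fin n → Fin m → ℝ)
    (k : Fin m) : Measurable fun ω => A.shadowPrice v x (M ω) k := by
  refine Finset.measurable_sum _ fun a _ => Measurable.const_mul (Measurable.mul_const ?_ _) _
  exact measurable_const.div ((hM.mean a).max measurable_const)

variable {n m : ℕ} {Ω : Type*} {v : Fin n → Fin m → ℝ} {j : ℕ → Ω → Fin m} {i : ℕ → Ω → Fin n}
  {ε : ℕ → Ω → ℝ} {s : Fin m → ℝ} {σ : ℝ} {A : Alg n} [m0 : MeasurableSpace Ω] {μ : Measure Ω}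

/-- The explicit bound on the expected regret. -/
theorem IsRun.integral_regret_le [IsProbabilityMeasure μ] (hrun : IsRun μ A s v σ j i ε)
    (hA : A.Valid) (hB1 : ∑ a, A.B a = 1) (hT : 1 ≤ A.T) (hs : ∀ k, 0 ≤ s k)
    (hs1 : ∑ k, s k = 1) (hv : ∀ a k, A.l ≤ v a k ∧ v a k ≤ A.h) (hc : 2 * σ ^ 2 ≤ A.c)
    {b : ℝ} (hb : 0 < b) (hbB : ∀ a, b ≤ A.B a) :
    Integrable (regret A.B s v j i ε A.T) μ ∧
    ∫ ω, regret A.B s v j i ε A.T ω ∂μ ≤ A.h * (1 + 1 / (b * logGap A.δ₀)) *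
        ((1 + A.δ₀) / A.l * A.h * Real.sqrt A.T
          + n * ((1 + A.δ₀) ^ 2 * A.h ^ 2 / (A.l ^ 2 * b))
            * (2 * (n * m) * (1 + Real.log A.T) ^ 2)
          + (1 + A.δ₀) / A.l * (4 * A.width * (n * m * Real.sqrt A.T))
          + A.h / A.l * Real.sqrt A.T
          + ((1 + A.δ₀) / A.l + 1 / A.l) * (n * (2 * Real.exp (A.c / 4) * Real.sqrt A.T)))
      + 2 * A.h * (n * m) := by
  have hδ := hA.δ₀_pos
  have hl := hA.l_pos
  have hh := hA.h_pos
  have hγ := logGap_pos hδ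
  have hT0 : (0 : ℝ) < A.T := by exact_mod_cast hT
  have hv0 : ∀ a k, 0 ≤ v a k := fun a k => hl.le.trans (hv a k).1
  obtain ⟨x, hx, hu, honsw, hopt⟩ :=
    exists_optimal_allocation hA.B_pos hB1 hs hs1 hl fun a k => (hv a k).1
  have hul := weight_mul_le_of_optimal hA.B_pos hs hs1 hl (fun a k => (hv a k).1) hu hopt
  obtain ⟨w, hprice, hprice1⟩ := exists_prices hB1 hopt
  set price : Fin m → ℝ := fun k => A.B (w k) * v (w k) k / allocUtility s v x (w k) with hpr
  have hprice0 : ∀ k, 0 ≤ price k := fun k =>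
    div_nonneg (mul_nonneg (hA.B_pos _).le (hv0 _ _)) (hu _).le
  have hpriceb : ∀ k, price k ≤ A.h / A.l := by
    intro k
    rw [hpr, div_le_div_iff₀ (hu _) hl]
    have h1 := hul (w k)
    have h2 := (hv (w k) k).2
    have h3 := hA.B_pos (w k)
    calc A.B (w k) * v (w k) k * A.l = v (w k) k * (A.B (w k) * A.l) := by ring
      _ ≤ A.h * allocUtility s v x (w k) := mul_le_mul h2 h1 (by positivity) hh.le
  have honsw_le : onsw A.B s v ≤ A.h := by
    rw [honsw]
    exact prod_rpow_le hA.B_pos hB1 (fun a => (hu a).le)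
      (fun a => allocUtility_le hs hs1 hv0 (fun a k => (hv a k).2) hx a) hh
  have hint : Integrable (regret A.B s v j i ε A.T) μ :=
    (integrable_const _).sub (hrun.integrable_nsw hA.B_pos hB1)
  refine ⟨hint, ?_⟩
  set f : ℕ → Ω → Fin m → ℝ := fun t ω k => A.shadowPrice v x
    (A.pathMemory v (fun τ => j τ ω) (fun τ => i τ ω) (fun τ => ε τ ω) t) k with hf
  obtain ⟨iQ, bQ⟩ := hrun.integral_abs_typeDeviation_le (f := f)
    (b := (1 + A.δ₀) / A.l * A.h) hT hs hs1 (by positivity)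
    (fun t _ k => @Alg.MeasurableMemory.shadowPrice _ _ _ (pastAlgebra j i ε t) _
      (measurable_memory_past A le_rfl) A v x k)
    (fun t ω k => A.shadowPrice_nonneg hA _ hx hv0 k)
    (fun t ω k => A.shadowPrice_le_const hA _ hx hv0 (fun a k => (hv a k).2) k)
  obtain ⟨iP, bP⟩ := hrun.integral_abs_typeDeviation_le (f := fun _ _ k => price k)
    (b := A.h / A.l) hT hs hs1 (by positivity) (fun t _ k => measurable_const)
    (fun _ _ k => hprice0 k) (fun _ _ k => hpriceb k)
  have hS := fun a => hrun.integral_abs_maskedNoise_le (θ := fun t ω => i t ω = a) hT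
    (fun t _ => by
      let _ := preNoiseAlgebra j i ε t
      exact measurableSet_eq_fun (measurable_winner_preNoise t) measurable_const) hc
  set K := A.h * (1 + 1 / (b * logGap A.δ₀)) with hK
  have hK0 : 0 ≤ K := by rw [hK]; positivity
  set K' := (1 + A.δ₀) / A.l + 1 / A.l with hK'
  have hK'0 : 0 ≤ K' := by rw [hK']; positivity
  set E₁ := n * ((1 + A.δ₀) ^ 2 * A.h ^ 2 / (A.l ^ 2 * b))
    * (2 * (n * m) * (1 + Real.log A.T) ^ 2) with hE₁
  set E₂ := (1 + A.δ₀) / A.l * (4 * A.width * (n * m * Real.sqrt A.T)) with hE₂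
  have hE₁0 : 0 ≤ E₁ := by rw [hE₁]; positivity
  have hE₂0 : 0 ≤ E₂ := by
    have := hA.width_pos
    rw [hE₂]; positivity
  set Q : Ω → ℝ := fun ω => |typeDeviation s j f A.T ω| + E₁ + E₂
    + |typeDeviation s j (fun _ _ k => price k) A.T ω|
    + K' * ∑ a, |maskedNoise ε A.T (fun t ω => i t ω = a) ω| with hQ
  have hconfm := hrun.measurableSet_confidentEvent
  -- On the confidence event the path bound applies. Off it, the welfare is nonnegative and the
  -- optimum is at most h, so the regret is at most Th; the failure probability 2nm/T turns this
  -- into 2hnm.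
  have hpoint : ∀ᵐ ω ∂μ, regret A.B s v j i ε A.T ω
      ≤ K * Q ω + (confidentEvent A v j i ε)ᶜ.indicator (fun _ => A.T * A.h) ω := by
    filter_upwards [hrun.winner] with ω hω
    have hQ0 : 0 ≤ Q ω := by
      have h1 : 0 ≤ ∑ a, |maskedNoise ε A.T (fun t ω => i t ω = a) ω| :=
        Finset.sum_nonneg fun a _ => abs_nonneg _
      simp only [hQ]
      positivity
    by_cases hconf : ω ∈ confidentEvent A v j i ε
    · rw [Set.indicator_of_notMem (by simpa using hconf), add_zero]
      have := Alg.path_regret_le (A := A) (s := s) (v := v) (x := x) (j := fun τ => j τ ω)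
        (i := fun τ => i τ ω) (e := fun τ => ε τ ω) hA hB1 hT hs hs1 hv hconf hω hx hu hul
        hprice hprice1 hb hbB
      unfold regret
      rw [honsw]
      exact this
    · rw [Set.indicator_of_mem (by simpa using hconf)]
      have h0 : 0 ≤ nsw A.B fun a => cumUtility v j i ε A.T a ω :=
        Finset.prod_nonneg fun a _ => Real.rpow_nonneg (le_max_right _ _) _
      have h1 : (A.T : ℝ) * onsw A.B s v ≤ A.T * A.h := mul_le_mul_of_nonneg_left honsw_le hT0.le
      have h2 : 0 ≤ K * Q ω := mul_nonneg hK0 hQ0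
      unfold regret
      linarith
  have iS : Integrable (fun ω => ∑ a, |maskedNoise ε A.T (fun t ω => i t ω = a) ω|) μ :=
    integrable_finsetSum _ fun a _ => (hS a).1
  have iQE : Integrable (fun ω => |typeDeviation s j f A.T ω| + E₁ + E₂) μ :=
    (iQ.add (integrable_const E₁)).add (integrable_const E₂)
  have iQEP : Integrable (fun ω => |typeDeviation s j f A.T ω| + E₁ + E₂
    + |typeDeviation s j (fun _ _ k => price k) A.T ω|) μ := iQE.add iP
  have iQall : Integrable Q μ := iQEP.add (iS.const_mul K')
  have iind : Integrable ((confidentEvent A v j i ε)ᶜ.indicator fun _ => A.T * A.h) μ :=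
    (integrable_const _).indicator hconfm.compl
  have hQint : ∫ ω, Q ω ∂μ ≤ (1 + A.δ₀) / A.l * A.h * Real.sqrt A.T + E₁ + E₂
      + A.h / A.l * Real.sqrt A.T + K' * (n * (2 * Real.exp (A.c / 4) * Real.sqrt A.T)) := by
    have iQ1 : Integrable (fun ω => |typeDeviation s j f A.T ω| + E₁) μ :=
      iQ.add (integrable_const E₁)
    rw [hQ, integral_add iQEP (iS.const_mul K'), integral_add iQE iP,
      integral_add iQ1 (integrable_const E₂), integral_add iQ (integrable_const E₁),
      integral_const_mul K', integral_finsetSum _ fun a _ => (hS a).1]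
    have h1 : ∑ a, ∫ ω, |maskedNoise ε A.T (fun t ω => i t ω = a) ω| ∂μ
        ≤ n * (2 * Real.exp (A.c / 4) * Real.sqrt A.T) :=
      (Finset.sum_le_card_nsmul _ _ _ fun a _ => (hS a).2).trans (by simp)
    have h2 := mul_le_mul_of_nonneg_left h1 hK'0
    simp only [integral_const, probReal_univ, smul_eq_mul, one_mul]
    linarith
  calc ∫ ω, regret A.B s v j i ε A.T ω ∂μ
      ≤ ∫ ω, (K * Q ω + (confidentEvent A v j i ε)ᶜ.indicator (fun _ => A.T * A.h) ω) ∂μ :=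
        integral_mono_ae hint ((iQall.const_mul K).add iind) hpoint
    _ = K * ∫ ω, Q ω ∂μ + μ.real (confidentEvent A v j i ε)ᶜ * (A.T * A.h) := by
        rw [integral_add (iQall.const_mul K) iind, integral_const_mul,
          integral_indicator_const _ hconfm.compl, smul_eq_mul]
    _ ≤ _ := by
        refine add_le_add (mul_le_mul_of_nonneg_left hQint hK0) ?_
        refine (mul_le_mul_of_nonneg_right (hrun.measureReal_compl_confidentEvent_le hT hc)
          (by positivity)).trans (le_of_eq ?_)
        field_simp

/-- The constant of the regret bound. -/
noncomputable def regretConst (l h δ₀ c : ℝ) : ℝ :=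
  h * (1 + 1 / logGap δ₀) * ((1 + δ₀) / l * h + 2 * ((1 + δ₀) ^ 2 * h ^ 2 / l ^ 2)
    + 4 * ((1 + δ₀) / l) * (h + 2 + 4 * c) + h / l
    + 2 * ((1 + δ₀) / l + 1 / l) * Real.exp (c / 4)) + 2 * h

theorem Alg.width_le (hA : A.Valid) (hT : 1 ≤ A.T) (hc : 0 ≤ A.c) :
    A.width ≤ (A.h + 2 + 4 * A.c) * (1 + Real.log A.T) := by
  have hL : 0 ≤ Real.log A.T := Real.log_nonneg (by exact_mod_cast hT)
  have hh := hA.h_pos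
  unfold width
  rw [Real.log_pow]
  push_cast
  -- This crude bound √y ≤ 1 + y is harmless: the harmonic term already carries the square of 1 +
  -- log T.
  have h1 : Real.sqrt (A.c * (2 * Real.log A.T)) ≤ 1 + A.c * (2 * Real.log A.T) := by
    have h0 : 0 ≤ A.c * (2 * Real.log A.T) := by positivity
    rw [Real.sqrt_le_left (by positivity)]
    nlinarith
  nlinarith [mul_nonneg hh.le hL]

/-- The expected regret in terms of a lower bound on the weights. -/
theorem IsRun.integral_regret_le_const [IsProbabilityMeasure μ] (hrun : IsRun μ A s v σ j i ε)
    (hA : A.Valid) (hB1 : ∑ a, A.B a = 1) (hT : 1 ≤ A.T) (hs : ∀ k, 0 ≤ s k)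
    (hs1 : ∑ k, s k = 1) (hv : ∀ a k, A.l ≤ v a k ∧ v a k ≤ A.h) (hc : 2 * σ ^ 2 ≤ A.c)
    {b : ℝ} (hb : 0 < b) (hbB : ∀ a, b ≤ A.B a) :
    ∫ ω, regret A.B s v j i ε A.T ω ∂μ ≤ regretConst A.l A.h A.δ₀ A.c * (n ^ 2 * m ^ 2 / b ^ 2)
      * Real.sqrt A.T * (1 + Real.log A.T) ^ 2 := by
  refine (hrun.integral_regret_le hA hB1 hT hs hs1 hv hc hb hbB).2.trans ?_
  have hδ := hA.δ₀_pos
  have hl := hA.l_pos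
  have hh := hA.h_pos
  have hγ := logGap_pos hδ
  have hc0 : 0 ≤ A.c := by nlinarith [sq_nonneg σ]
  have hn : 1 ≤ n := by
    rcases Nat.eq_zero_or_pos n with h | h
    · subst h; simp at hB1
    · exact h
  have hm : 1 ≤ m := by
    rcases Nat.eq_zero_or_pos m with h | h
    · subst h; simp at hs1
    · exact h
  have hb1 : b ≤ 1 := (hbB ⟨0, hn⟩).trans (hA.B_le_one _)
  have hw := Alg.width_le hA hT hc0
  have hw0 := hA.width_pos
  have hN : (1 : ℝ) ≤ n := by exact_mod_cast hn
  have hM : (1 : ℝ) ≤ m := by exact_mod_cast hm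
  have hR : 1 ≤ Real.sqrt A.T := by
    rw [Real.one_le_sqrt]; exact_mod_cast hT
  have hL : 1 ≤ 1 + Real.log A.T := by
    have : 0 ≤ Real.log A.T := Real.log_nonneg (by exact_mod_cast hT)
    linarith
  set R := Real.sqrt A.T
  set L := 1 + Real.log A.T
  have hib : 1 ≤ 1 / b := by rw [le_div_iff₀ hb]; linarith
  -- X carries only one factor 1/b, from the harmonic term; the other comes from the prefactor in
  -- `tK`.
  set X := (n : ℝ) ^ 2 * m ^ 2 / b * R * L ^ 2 with hX
  -- each error term is at most a constant times `X`
  have hNM : (1 : ℝ) ≤ n * m := one_le_mul_of_one_le_of_one_le hN hM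
  have hNM2 : (n : ℝ) * m ≤ n ^ 2 * m ^ 2 := by nlinarith
  have hL2 : L ≤ L ^ 2 := by nlinarith
  have hX' : X = n ^ 2 * m ^ 2 * (1 / b) * R * L ^ 2 := by rw [hX]; ring
  have hRX : n * m * (1 : ℝ) * R * L ≤ X := by rw [hX']; gcongr
  have hRX1 : R ≤ X := by
    calc R = 1 * 1 * R * 1 := by ring
      _ ≤ n * m * 1 * R * L := by gcongr
      _ ≤ X := hRX
  have hnX : n * R ≤ X := by
    calc n * R = n * 1 * 1 * R * 1 := by ring
      _ ≤ n * m * 1 * R * L := by gcongr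
      _ ≤ X := hRX
  have hX0 : 0 ≤ X := by positivity
  have t1 : (1 + A.δ₀) / A.l * A.h * R ≤ (1 + A.δ₀) / A.l * A.h * X :=
    mul_le_mul_of_nonneg_left hRX1 (by positivity)
  have t2 : n * ((1 + A.δ₀) ^ 2 * A.h ^ 2 / (A.l ^ 2 * b)) * (2 * (n * m) * L ^ 2)
      ≤ 2 * ((1 + A.δ₀) ^ 2 * A.h ^ 2 / A.l ^ 2) * X := by
    have : n * ((1 + A.δ₀) ^ 2 * A.h ^ 2 / (A.l ^ 2 * b)) * (2 * (n * m) * L ^ 2)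
        = 2 * ((1 + A.δ₀) ^ 2 * A.h ^ 2 / A.l ^ 2) * (n ^ 2 * m * (1 / b) * 1 * L ^ 2) := by
      field_simp
    rw [this, hX']
    have hm2 : (m : ℝ) ≤ m ^ 2 := by nlinarith
    gcongr
  have t3 : (1 + A.δ₀) / A.l * (4 * A.width * (n * m * R))
      ≤ 4 * ((1 + A.δ₀) / A.l) * (A.h + 2 + 4 * A.c) * X := by
    calc (1 + A.δ₀) / A.l * (4 * A.width * (n * m * R))
        ≤ (1 + A.δ₀) / A.l * (4 * ((A.h + 2 + 4 * A.c) * L) * (n * m * R)) := by gcongr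
      _ = 4 * ((1 + A.δ₀) / A.l) * (A.h + 2 + 4 * A.c) * (n * m * 1 * R * L) := by ring
      _ ≤ _ := mul_le_mul_of_nonneg_left hRX (by positivity)
  have t4 : A.h / A.l * R ≤ A.h / A.l * X := mul_le_mul_of_nonneg_left hRX1 (by positivity)
  have t5 : ((1 + A.δ₀) / A.l + 1 / A.l) * (n * (2 * Real.exp (A.c / 4) * R))
      ≤ 2 * ((1 + A.δ₀) / A.l + 1 / A.l) * Real.exp (A.c / 4) * X := by
    calc ((1 + A.δ₀) / A.l + 1 / A.l) * (n * (2 * Real.exp (A.c / 4) * R))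
        = 2 * ((1 + A.δ₀) / A.l + 1 / A.l) * Real.exp (A.c / 4) * (n * R) := by ring
      _ ≤ _ := mul_le_mul_of_nonneg_left hnX (by positivity)
  have tK : A.h * (1 + 1 / (b * logGap A.δ₀)) ≤ A.h * (1 + 1 / logGap A.δ₀) * (1 / b) := by
    have : A.h * (1 + 1 / logGap A.δ₀) * (1 / b) = A.h * (1 / b + 1 / (b * logGap A.δ₀)) := by
      field_simp
    rw [this]; gcongr
  have t6 : 2 * A.h * (n * m) ≤ 2 * A.h * (1 / b * X) := by
    refine mul_le_mul_of_nonneg_left ?_ (by positivity)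
    calc (n : ℝ) * m = 1 * (n * m * 1 * 1 * 1) := by ring
      _ ≤ 1 / b * (n * m * 1 * R * L) := by gcongr
      _ ≤ 1 / b * X := by gcongr
  have hfin : regretConst A.l A.h A.δ₀ A.c * (n ^ 2 * m ^ 2 / b ^ 2) * R * L ^ 2
      = A.h * (1 + 1 / logGap A.δ₀) * (1 / b) * (((1 + A.δ₀) / A.l * A.h) * X
        + 2 * ((1 + A.δ₀) ^ 2 * A.h ^ 2 / A.l ^ 2) * X
        + 4 * ((1 + A.δ₀) / A.l) * (A.h + 2 + 4 * A.c) * X + A.h / A.l * X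
        + 2 * ((1 + A.δ₀) / A.l + 1 / A.l) * Real.exp (A.c / 4) * X)
        + 2 * A.h * (1 / b * X) := by
    have : (n : ℝ) ^ 2 * m ^ 2 / b ^ 2 * R * L ^ 2 = 1 / b * X := by
      rw [hX]; field_simp
    rw [regretConst]
    linear_combination (A.h * (1 + 1 / logGap A.δ₀) * ((1 + A.δ₀) / A.l * A.h
      + 2 * ((1 + A.δ₀) ^ 2 * A.h ^ 2 / A.l ^ 2)
      + 4 * ((1 + A.δ₀) / A.l) * (A.h + 2 + 4 * A.c) + A.h / A.l
      + 2 * ((1 + A.δ₀) / A.l + 1 / A.l) * Real.exp (A.c / 4)) + 2 * A.h) * this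
  rw [hfin]
  refine add_le_add (mul_le_mul tK ?_ (by positivity) (by positivity)) t6
  linarith

end FairDivision

theorem theorem2 :
    ∃ p : ℕ, ∀ l h δ₀ c : ℝ, 0 < l → 0 < δ₀ → ∃ C : ℝ,
      ∀ (n m T : ℕ) (B : Fin n → ℝ) (s : Fin m → ℝ) (v : Fin n → Fin m → ℝ) (σ : ℝ),
        1 ≤ T → (∀ i, 0 < B i) → ∑ i, B i = 1 → (∀ j, 0 ≤ s j) → ∑ j, s j = 1 →
        (∀ i j, l ≤ v i j ∧ v i j ≤ h) → 2 * σ ^ 2 ≤ c →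
        ∀ (Ω : Type*) [MeasurableSpace Ω] (μ : MeasureTheory.Measure Ω)
          [MeasureTheory.IsProbabilityMeasure μ]
          (j : ℕ → Ω → Fin m) (i : ℕ → Ω → Fin n) (ε : ℕ → Ω → ℝ),
          FairDivision.IsRun μ ⟨T, B, l, h, δ₀, c⟩ s v σ j i ε →
          MeasureTheory.Integrable (FairDivision.regret B s v j i ε T) μ ∧
          ∫ ω, FairDivision.regret B s v j i ε T ω ∂μ
            ≤ C * (n ^ 2 * m ^ 2 / (⨅ i, B i) ^ 2) * Real.sqrt T * (1 + Real.log T) ^ p ∧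
          ((∀ i, B i = 1 / n) →
            ∫ ω, FairDivision.regret B s v j i ε T ω ∂μ
              ≤ C * (n ^ 4 * m ^ 2) * Real.sqrt T * (1 + Real.log T) ^ p) := by
  -- The exponent is 2 because one logarithm counts the restarts and the other is the harmonic sum
  -- of each instance.
  refine ⟨2, fun l h δ₀ c hl hδ => ⟨FairDivision.regretConst l h δ₀ c, ?_⟩⟩
  intro n m T B s v σ hT hB hB1 hs hs1 hv hc Ω _ μ _ j i ε hrun
  have hn : n ≠ 0 := by rintro rfl; simp at hB1
  have hm : m ≠ 0 := by rintro rfl; simp at hs1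
  have : Nonempty (Fin n) := ⟨⟨0, Nat.pos_of_ne_zero hn⟩⟩
  have hlh : l ≤ h := by
    have := hv ⟨0, Nat.pos_of_ne_zero hn⟩ ⟨0, Nat.pos_of_ne_zero hm⟩
    exact this.1.trans this.2
  have hA : (⟨T, B, l, h, δ₀, c⟩ : FairDivision.Alg n).Valid :=
    ⟨hl, hlh, hδ, hB, fun a => hB1 ▸ Finset.single_le_sum (fun a _ => (hB a).le)
      (Finset.mem_univ a)⟩
  obtain ⟨a, ha⟩ := exists_eq_ciInf_of_finite (f := B)
  have hb : 0 < ⨅ a, B a := ha ▸ hB a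
  have hbB : ∀ a, ⨅ a, B a ≤ B a := fun a => ciInf_le (Set.finite_range B).bddBelow a
  have hbound := hrun.integral_regret_le_const hA hB1 hT hs hs1 hv hc hb hbB
  refine ⟨(hrun.integral_regret_le hA hB1 hT hs hs1 hv hc hb hbB).1, hbound, fun heq => ?_⟩
  refine hbound.trans (le_of_eq ?_)
  have hinf : ⨅ a, B a = 1 / n := by rw [← ha, heq a]
  have hn0 : (n : ℝ) ≠ 0 := by exact_mod_cast hn
  have hpow : (n : ℝ) ^ 2 * m ^ 2 / (1 / n) ^ 2 = n ^ 4 * m ^ 2 := by field_simp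
  dsimp only
  rw [hinf, hpow]
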